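/- Let $d\ge 3$ be an integer, let $c\neq 0$ be a real number with $c<\left(\frac{d-2}{2}\right)^2$, and let $\frac4d<\alpha<\frac4{d-2}$ and $\omega>0$. Let $H^1=H^1(\mathbb R^d;\mathbb C)$, regarded as a real Hilbert space, and let $H^1_{\mathrm{rad}}$ be the set of radial functions in $H^1$, i.e. of those $v\in H^1$ with $v(Rx)=v(x)$ for a.e. $x$, for every linear isometry $R$ of $\mathbb R^d$. For $v\in H^1$ put $$\|v\|_{\dot H^1_c}^2=\|\nabla v\|_{L^2}^2-c\,\||x|^{-1}v\|_{L^2}^2,$$ $$S_\omega(v)=\tfrac12\|v\|_{\dot H^1_c}^2+\tfrac{\omega}{2}\|v\|_{L^2}^2-\tfrac1{\alpha+2}\|v\|_{L^{\alpha+2}}^{\alpha+2},\qquad K_\omega(v)=\|v\|_{\dot H^1_c}^2+\omega\|v\|_{L^2}^2-\|v\|_{L^{\alpha+2}}^{\alpha+2}.$$ Let $$\mathcal A_{\mathrm{rad},\omega}=\{v\in H^1_{\mathrm{rad}}\setminus\{0\}: S_\omega'(v)=0\},$$ where $S_\omega'$ is the Fréchet derivative of $S_\omega:H^1\to\mathbb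 R$; this is the set of nontrivial radial $H^1$ solutions of $-\Delta\phi+\omega\phi-c|x|^{-2}\phi-|\phi|^\alpha\phi=0$. The set of radial ground states is $$\mathcal G_{\mathrm{rad},\omega}=\{\phi\in\mathcal A_{\mathrm{rad},\omega}: S_\omega(\phi)\le S_\omega(v)\ \text{for all } v\in\mathcal A_{\mathrm{rad},\omega}\},$$ and $$d(\mathrm{rad},\omega)=\inf\{S_\omega(v): v\in H^1_{\mathrm{rad}}\setminus\{0\},\ K_\omega(v)=0\}.$$ Then the integrals $\||x|^{-1}v\|_{L^2}^2$ and $\|v\|_{L^{\alpha+2}}^{\alpha+2}$ are finite for all $v\in H^1$, $K_\omega(v)=\partial_\lambda S_\omega(\lambda v)|_{\lambda=1}$ for all $v\in H^1$, the infimum $d(\mathrm{rad},\omega)$ is a finite real number (it is taken over a nonempty set of reals that is bounded below), the set $\mathcal G_{\mathrm{rad},\omega}$ is not empty, and $$\mathcal G_{\mathrm{rad},\omega}=\{v\in H^1_{\mathrm{rad}}\setminus\{0\}: S_\omega(v)=d(\mathrm{rad},\omega),\ K_\omega(v)=0\}.$$ -/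

import Mathlib

open MeasureTheory Set

namespace InverseSquareNLS

/-- The Hilbert space of pairs `(u, G)` with `u : ℝᵈ → ℂ` and `G : ℝᵈ → ℂᵈ` square integrable,
with norm `(‖u‖² + ‖G‖²)^(1/2)`. All vector spaces are taken over `ℝ`. -/
abbrev L2Pair (d : ℕ) : Type :=
  WithLp 2 (Lp ℂ 2 (volume : Measure (EuclideanSpace ℝ (Fin d))) ×
    Lp (EuclideanSpace ℂ (Fin d)) 2 (volume : Measure (EuclideanSpace ℝ (Fin d))))

/-- `G` is the weak (distributional) gradient of `u` on `ℝᵈ`: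
`∫ (∂ᵢφ) u = - ∫ φ Gᵢ` for every real test function `φ` and every coordinate `i`. -/
def IsWeakGradient {d : ℕ} (u : EuclideanSpace ℝ (Fin d) → ℂ)
    (G : EuclideanSpace ℝ (Fin d) → EuclideanSpace ℂ (Fin d)) : Prop :=
  ∀ φ : EuclideanSpace ℝ (Fin d) → ℝ, ContDiff ℝ (⊤ : ℕ∞) φ → HasCompactSupport φ → ∀ i : Fin d,
    ∫ x, fderiv ℝ φ x (EuclideanSpace.single i 1) • u x = -∫ x, φ x • G x i

theorem integrable_smul_of_memLp {d : ℕ} {φ : EuclideanSpace ℝ (Fin d) → ℝ}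
    {u : EuclideanSpace ℝ (Fin d) → ℂ} (hφ : Continuous φ) (hs : HasCompactSupport φ)
    (hu : MemLp u 2 volume) : Integrable (fun x ↦ φ x • u x) :=
  memLp_one_iff_integrable.1 (hu.smul (p := 2) (q := 2) (hφ.memLp_of_hasCompactSupport hs))

theorem memLp_coord {d : ℕ} {G : EuclideanSpace ℝ (Fin d) → EuclideanSpace ℂ (Fin d)}
    (hG : MemLp G 2 volume) (i : Fin d) : MemLp (fun x ↦ G x i) 2 volume :=
  (EuclideanSpace.proj i : EuclideanSpace ℂ (Fin d) →L[ℂ] ℂ).comp_memLp' hG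

theorem continuous_partial {d : ℕ} {φ : EuclideanSpace ℝ (Fin d) → ℝ} (hφ : ContDiff ℝ (⊤ : ℕ∞) φ)
    (i : Fin d) : Continuous (fun x ↦ fderiv ℝ φ x (EuclideanSpace.single i 1)) :=
  (hφ.continuous_fderiv (by simp)).clm_apply continuous_const

theorem hasCompactSupport_partial {d : ℕ} {φ : EuclideanSpace ℝ (Fin d) → ℝ}
    (hs : HasCompactSupport φ) (i : Fin d) :
    HasCompactSupport (fun x ↦ fderiv ℝ φ x (EuclideanSpace.single i 1)) :=
  hs.fderiv_apply (𝕜 := ℝ) _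

/-- The Sobolev space `H¹(ℝᵈ; ℂ)`, a real Hilbert space with the norm
`(‖u‖²_{L²} + ‖∇u‖²_{L²})^(1/2)`. An element is a class `u` in `L²` together with its weak
gradient, which is in `L²` and is determined by `u`. -/
def H1 (d : ℕ) : Submodule ℝ (L2Pair d) where
  carrier := {p | IsWeakGradient (p.fst : EuclideanSpace ℝ (Fin d) → ℂ) p.snd}
  zero_mem' := by
    intro φ _ _ i
    have h1 : ∫ x, fderiv ℝ φ x (EuclideanSpace.single i 1) • ((0 : L2Pair d).fst x) = 0 := by
      apply integral_eq_zero_of_ae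
      filter_upwards with x
      simp [WithLp.zero_fst]
    have h2 : ∫ x, φ x • ((0 : L2Pair d).snd x i) = 0 := by
      apply integral_eq_zero_of_ae
      filter_upwards with x
      simp [WithLp.zero_snd]
    rw [h1, h2, neg_zero]
  add_mem' := by
    intro p q hp hq φ hφ hs i
    have h1 : ∫ x, fderiv ℝ φ x (EuclideanSpace.single i 1) • ((p + q).fst x)
        = (∫ x, fderiv ℝ φ x (EuclideanSpace.single i 1) • p.fst x)
          + ∫ x, fderiv ℝ φ x (EuclideanSpace.single i 1) • q.fst x := by
      rw [← integral_add
        (integrable_smul_of_memLp (continuous_partial hφ i) (hasCompactSupport_partial hs i)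
          (Lp.memLp p.fst))
        (integrable_smul_of_memLp (continuous_partial hφ i) (hasCompactSupport_partial hs i)
          (Lp.memLp q.fst))]
      apply integral_congr_ae
      filter_upwards [Lp.coeFn_add p.fst q.fst] with x hx
      rw [WithLp.add_fst, hx, Pi.add_apply, smul_add]
    have h2 : ∫ x, φ x • ((p + q).snd x i)
        = (∫ x, φ x • p.snd x i) + ∫ x, φ x • q.snd x i := by
      rw [← integral_add
        (integrable_smul_of_memLp hφ.continuous hs (memLp_coord (Lp.memLp p.snd) i))
        (integrable_smul_of_memLp hφ.continuous hs (memLp_coord (Lp.memLp q.snd) i))]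
      apply integral_congr_ae
      filter_upwards [Lp.coeFn_add p.snd q.snd] with x hx
      rw [WithLp.add_snd, hx, Pi.add_apply, PiLp.add_apply, smul_add]
    rw [h1, h2, hp φ hφ hs i, hq φ hφ hs i, neg_add]
  smul_mem' := by
    intro a p hp φ hφ hs i
    have h1 : ∫ x, fderiv ℝ φ x (EuclideanSpace.single i 1) • ((a • p).fst x)
        = a • ∫ x, fderiv ℝ φ x (EuclideanSpace.single i 1) • p.fst x := by
      rw [← integral_smul]
      apply integral_congr_ae
      filter_upwards [Lp.coeFn_smul a p.fst] with x hx
      rw [WithLp.smul_fst, hx, Pi.smul_apply, smul_comm]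
    have h2 : ∫ x, φ x • ((a • p).snd x i) = a • ∫ x, φ x • p.snd x i := by
      rw [← integral_smul]
      apply integral_congr_ae
      filter_upwards [Lp.coeFn_smul a p.snd] with x hx
      rw [WithLp.smul_snd, hx, Pi.smul_apply, PiLp.smul_apply, smul_comm]
    rw [h1, h2, hp φ hφ hs i, smul_neg]

/-- The underlying function of an element of `H¹` (defined up to null sets). -/
noncomputable def H1.toFun {d : ℕ} (v : H1 d) : EuclideanSpace ℝ (Fin d) → ℂ :=
  (v : L2Pair d).fst

/-- The weak gradient of an element of `H¹` (defined up to null sets). -/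
noncomputable def H1.grad {d : ℕ} (v : H1 d) :
    EuclideanSpace ℝ (Fin d) → EuclideanSpace ℂ (Fin d) :=
  (v : L2Pair d).snd

/-- The set `H¹_rad` of radial `H¹` functions: those invariant, as classes of functions, under
every linear isometry of `ℝᵈ`. -/
def H1rad (d : ℕ) : Set (H1 d) :=
  {v | ∀ R : EuclideanSpace ℝ (Fin d) ≃ₗᵢ[ℝ] EuclideanSpace ℝ (Fin d),
    (fun x ↦ H1.toFun v (R x)) =ᵐ[volume] H1.toFun v}

/-- The Hardy functional `‖∇v‖²_{L²} - c ‖|x|⁻¹ v‖²_{L²}`. -/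
noncomputable def hardy {d : ℕ} (c : ℝ) (v : H1 d) : ℝ :=
  (∫ x, ‖H1.grad v x‖ ^ 2) - c * ∫ x, ‖(‖x‖⁻¹ : ℝ) • H1.toFun v x‖ ^ 2

/-- The action functional
`S_ω(v) = ½ (‖∇v‖² - c ‖|x|⁻¹ v‖²) + (ω/2) ‖v‖² - (α+2)⁻¹ ‖v‖_{L^{α+2}}^{α+2}`. -/
noncomputable def action {d : ℕ} (c α ω : ℝ) (v : H1 d) : ℝ :=
  1 / 2 * hardy c v + ω / 2 * (∫ x, ‖H1.toFun v x‖ ^ 2)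
    - 1 / (α + 2) * ∫ x, ‖H1.toFun v x‖ ^ (α + 2)

/-- The Nehari functional
`K_ω(v) = (‖∇v‖² - c ‖|x|⁻¹ v‖²) + ω ‖v‖² - ‖v‖_{L^{α+2}}^{α+2}`. -/
noncomputable def nehari {d : ℕ} (c α ω : ℝ) (v : H1 d) : ℝ :=
  hardy c v + ω * (∫ x, ‖H1.toFun v x‖ ^ 2) - ∫ x, ‖H1.toFun v x‖ ^ (α + 2)

/-- The set `A_{rad,ω}` of nontrivial radial solutions in `H¹` of
`-Δφ + ωφ - c|x|⁻²φ - |φ|^α φ = 0`: the nonzero radial `H¹` functions at which the action, as a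
functional on the whole space `H¹`, has Fréchet derivative zero. -/
def radialSolutions (d : ℕ) (c α ω : ℝ) : Set (H1 d) :=
  {v | v ∈ H1rad d ∧ v ≠ 0 ∧ HasFDerivAt (action c α ω) (0 : H1 d →L[ℝ] ℝ) v}

/-- The set `G_{rad,ω}` of radial ground states: the minimizers of the action over the nontrivial
radial solutions. -/
def radialGroundStates (d : ℕ) (c α ω : ℝ) : Set (H1 d) :=
  {φ | φ ∈ radialSolutions d c α ω ∧
    ∀ v ∈ radialSolutions d c α ω, action c α ω φ ≤ action c α ω v}

/-- The radial Nehari manifold. -/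
def radialNehari (d : ℕ) (c α ω : ℝ) : Set (H1 d) :=
  {v | v ∈ H1rad d ∧ v ≠ 0 ∧ nehari c α ω v = 0}

/-- `d(rad, ω)`, the infimum of the action over the radial Nehari manifold. -/
noncomputable def dRad (d : ℕ) (c α ω : ℝ) : ℝ :=
  sInf (action c α ω '' radialNehari d c α ω)

end InverseSquareNLS

/-! ### Averages, mollification and gradients -/

namespace InverseSquareNLS

open Filter Topology Convolution ContinuousLinearMap
open scoped ENNReal NNReal

/-! Put `p = α + 2`, so that `2 < p < 2d/(d-2)`, and write the action as `½ B(v,v) - (1/p) N(v)`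
with `N(v) = ∫ |v|ᵖ` and `B` the quadratic part. Hardy's inequality with constant `2/(d-2)` makes
`B` a bounded symmetric form, coercive on `H¹` because `c` is below the Hardy threshold
(`exists_energyForm`).

On radial functions `N(v) ≤ M B(v,v)^(p/2)` with a best constant `M` that is attained
(`exists_maximizer`), because `N` is weakly sequentially continuous there. On the Nehari manifold `B
= N`, so this inequality forces `B ≥ q`, where `M q^(p/2-1) = 1`. The action equals `(1/2 - 1/p) B`
on that set, so its infimum is `(1/2 - 1/p) q`, attained at a multiple of the maximizer. Any
minimizer `v` gives equality in `N ≤ M B^(p/2)`, so it minimizes the difference of the two sides,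
and the first-order condition is already `N'(v) = p B(v,·)` on radial directions, with no Lagrange
multiplier to eliminate (`exists_isLeast_nehari`). Symmetric criticality
(`H1.eq_zero_of_forall_radial`) extends it to all of `H¹`. Conversely, differentiating along
dilations puts every radial solution on the Nehari manifold. The two minimization problems therefore
have the same value and the same minimizers (`radialGroundStates_eq`).

Weak continuity of `N` is the compactness of the radial embedding in `Lᵖ`
(`H1.tendsto_eLpNorm_of_weakly_null`). The mass of a radial function in a distant ball recurs in
many disjoint rotated balls, so it is small; mollifications thus decay uniformly at infinity, and on
bounded sets weak convergence and domination suffice. The mollification error is uniformly small by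
the `L²` translation estimate interpolated with the critical Sobolev bound. The Hardy, Sobolev and
translation inequalities are proved for test functions and carried to `H¹` by mollification, cutoff
and Fatou. -/

/-- **Minkowski's integral inequality** for averages against a probability measure. -/
theorem eLpNorm_integral_le_of_forall {X Y F : Type*} [MeasurableSpace X] [MeasurableSpace Y]
    [NormedAddCommGroup F] [NormedSpace ℝ F] {μ : Measure X} {ν : Measure Y} [SFinite μ]
    [IsProbabilityMeasure ν] {U : X → Y → F} (hU : StronglyMeasurable (Function.uncurry U))
    {p : ℝ≥0∞} (hp : 1 ≤ p) (hp' : p ≠ ∞) {A : ℝ≥0∞}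
    (hA : ∀ᵐ y ∂ν, eLpNorm (fun x ↦ U x y) p μ ≤ A) :
    eLpNorm (fun x ↦ ∫ y, U x y ∂ν) p μ ≤ A := by
  have hp0 : p ≠ 0 := (zero_lt_one.trans_le hp).ne'
  have hpr : 0 < p.toReal := ENNReal.toReal_pos hp0 hp'
  -- Jensen's inequality in the form `L¹ ≤ Lᵖ` on a probability space; Tonelli then exchanges the
  -- two integrals.
  have jensen : ∀ x, ‖∫ y, U x y ∂ν‖ₑ ^ p.toReal ≤ ∫⁻ y, ‖U x y‖ₑ ^ p.toReal ∂ν := by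
    intro x
    have hm : AEStronglyMeasurable (U x) ν :=
      (hU.comp_measurable measurable_prodMk_left).aestronglyMeasurable
    have h1 : ‖∫ y, U x y ∂ν‖ₑ ≤ eLpNorm (U x) p ν := by
      refine (enorm_integral_le_lintegral_enorm _).trans ?_
      rw [← eLpNorm_one_eq_lintegral_enorm]
      exact eLpNorm_le_eLpNorm_of_exponent_le hp hm
    rw [eLpNorm_eq_lintegral_rpow_enorm_toReal hp0 hp'] at h1
    calc ‖∫ y, U x y ∂ν‖ₑ ^ p.toReal
        ≤ ((∫⁻ y, ‖U x y‖ₑ ^ p.toReal ∂ν) ^ (1 / p.toReal)) ^ p.toReal := by gcongr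
      _ = ∫⁻ y, ‖U x y‖ₑ ^ p.toReal ∂ν := by
        rw [← ENNReal.rpow_mul, one_div_mul_cancel hpr.ne', ENNReal.rpow_one]
  have hmeas : Measurable (fun q : X × Y ↦ ‖U q.1 q.2‖ₑ ^ p.toReal) :=
    hU.enorm.pow_const _
  have key : ∫⁻ x, ‖∫ y, U x y ∂ν‖ₑ ^ p.toReal ∂μ ≤ A ^ p.toReal := by
    calc ∫⁻ x, ‖∫ y, U x y ∂ν‖ₑ ^ p.toReal ∂μ
        ≤ ∫⁻ x, ∫⁻ y, ‖U x y‖ₑ ^ p.toReal ∂ν ∂μ := lintegral_mono jensen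
      _ = ∫⁻ y, ∫⁻ x, ‖U x y‖ₑ ^ p.toReal ∂μ ∂ν :=
        lintegral_lintegral_swap hmeas.aemeasurable
      _ ≤ ∫⁻ y, A ^ p.toReal ∂ν := by
        refine lintegral_mono_ae (hA.mono fun y hy ↦ ?_)
        rw [eLpNorm_eq_lintegral_rpow_enorm_toReal hp0 hp', one_div,
          ENNReal.rpow_inv_le_iff hpr] at hy
        exact hy
      _ = A ^ p.toReal := by simp
  rw [eLpNorm_eq_lintegral_rpow_enorm_toReal hp0 hp', one_div, ENNReal.rpow_inv_le_iff hpr]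
  exact key

section Mollification

variable {d : ℕ}

/-- The probability measure with density the normalized bump function `φ`. -/
noncomputable def bumpMeasure (φ : ContDiffBump (0 : EuclideanSpace ℝ (Fin d))) :
    Measure (EuclideanSpace ℝ (Fin d)) :=
  volume.withDensity fun y ↦ ENNReal.ofReal (φ.normed volume y)

instance (φ : ContDiffBump (0 : EuclideanSpace ℝ (Fin d))) :
    IsProbabilityMeasure (bumpMeasure φ) where
  measure_univ := by
    rw [bumpMeasure, withDensity_apply _ MeasurableSet.univ, Measure.restrict_univ,
      ← ofReal_integral_eq_lintegral_ofReal φ.integrable_normed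
        (Eventually.of_forall fun x ↦ φ.nonneg_normed x), φ.integral_normed, ENNReal.ofReal_one]

variable {F : Type*} [NormedAddCommGroup F] [NormedSpace ℝ F]

theorem integral_bumpMeasure (φ : ContDiffBump (0 : EuclideanSpace ℝ (Fin d)))
    (f : EuclideanSpace ℝ (Fin d) → F) :
    ∫ y, f y ∂(bumpMeasure φ) = ∫ y, φ.normed volume y • f y := by
  rw [bumpMeasure, integral_withDensity_eq_integral_toReal_smul
    (φ.continuous_normed.measurable.ennreal_ofReal) (by simp)]
  exact integral_congr_ae (Eventually.of_forall fun y ↦ by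
    simp [ENNReal.toReal_ofReal (φ.nonneg_normed y)])

theorem ae_bumpMeasure (φ : ContDiffBump (0 : EuclideanSpace ℝ (Fin d))) :
    ∀ᵐ y ∂(bumpMeasure φ), ‖y‖ < φ.rOut := by
  rw [bumpMeasure, ae_withDensity_iff φ.continuous_normed.measurable.ennreal_ofReal]
  refine Eventually.of_forall fun y hy ↦ ?_
  have : y ∈ Function.support (φ.normed volume) := fun h ↦ hy (by simp [h])
  rw [φ.support_normed_eq] at this
  simpa using this

/-- The mollification of `u` by the normalized bump function `φ`. -/
noncomputable def mollify (φ : ContDiffBump (0 : EuclideanSpace ℝ (Fin d)))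
    (u : EuclideanSpace ℝ (Fin d) → F) : EuclideanSpace ℝ (Fin d) → F :=
  φ.normed volume ⋆[lsmul ℝ ℝ, volume] u

theorem mollify_apply (φ : ContDiffBump (0 : EuclideanSpace ℝ (Fin d)))
    (u : EuclideanSpace ℝ (Fin d) → F) (x : EuclideanSpace ℝ (Fin d)) :
    mollify φ u x = ∫ y, u (x - y) ∂(bumpMeasure φ) := by
  rw [integral_bumpMeasure]; rfl

theorem mollify_apply' (φ : ContDiffBump (0 : EuclideanSpace ℝ (Fin d)))
    (u : EuclideanSpace ℝ (Fin d) → F) (x : EuclideanSpace ℝ (Fin d)) :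
    mollify φ u x = ∫ y, φ.normed volume (x - y) • u y :=
  convolution_lsmul_swap

/-- A mollification averages translates against a probability measure, and all translates have the
same norm. -/
theorem eLpNorm_mollify_le (φ : ContDiffBump (0 : EuclideanSpace ℝ (Fin d)))
    {u : EuclideanSpace ℝ (Fin d) → F} (hu : StronglyMeasurable u) {p : ℝ≥0∞} (hp : 1 ≤ p)
    (hp' : p ≠ ∞) : eLpNorm (mollify φ u) p volume ≤ eLpNorm u p volume := by
  have : mollify φ u = fun x ↦ ∫ y, u (x - y) ∂(bumpMeasure φ) := funext (mollify_apply φ u)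
  rw [this]
  refine eLpNorm_integral_le_of_forall (U := fun x y ↦ u (x - y))
    (hu.comp_measurable measurable_sub) hp hp' (Eventually.of_forall fun y ↦ ?_)
  exact (eLpNorm_comp_measurePreserving hu.aestronglyMeasurable
    (measurePreserving_sub_right volume y)).le

/-- The bump measure has mass one and lives in the ball of radius `rOut`, so `u - mollify φ u` is an
average of differences `u(x) - u(x - y)` with small `y`. A bound on translations thus becomes a rate
for mollification. -/
theorem eLpNorm_sub_mollify_le [CompleteSpace F]
    (φ : ContDiffBump (0 : EuclideanSpace ℝ (Fin d)))
    {u : EuclideanSpace ℝ (Fin d) → F} (hu : StronglyMeasurable u)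
    (hloc : LocallyIntegrable u) {p : ℝ≥0∞} (hp : 1 ≤ p)
    (hp' : p ≠ ∞) {A : ℝ≥0∞}
    (hA : ∀ y : EuclideanSpace ℝ (Fin d), ‖y‖ < φ.rOut →
      eLpNorm (fun x ↦ u x - u (x - y)) p volume ≤ A) :
    eLpNorm (fun x ↦ u x - mollify φ u x) p volume ≤ A := by
  have : (fun x ↦ u x - mollify φ u x) = fun x ↦ ∫ y, (u x - u (x - y)) ∂(bumpMeasure φ) := by
    funext x
    have hint : Integrable (fun y ↦ u (x - y)) (bumpMeasure φ) := by
      have h := (φ.hasCompactSupport_normed (μ := volume)).convolutionExists_left (μ := volume) (lsmul ℝ ℝ)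
        φ.continuous_normed hloc x
      rw [bumpMeasure, integrable_withDensity_iff_integrable_smul₀'
        (φ.continuous_normed.measurable.ennreal_ofReal.aemeasurable) (by simp)]
      refine h.integrable.congr (Eventually.of_forall fun y ↦ ?_)
      simp [ENNReal.toReal_ofReal (φ.nonneg_normed y)]
    rw [integral_sub (integrable_const _) hint, mollify_apply]
    simp
  rw [this]
  refine eLpNorm_integral_le_of_forall ?_ hp hp' ((ae_bumpMeasure φ).mono fun y hy ↦ hA y hy)
  exact (hu.comp_measurable measurable_fst).sub (hu.comp_measurable measurable_sub)

theorem contDiff_mollify [CompleteSpace F] (φ : ContDiffBump (0 : EuclideanSpace ℝ (Fin d)))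
    {u : EuclideanSpace ℝ (Fin d) → F} (hu : LocallyIntegrable u) :
    ContDiff ℝ (⊤ : ℕ∞) (mollify φ u) :=
  φ.hasCompactSupport_normed.contDiff_convolution_left (n := (⊤ : ℕ∞)) (lsmul ℝ ℝ)
    φ.contDiff_normed hu

theorem fderiv_mollify [CompleteSpace F] (φ : ContDiffBump (0 : EuclideanSpace ℝ (Fin d)))
    {u : EuclideanSpace ℝ (Fin d) → F} (hu : LocallyIntegrable u)
    (x v : EuclideanSpace ℝ (Fin d)) :
    fderiv ℝ (mollify φ u) x v = ∫ y, fderiv ℝ (φ.normed volume) (x - y) v • u y := by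
  have hd : ContDiff ℝ 1 (φ.normed volume) := φ.contDiff_normed (n := 1)
  have h := φ.hasCompactSupport_normed.hasFDerivAt_convolution_left (μ := volume)
    (lsmul ℝ ℝ) hd hu x
  rw [show mollify φ u = φ.normed volume ⋆[lsmul ℝ ℝ, volume] u from rfl, h.fderiv,
    convolution_eq_swap]
  have hex := (φ.hasCompactSupport_normed (μ := volume)).fderiv (𝕜 := ℝ)
    |>.convolutionExists_left (μ := volume) ((lsmul ℝ ℝ : ℝ →L[ℝ] F →L[ℝ] F).precompL
      (EuclideanSpace ℝ (Fin d)))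
      (hd.continuous_fderiv one_ne_zero) hu x
  rw [ContinuousLinearMap.integral_apply hex.integrable_swap]
  rfl

end Mollification

section Gradient

variable {d : ℕ}

/-- The pointwise gradient of a differentiable complex-valued function. -/
noncomputable def complexGradient (u : EuclideanSpace ℝ (Fin d) → ℂ)
    (x : EuclideanSpace ℝ (Fin d)) : EuclideanSpace ℂ (Fin d) :=
  WithLp.toLp 2 fun i ↦ fderiv ℝ u x (EuclideanSpace.single i 1)

theorem apply_eq_sum_single {F : Type*} [NormedAddCommGroup F] [NormedSpace ℝ F]
    (L : EuclideanSpace ℝ (Fin d) →L[ℝ] F) (v : EuclideanSpace ℝ (Fin d)) :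
    L v = ∑ i, v i • L (EuclideanSpace.single i 1) := by
  have hv : v = ∑ i, v i • EuclideanSpace.single i (1 : ℝ) := by
    simpa using ((EuclideanSpace.basisFun (Fin d) ℝ).sum_repr v).symm
  conv_lhs => rw [hv]
  simp only [map_sum, map_smul]

/-- Cauchy–Schwarz in the coordinates of the direction. It lets estimates stated with the operator
norm of the derivative be used for the Euclidean norm of the gradient. -/
theorem norm_fderiv_le_complexGradient (u : EuclideanSpace ℝ (Fin d) → ℂ)
    (x : EuclideanSpace ℝ (Fin d)) : ‖fderiv ℝ u x‖ ≤ ‖complexGradient u x‖ := by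
  refine ContinuousLinearMap.opNorm_le_bound _ (norm_nonneg _) fun v ↦ ?_
  have h1 : ‖fderiv ℝ u x v‖ ≤ ∑ i, ‖complexGradient u x i‖ * ‖v i‖ := by
    rw [apply_eq_sum_single (fderiv ℝ u x) v]
    refine (norm_sum_le _ _).trans (Finset.sum_le_sum fun i _ ↦ ?_)
    rw [norm_smul, mul_comm]
    rfl
  refine h1.trans ?_
  rw [EuclideanSpace.norm_eq, EuclideanSpace.norm_eq]
  exact Real.sum_mul_le_sqrt_mul_sqrt _ _ _

theorem continuous_complexGradient {u : EuclideanSpace ℝ (Fin d) → ℂ} (hu : ContDiff ℝ 1 u) :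
    Continuous (complexGradient u) := by
  refine (PiLp.continuous_toLp 2 _).comp (continuous_pi fun i ↦ ?_)
  exact (hu.continuous_fderiv one_ne_zero).clm_apply continuous_const

theorem complexGradient_smul {χ : EuclideanSpace ℝ (Fin d) → ℝ}
    {u : EuclideanSpace ℝ (Fin d) → ℂ} {x : EuclideanSpace ℝ (Fin d)}
    (hχ : DifferentiableAt ℝ χ x) (hu : DifferentiableAt ℝ u x) :
    complexGradient (fun y ↦ χ y • u y) x = χ x • complexGradient u x
      + WithLp.toLp 2 fun i ↦ fderiv ℝ χ x (EuclideanSpace.single i 1) • u x := by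
  ext i
  change fderiv ℝ (fun y ↦ χ y • u y) x _ = χ x • fderiv ℝ u x _ + fderiv ℝ χ x _ • u x
  rw [fderiv_fun_smul hχ hu]
  rfl

/-- The function `y ↦ φ(x - y)` is an admissible test function; the sign from differentiating in `y`
cancels the sign in the definition of the weak gradient. -/
theorem complexGradient_mollify (φ : ContDiffBump (0 : EuclideanSpace ℝ (Fin d)))
    {u : EuclideanSpace ℝ (Fin d) → ℂ}
    {G : EuclideanSpace ℝ (Fin d) → EuclideanSpace ℂ (Fin d)} (hu : MemLp u 2 volume)
    (hG : MemLp G 2 volume) (h : IsWeakGradient u G) :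
    complexGradient (mollify φ u) = mollify φ G := by
  funext x
  ext i
  have hloc : LocallyIntegrable u := hu.locallyIntegrable one_le_two
  change fderiv ℝ (mollify φ u) x (EuclideanSpace.single i 1) = _
  rw [fderiv_mollify φ hloc, mollify_apply']
  set ψ : EuclideanSpace ℝ (Fin d) → ℝ := fun y ↦ φ.normed volume (x - y) with hψ
  have hψs : ContDiff ℝ (⊤ : ℕ∞) ψ := φ.contDiff_normed.comp (contDiff_const.sub contDiff_id)
  have hψc : HasCompactSupport ψ :=
    φ.hasCompactSupport_normed.comp_homeomorph (Homeomorph.subLeft x)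
  have hd : Differentiable ℝ (φ.normed volume : EuclideanSpace ℝ (Fin d) → ℝ) :=
    (φ.contDiff_normed (n := 1)).differentiable one_ne_zero
  have hfd : ∀ y, fderiv ℝ ψ y (EuclideanSpace.single i 1)
      = -fderiv ℝ (φ.normed volume) (x - y) (EuclideanSpace.single i 1) := by
    intro y
    have h1 : HasFDerivAt (fun y ↦ x - y) (-ContinuousLinearMap.id ℝ _) y :=
      (hasFDerivAt_id y).const_sub x
    have := ((hd (x - y)).hasFDerivAt.comp y h1).fderiv
    rw [show ψ = φ.normed volume ∘ (fun y ↦ x - y) from rfl, this]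
    simp
  have key := h ψ hψs hψc i
  simp only [hfd, neg_smul, integral_neg, neg_inj] at key
  have hint : Integrable (fun y ↦ ψ y • G y) :=
    memLp_one_iff_integrable.1 (hG.smul (p := 2) (q := 2)
      (hψs.continuous.memLp_of_hasCompactSupport hψc))
  have h3 := (EuclideanSpace.proj i : EuclideanSpace ℂ (Fin d) →L[ℂ] ℂ).integral_comp_comm hint
  refine key.trans (Eq.trans ?_ h3)
  simp

end Gradient

end InverseSquareNLS

/-! ### Approximation by test functions -/

namespace InverseSquareNLS

open Filter Topology ContinuousLinearMap
open scoped ENNReal NNReal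

section Approximation

variable {d : ℕ}

/-- A bump function of radius `1 / (n + 1)`. -/
noncomputable def shrinkingBump (d n : ℕ) : ContDiffBump (0 : EuclideanSpace ℝ (Fin d)) where
  rIn := 1 / (2 * (n + 1))
  rOut := 1 / (n + 1)
  rIn_pos := by positivity
  rIn_lt_rOut := by
    apply one_div_lt_one_div_of_lt <;> linarith [Nat.cast_nonneg (α := ℝ) n]

theorem ae_tendsto_mollify {F : Type*} [NormedAddCommGroup F] [NormedSpace ℝ F] [CompleteSpace F]
    {u : EuclideanSpace ℝ (Fin d) → F} (hu : LocallyIntegrable u) :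
    ∀ᵐ x, Tendsto (fun n ↦ mollify (shrinkingBump d n) u x) atTop (𝓝 (u x)) := by
  -- The outer radius is exactly twice the inner one; this bounded ratio is what Lebesgue
  -- differentiation requires.
  refine ContDiffBump.ae_convolution_tendsto_right_of_locallyIntegrable (K := 2)
    tendsto_one_div_add_atTop_nhds_zero_nat (Eventually.of_forall fun n ↦ ?_) hu
  simp only [shrinkingBump]
  have : (0 : ℝ) < n + 1 := by positivity
  field_simp
  norm_num

/-- A smooth cutoff at scale `n + 1`. -/
noncomputable def cutoff (d n : ℕ) (x : EuclideanSpace ℝ (Fin d)) : ℝ :=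
  (⟨1, 2, one_pos, one_lt_two⟩ : ContDiffBump (0 : EuclideanSpace ℝ (Fin d)))
    (((n : ℝ) + 1)⁻¹ • x)

theorem contDiff_cutoff (d n : ℕ) : ContDiff ℝ (⊤ : ℕ∞) (cutoff d n) :=
  (ContDiffBump.contDiff _).comp (contDiff_const_smul _)

theorem hasCompactSupport_cutoff (d n : ℕ) : HasCompactSupport (cutoff d n) :=
  (ContDiffBump.hasCompactSupport _).comp_smul (by positivity)

theorem cutoff_nonneg (d n : ℕ) (x : EuclideanSpace ℝ (Fin d)) : 0 ≤ cutoff d n x :=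
  ContDiffBump.nonneg _

theorem cutoff_le_one (d n : ℕ) (x : EuclideanSpace ℝ (Fin d)) : cutoff d n x ≤ 1 :=
  ContDiffBump.le_one _

theorem eventually_cutoff_eq_one (x : EuclideanSpace ℝ (Fin d)) :
    ∀ᶠ n in atTop, cutoff d n x = 1 := by
  obtain ⟨N, hN⟩ := exists_nat_ge ‖x‖
  filter_upwards [eventually_ge_atTop N] with n hn
  refine ContDiffBump.one_of_mem_closedBall _ ?_
  have : (N : ℝ) ≤ n := by exact_mod_cast hn
  rw [mem_closedBall_zero_iff, norm_smul, norm_inv, Real.norm_of_nonneg (by positivity),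
    inv_mul_le_iff₀ (by positivity)]
  change ‖x‖ ≤ (n + 1) * 1
  linarith

/-- By scaling the derivative is `O(1/n)`, so cutting off costs nothing in the limit of the gradient
norms. -/
theorem exists_norm_fderiv_cutoff_le (d : ℕ) : ∃ C : ℝ, 0 ≤ C ∧
    ∀ n (x : EuclideanSpace ℝ (Fin d)), ‖fderiv ℝ (cutoff d n) x‖ ≤ C / (n + 1) := by
  set χ : ContDiffBump (0 : EuclideanSpace ℝ (Fin d)) := ⟨1, 2, one_pos, one_lt_two⟩ with hχ
  obtain ⟨C, hC⟩ := (χ.contDiff (n := 1)).continuous_fderiv one_ne_zero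
    |>.bounded_above_of_compact_support (χ.hasCompactSupport.fderiv (𝕜 := ℝ))
  refine ⟨C, (norm_nonneg _).trans (hC 0), fun n x ↦ ?_⟩
  have h1 : fderiv ℝ (cutoff d n) x
      = ((n : ℝ) + 1)⁻¹ • fderiv ℝ χ (((n : ℝ) + 1)⁻¹ • x) := fderiv_comp_smul _
  rw [h1, norm_smul, norm_inv, Real.norm_of_nonneg (by positivity), inv_mul_eq_div]
  gcongr
  exact hC _

theorem norm_toLp_fderiv_smul_le {χ : EuclideanSpace ℝ (Fin d) → ℝ}
    (x : EuclideanSpace ℝ (Fin d)) (z : ℂ) :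
    ‖(WithLp.toLp 2 fun i ↦ fderiv ℝ χ x (EuclideanSpace.single i 1) • z :
      EuclideanSpace ℂ (Fin d))‖ ≤ Real.sqrt d * ‖fderiv ℝ χ x‖ * ‖z‖ := by
  rw [EuclideanSpace.norm_eq]
  refine Real.sqrt_le_iff.2 ⟨by positivity, ?_⟩
  have : ∀ i ∈ (Finset.univ : Finset (Fin d)),
      ‖(fderiv ℝ χ x (EuclideanSpace.single i 1) • z : ℂ)‖ ^ 2
        ≤ (‖fderiv ℝ χ x‖ * ‖z‖) ^ 2 := by
    intro i _
    rw [norm_smul]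
    gcongr
    exact (fderiv ℝ χ x).unit_le_opNorm _ (by simp)
  refine (Finset.sum_le_sum this).trans ?_
  rw [Finset.sum_const, Finset.card_univ, Fintype.card_fin, nsmul_eq_mul, mul_assoc,
    mul_pow (Real.sqrt d), Real.sq_sqrt (Nat.cast_nonneg d)]

/-- Functions with a square integrable weak gradient are a.e. limits of test functions whose
gradients have asymptotically no larger norm. -/
theorem exists_testFunction_approximation {u : EuclideanSpace ℝ (Fin d) → ℂ}
    {G : EuclideanSpace ℝ (Fin d) → EuclideanSpace ℂ (Fin d)} (hum : StronglyMeasurable u)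
    (hGm : StronglyMeasurable G) (hu : MemLp u 2 volume) (hG : MemLp G 2 volume)
    (h : IsWeakGradient u G) :
    ∃ w : ℕ → EuclideanSpace ℝ (Fin d) → ℂ,
      (∀ n, ContDiff ℝ (⊤ : ℕ∞) (w n)) ∧ (∀ n, HasCompactSupport (w n)) ∧
      (∀ᵐ x, Tendsto (fun n ↦ w n x) atTop (𝓝 (u x))) ∧
      ∃ b : ℕ → ℝ≥0∞, (∀ n, eLpNorm (complexGradient (w n)) 2 volume ≤ b n) ∧
        Tendsto b atTop (𝓝 (eLpNorm G 2 volume)) := by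
  obtain ⟨C, hC0, hC⟩ := exists_norm_fderiv_cutoff_le d
  have hloc : LocallyIntegrable u := hu.locallyIntegrable one_le_two
  set m : ℕ → EuclideanSpace ℝ (Fin d) → ℂ := fun n ↦ mollify (shrinkingBump d n) u with hm
  have hms : ∀ n, ContDiff ℝ (⊤ : ℕ∞) (m n) := fun n ↦ contDiff_mollify _ hloc
  -- Mollify, then cut off. The bound `b n` is the norm of `G`, which mollification does not
  -- increase, plus the term in which the derivative falls on the cutoff.
  refine ⟨fun n x ↦ cutoff d n x • m n x, fun n ↦ (contDiff_cutoff d n).smul (hms n),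
    fun n ↦ (hasCompactSupport_cutoff d n).smul_right, ?_,
    fun n ↦ eLpNorm G 2 volume
      + ENNReal.ofReal (Real.sqrt d * (C / (n + 1))) * eLpNorm u 2 volume, fun n ↦ ?_, ?_⟩
  · filter_upwards [ae_tendsto_mollify hloc] with x hx
    refine hx.congr' ?_
    filter_upwards [eventually_cutoff_eq_one x] with n hn
    simp [hn, hm]
  · have h1 : ∀ x, ‖complexGradient (fun x ↦ cutoff d n x • m n x) x‖
        ≤ ‖complexGradient (m n) x‖ + ‖(Real.sqrt d * (C / (n + 1))) • m n x‖ := by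
      intro x
      rw [complexGradient_smul ((contDiff_cutoff d n).differentiable (by simp) x)
        ((hms n).differentiable (by simp) x)]
      refine (norm_add_le _ _).trans (add_le_add ?_ ?_)
      · rw [norm_smul, Real.norm_of_nonneg (cutoff_nonneg d n x)]
        exact mul_le_of_le_one_left (norm_nonneg _) (cutoff_le_one d n x)
      · refine (norm_toLp_fderiv_smul_le (χ := cutoff d n) x (m n x)).trans ?_
        rw [norm_smul, Real.norm_of_nonneg (by positivity)]
        gcongr
        exact hC n x
    have h2 : eLpNorm (complexGradient fun x ↦ cutoff d n x • m n x) 2 volume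
        ≤ eLpNorm (fun x ↦ ‖complexGradient (m n) x‖
          + ‖(Real.sqrt d * (C / (n + 1))) • m n x‖) 2 volume :=
      eLpNorm_mono_real h1
    have hc1 : Continuous (complexGradient (m n)) :=
      continuous_complexGradient ((hms n).of_le (by simp))
    have hm1 : AEStronglyMeasurable (fun x ↦ ‖complexGradient (m n) x‖) volume :=
      hc1.norm.aestronglyMeasurable
    have hm2 : AEStronglyMeasurable (fun x ↦ ‖(Real.sqrt d * (C / (n + 1))) • m n x‖) volume :=
      ((hms n).continuous.const_smul (Real.sqrt d * (C / (n + 1)))).norm.aestronglyMeasurable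
    have h3 := eLpNorm_add_le hm1 hm2 (p := 2) one_le_two
    refine h2.trans (h3.trans ?_)
    rw [eLpNorm_norm, eLpNorm_norm]
    refine add_le_add ?_ ?_
    · rw [hm, complexGradient_mollify _ hu hG h]
      exact eLpNorm_mollify_le _ hGm one_le_two (by simp)
    · have := eLpNorm_const_smul_le (c := Real.sqrt d * (C / (n + 1))) (f := m n) (p := 2)
        (μ := volume)
      refine this.trans ?_
      rw [← ofReal_norm, Real.norm_of_nonneg (by positivity)]
      gcongr
      exact eLpNorm_mollify_le _ hum one_le_two (by simp)
  · have h1 : Tendsto (fun n : ℕ ↦ ENNReal.ofReal (Real.sqrt d * (C / (n + 1)))) atTop (𝓝 0) := by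
      rw [← ENNReal.ofReal_zero]
      refine ENNReal.tendsto_ofReal ?_
      have := (tendsto_one_div_add_atTop_nhds_zero_nat (𝕜 := ℝ)).const_mul (Real.sqrt d * C)
      rw [mul_zero] at this
      refine this.congr fun n ↦ ?_
      ring
    have h2 := tendsto_const_nhds (x := eLpNorm G 2 volume).add
      (ENNReal.Tendsto.mul_const h1 (Or.inr hu.2.ne))
    simpa using h2

/-- An inequality `‖T w‖_q ≤ A ‖∇w‖₂` for test functions passes to `H¹` functions when `T` acts
pointwise. -/
theorem eLpNorm_le_of_testFunction_bound {F : Type*} [NormedAddCommGroup F]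
    {T : (EuclideanSpace ℝ (Fin d) → ℂ) → EuclideanSpace ℝ (Fin d) → F} {q A : ℝ≥0∞} (hA : A ≠ ∞)
    (hT : ∀ w, ContDiff ℝ (⊤ : ℕ∞) w → HasCompactSupport w →
      AEStronglyMeasurable (T w) volume ∧
        eLpNorm (T w) q volume ≤ A * eLpNorm (complexGradient w) 2 volume)
    (hlim : ∀ (w : ℕ → EuclideanSpace ℝ (Fin d) → ℂ) (u : EuclideanSpace ℝ (Fin d) → ℂ),
      (∀ᵐ x, Tendsto (fun n ↦ w n x) atTop (𝓝 (u x))) →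
        ∀ᵐ x, Tendsto (fun n ↦ T (w n) x) atTop (𝓝 (T u x)))
    {u : EuclideanSpace ℝ (Fin d) → ℂ}
    {G : EuclideanSpace ℝ (Fin d) → EuclideanSpace ℂ (Fin d)} (hum : StronglyMeasurable u)
    (hGm : StronglyMeasurable G) (hu : MemLp u 2 volume) (hG : MemLp G 2 volume)
    (h : IsWeakGradient u G) :
    eLpNorm (T u) q volume ≤ A * eLpNorm G 2 volume := by
  obtain ⟨w, hws, hwc, hwt, b, hb, hbt⟩ := exists_testFunction_approximation hum hGm hu hG h
  -- Fatou: a.e. convergence and an upper bound on the gradients are enough, so strong density in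
  -- `H¹` is never needed.
  refine (Lp.eLpNorm_lim_le_liminf_eLpNorm (fun n ↦ (hT _ (hws n) (hwc n)).1) _
    (hlim w u hwt)).trans ?_
  have h1 : Tendsto (fun n ↦ A * b n) atTop (𝓝 (A * eLpNorm G 2 volume)) :=
    ENNReal.Tendsto.const_mul hbt (Or.inr hA)
  rw [← h1.liminf_eq]
  exact liminf_le_liminf (Eventually.of_forall fun n ↦
    (hT _ (hws n) (hwc n)).2.trans (mul_le_mul_right (hb n) A))

end Approximation

end InverseSquareNLS

/-! ### Translation, Sobolev and Hardy inequalities for test functions -/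

namespace InverseSquareNLS

open Filter Topology ContinuousLinearMap
open scoped ENNReal NNReal

theorem MemLp.eLpNorm_two_eq_sqrt_integral {X F : Type*} [MeasurableSpace X]
    [NormedAddCommGroup F] {μ : Measure X} {f : X → F} (hf : MemLp f 2 μ) :
    eLpNorm f 2 μ = ENNReal.ofReal (Real.sqrt (∫ x, ‖f x‖ ^ 2 ∂μ)) := by
  rw [hf.eLpNorm_eq_integral_rpow_norm (by simp) (by simp), Real.sqrt_eq_rpow]
  norm_num

theorem eLpNorm_two_le_of_integral_sq_le {X F F' : Type*} [MeasurableSpace X]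
    [NormedAddCommGroup F] [NormedAddCommGroup F'] {μ : Measure X} {f : X → F} {g : X → F'}
    (hf : MemLp f 2 μ) (hg : MemLp g 2 μ) {K : ℝ} (hK : 0 ≤ K)
    (h : ∫ x, ‖f x‖ ^ 2 ∂μ ≤ K ^ 2 * ∫ x, ‖g x‖ ^ 2 ∂μ) :
    eLpNorm f 2 μ ≤ ENNReal.ofReal K * eLpNorm g 2 μ := by
  rw [MemLp.eLpNorm_two_eq_sqrt_integral hf, MemLp.eLpNorm_two_eq_sqrt_integral hg,
    ← ENNReal.ofReal_mul hK]
  refine ENNReal.ofReal_le_ofReal ?_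
  rw [← Real.sqrt_sq hK, ← Real.sqrt_mul (sq_nonneg K)]
  exact Real.sqrt_le_sqrt h

section TestFunctions

variable {d : ℕ}

theorem memLp_complexGradient {w : EuclideanSpace ℝ (Fin d) → ℂ} (hw : ContDiff ℝ 1 w)
    (hc : HasCompactSupport w) (p : ℝ≥0∞) : MemLp (complexGradient w) p volume := by
  refine (continuous_complexGradient hw).memLp_of_hasCompactSupport ?_
  refine (hc.fderiv (𝕜 := ℝ)).mono fun x hx h ↦ hx ?_
  ext i
  simp [complexGradient, h]

/-- The fundamental theorem of calculus on the segment from `x - y` to `x` writes the difference as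
an average over `t ∈ (0, 1]` of translated directional derivatives, to which Minkowski applies. -/
theorem eLpNorm_translation_sub_le {w : EuclideanSpace ℝ (Fin d) → ℂ} (hw : ContDiff ℝ 1 w)
    (y : EuclideanSpace ℝ (Fin d)) :
    eLpNorm (fun x ↦ w x - w (x - y)) 2 volume
      ≤ ‖y‖ₑ * eLpNorm (complexGradient w) 2 volume := by
  have hcf : Continuous (fderiv ℝ w) := hw.continuous_fderiv one_ne_zero
  have hprob : IsProbabilityMeasure ((volume : Measure ℝ).restrict (Ioc 0 1)) :=
    ⟨by simp⟩
  have hftc : (fun x ↦ w x - w (x - y))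
      = fun x ↦ ∫ t, fderiv ℝ w (x - y + t • y) y ∂((volume : Measure ℝ).restrict (Ioc 0 1)) := by
    funext x
    have hderiv : ∀ t ∈ uIcc (0 : ℝ) 1,
        HasDerivAt (fun t : ℝ ↦ w (x - y + t • y)) (fderiv ℝ w (x - y + t • y) y) t := by
      intro t _
      have h1 : HasDerivAt (fun t : ℝ ↦ x - y + t • y) y t := by
        simpa using ((hasDerivAt_id t).smul_const y).const_add (x - y)
      exact ((hw.differentiable one_ne_zero _).hasFDerivAt).comp_hasDerivAt t h1
    have hcont : Continuous fun t : ℝ ↦ fderiv ℝ w (x - y + t • y) y :=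
      (hcf.comp (by fun_prop)).clm_apply continuous_const
    rw [← intervalIntegral.integral_of_le zero_le_one,
      intervalIntegral.integral_eq_sub_of_hasDerivAt hderiv (hcont.intervalIntegrable _ _)]
    simp
  rw [hftc]
  have hU : Continuous (Function.uncurry fun (x : EuclideanSpace ℝ (Fin d)) (t : ℝ) ↦
      fderiv ℝ w (x - y + t • y) y) :=
    (hcf.comp (by fun_prop)).clm_apply continuous_const
  refine eLpNorm_integral_le_of_forall hU.stronglyMeasurable one_le_two (by simp)
    (Eventually.of_forall fun t ↦ ?_)
  have h1 : ∀ x, ‖fderiv ℝ w (x - y + t • y) y‖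
      ≤ ‖‖y‖ • complexGradient w (x + (t • y - y))‖ := by
    intro x
    rw [norm_smul, norm_norm, mul_comm, show x + (t • y - y) = x - y + t • y by abel]
    exact (le_opNorm _ _).trans
      (mul_le_mul_of_nonneg_right (norm_fderiv_le_complexGradient w _) (norm_nonneg _))
  refine (eLpNorm_mono h1).trans ?_
  have hmp := eLpNorm_comp_measurePreserving (p := 2)
    (continuous_complexGradient hw).aestronglyMeasurable
    (measurePreserving_add_right volume (t • y - y))
  have h2 := eLpNorm_const_smul_le (c := ‖y‖) (p := 2) (μ := volume)
    (f := complexGradient w ∘ fun x ↦ x + (t • y - y))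
  rw [hmp, enorm_norm] at h2
  exact h2

theorem exists_sobolev_const {q : ℝ≥0} (hq : (q : ℝ)⁻¹ = 2⁻¹ - (d : ℝ)⁻¹) (hd : 0 < d) :
    ∃ K : ℝ≥0, ∀ w : EuclideanSpace ℝ (Fin d) → ℂ, ContDiff ℝ 1 w → HasCompactSupport w →
      eLpNorm w q volume ≤ K * eLpNorm (complexGradient w) 2 volume := by
  refine ⟨SNormLESNormFDerivOfEqConst ℂ (volume : Measure (EuclideanSpace ℝ (Fin d))) (2 : ℝ≥0),
    fun w hw hc ↦ ?_⟩
  have h := eLpNorm_le_eLpNorm_fderiv_of_eq (volume : Measure (EuclideanSpace ℝ (Fin d))) hw hc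
    (p := 2) (p' := q) one_le_two (by simpa using hd) (by simpa using hq)
  refine h.trans ?_
  gcongr
  exact eLpNorm_mono (norm_fderiv_le_complexGradient w)

theorem fderiv_regularized_inv_sq {ε : ℝ} (hε : 0 < ε) (x : EuclideanSpace ℝ (Fin d))
    (i : Fin d) :
    HasFDerivAt (fun y : EuclideanSpace ℝ (Fin d) ↦ y i * (‖y‖ ^ 2 + ε)⁻¹)
      (x i • (-((‖x‖ ^ 2 + ε) ^ 2)⁻¹ • (2 • innerSL ℝ x))
        + (‖x‖ ^ 2 + ε)⁻¹ • (EuclideanSpace.proj i : EuclideanSpace ℝ (Fin d) →L[ℝ] ℝ)) x := by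
  have h1 : HasFDerivAt (fun y : EuclideanSpace ℝ (Fin d) ↦ ‖y‖ ^ 2 + ε) (2 • innerSL ℝ x) x :=
    (hasStrictFDerivAt_norm_sq x).hasFDerivAt.add_const ε
  have h2 : HasFDerivAt (fun y : EuclideanSpace ℝ (Fin d) ↦ (‖y‖ ^ 2 + ε)⁻¹)
      (-((‖x‖ ^ 2 + ε) ^ 2)⁻¹ • (2 • innerSL ℝ x)) x :=
    (hasDerivAt_inv (by positivity : ‖x‖ ^ 2 + ε ≠ 0)).comp_hasFDerivAt x h1
  exact ((EuclideanSpace.proj i : EuclideanSpace ℝ (Fin d) →L[ℝ] ℝ).hasFDerivAt).mul h2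

/-- The field `x/(|x|² + ε)` is a smooth substitute for `x/|x|²`, whose divergence is `(d-2)/|x|²`;
the regularization errs in the favourable direction. -/
theorem divergence_regularized_inv_sq_ge {ε : ℝ} (hε : 0 < ε) (x : EuclideanSpace ℝ (Fin d)) :
    ((d : ℝ) - 2) * (‖x‖ ^ 2 + ε)⁻¹ ≤ ∑ i,
      fderiv ℝ (fun y : EuclideanSpace ℝ (Fin d) ↦ y i * (‖y‖ ^ 2 + ε)⁻¹) x
        (EuclideanSpace.single i 1) := by
  have h1 : ∀ i, fderiv ℝ (fun y : EuclideanSpace ℝ (Fin d) ↦ y i * (‖y‖ ^ 2 + ε)⁻¹) x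
        (EuclideanSpace.single i 1)
      = (‖x‖ ^ 2 + ε)⁻¹ - 2 * ((‖x‖ ^ 2 + ε) ^ 2)⁻¹ * ‖x i‖ ^ 2 := by
    intro i
    rw [(fderiv_regularized_inv_sq hε x i).fderiv]
    simp [EuclideanSpace.inner_single_right]
    ring
  simp only [h1]
  rw [Finset.sum_sub_distrib, ← Finset.mul_sum, ← EuclideanSpace.norm_sq_eq, Finset.sum_const,
    Finset.card_univ, Fintype.card_fin, nsmul_eq_mul, sub_mul]
  have hs : 0 < ‖x‖ ^ 2 + ε := by positivity
  have h2 : ((‖x‖ ^ 2 + ε) ^ 2)⁻¹ * ‖x‖ ^ 2 ≤ (‖x‖ ^ 2 + ε)⁻¹ := by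
    rw [inv_mul_le_iff₀ (by positivity), pow_two (‖x‖ ^ 2 + ε), mul_assoc,
      mul_inv_cancel₀ hs.ne', mul_one]
    linarith
  linarith

/-- The divergence of `|w|² x/(|x|² + ε)` integrates to zero. Its part with the derivative on `|w|²`
is controlled by Cauchy–Schwarz and Young, its other part by the lower bound on the divergence of
the field. -/
theorem integral_regularized_hardy_le (hd : 3 ≤ d) {w : EuclideanSpace ℝ (Fin d) → ℂ}
    (hw : ContDiff ℝ 1 w) (hc : HasCompactSupport w) {ε : ℝ} (hε : 0 < ε) :
    ∫ x, (‖x‖ ^ 2 + ε)⁻¹ * ‖w x‖ ^ 2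
      ≤ (2 / ((d : ℝ) - 2)) ^ 2 * ∫ x, ‖complexGradient w x‖ ^ 2 := by
  have hd' : (0 : ℝ) < (d : ℝ) - 2 := by
    have : (3 : ℝ) ≤ d := by exact_mod_cast hd
    linarith
  set f : EuclideanSpace ℝ (Fin d) → ℝ := fun x ↦ ‖w x‖ ^ 2 with hf
  have hfs : ContDiff ℝ 1 f := hw.norm_sq ℝ
  have hfc : HasCompactSupport f := hc.comp_left (g := fun z ↦ ‖z‖ ^ 2) (by simp)
  set g : Fin d → EuclideanSpace ℝ (Fin d) → ℝ := fun i y ↦ y i * (‖y‖ ^ 2 + ε)⁻¹ with hg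
  have hgs : ∀ i, ContDiff ℝ 1 (g i) := fun i ↦
    (EuclideanSpace.proj i : EuclideanSpace ℝ (Fin d) →L[ℝ] ℝ).contDiff.mul
      (((contDiff_norm_sq ℝ).add contDiff_const).inv fun x ↦ by positivity)
  have hfd : Continuous (fderiv ℝ f) := hfs.continuous_fderiv one_ne_zero
  have hgd : ∀ i, Continuous (fderiv ℝ (g i)) := fun i ↦ (hgs i).continuous_fderiv one_ne_zero
  have hi1 : ∀ i, Integrable fun x ↦ fderiv ℝ (g i) x (EuclideanSpace.single i 1) * f x :=
    fun i ↦ (((hgd i).clm_apply continuous_const).mul hfs.continuous).integrable_of_hasCompactSupport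
      hfc.mul_left
  have hi2 : ∀ i, Integrable fun x ↦ g i x * fderiv ℝ f x (EuclideanSpace.single i 1) :=
    fun i ↦ ((hgs i).continuous.mul (hfd.clm_apply continuous_const)).integrable_of_hasCompactSupport
      (hfc.fderiv_apply (𝕜 := ℝ) _).mul_left
  have hi3 : ∀ i, Integrable fun x ↦ g i x * f x :=
    fun i ↦ ((hgs i).continuous.mul hfs.continuous).integrable_of_hasCompactSupport hfc.mul_left
  have hi4 : ∀ i, Integrable fun x ↦ g i x * fderiv ℝ f x (EuclideanSpace.single i 1)
      + fderiv ℝ (g i) x (EuclideanSpace.single i 1) * f x := fun i ↦ (hi2 i).add (hi1 i)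
  have hparts : ∀ i, (∫ x, (g i x * fderiv ℝ f x (EuclideanSpace.single i 1)
      + fderiv ℝ (g i) x (EuclideanSpace.single i 1) * f x)) = 0 := by
    intro i
    rw [integral_add (hi2 i) (hi1 i), integral_mul_fderiv_eq_neg_fderiv_mul_of_integrable
      (hi1 i) (hi2 i) (hi3 i) (fun x _ ↦ (hgs i).differentiable one_ne_zero x)
      (fun x _ ↦ hfs.differentiable one_ne_zero x), neg_add_cancel]
  have hsum : ∫ x, ∑ i, (g i x * fderiv ℝ f x (EuclideanSpace.single i 1)
      + fderiv ℝ (g i) x (EuclideanSpace.single i 1) * f x) = 0 := by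
    rw [integral_finsetSum _ fun i _ ↦ hi4 i]
    exact Finset.sum_eq_zero fun i _ ↦ hparts i
  have hs : ∀ x : EuclideanSpace ℝ (Fin d), 0 < ‖x‖ ^ 2 + ε := fun x ↦ by positivity
  have hgcont : Continuous fun x : EuclideanSpace ℝ (Fin d) ↦ (‖x‖ ^ 2 + ε)⁻¹ :=
    ((continuous_norm.pow 2).add continuous_const).inv₀ fun x ↦ (hs x).ne'
  have hiA : Integrable fun x ↦ (‖x‖ ^ 2 + ε)⁻¹ * ‖w x‖ ^ 2 :=
    (hgcont.mul hfs.continuous).integrable_of_hasCompactSupport hfc.mul_left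
  have hiB : Integrable fun x ↦ ‖complexGradient w x‖ ^ 2 :=
    (memLp_complexGradient hw hc 2).integrable_norm_pow (by norm_num)
  have hpt : ∀ x, ((d : ℝ) - 2) / 2 * ((‖x‖ ^ 2 + ε)⁻¹ * ‖w x‖ ^ 2)
      - 2 / ((d : ℝ) - 2) * ‖complexGradient w x‖ ^ 2
      ≤ ∑ i, (g i x * fderiv ℝ f x (EuclideanSpace.single i 1)
      + fderiv ℝ (g i) x (EuclideanSpace.single i 1) * f x) := by
    intro x
    have hdiv := mul_le_mul_of_nonneg_right (divergence_regularized_inv_sq_ge hε x)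
      (sq_nonneg ‖w x‖)
    rw [Finset.sum_add_distrib, ← Finset.sum_mul]
    have hdir : ∑ i, g i x * fderiv ℝ f x (EuclideanSpace.single i 1)
        = (‖x‖ ^ 2 + ε)⁻¹ * (2 * inner ℝ (w x) (fderiv ℝ w x x)) := by
      have h1 : fderiv ℝ f x x = 2 * inner ℝ (w x) (fderiv ℝ w x x) := by
        rw [hf, ((hw.differentiable one_ne_zero x).hasFDerivAt.norm_sq).fderiv, two_smul, two_mul]
        rfl
      rw [← h1, apply_eq_sum_single (fderiv ℝ f x), Finset.mul_sum]
      exact Finset.sum_congr rfl fun i _ ↦ by rw [smul_eq_mul, hg]; ring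
    rw [hdir]
    set s := ‖x‖ ^ 2 + ε with hsdef
    have hs0 : 0 < s := hs x
    -- With this `a` and `b = |∇w|`, the divergence is at least `(d-2)a² - 2ab`.
    set a := Real.sqrt s⁻¹ * ‖w x‖ with ha
    have ha2 : a ^ 2 = s⁻¹ * ‖w x‖ ^ 2 := by
      rw [ha, mul_pow, Real.sq_sqrt (by positivity)]
    set b := ‖complexGradient w x‖ with hb
    have hcs : -(s⁻¹ * inner ℝ (w x) (fderiv ℝ w x x)) ≤ a * b := by
      have h1 : -inner ℝ (w x) (fderiv ℝ w x x) ≤ ‖w x‖ * (b * ‖x‖) := by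
        refine (neg_le_abs _).trans ((abs_real_inner_le_norm _ _).trans ?_)
        gcongr
        exact (le_opNorm _ _).trans
          (mul_le_mul_of_nonneg_right (norm_fderiv_le_complexGradient w x) (norm_nonneg _))
      have h2 : Real.sqrt s⁻¹ * ‖x‖ ≤ 1 := by
        rw [Real.sqrt_inv, inv_mul_le_iff₀ (by positivity), mul_one]
        exact Real.le_sqrt_of_sq_le (by linarith)
      calc -(s⁻¹ * inner ℝ (w x) (fderiv ℝ w x x))
          = s⁻¹ * -inner ℝ (w x) (fderiv ℝ w x x) := by ring
        _ ≤ s⁻¹ * (‖w x‖ * (b * ‖x‖)) := by gcongr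
        _ = (Real.sqrt s⁻¹ * Real.sqrt s⁻¹) * (‖w x‖ * (b * ‖x‖)) := by
          rw [Real.mul_self_sqrt (by positivity)]
        _ = (a * b) * (Real.sqrt s⁻¹ * ‖x‖) := by rw [ha]; ring
        _ ≤ (a * b) * 1 := by gcongr
        _ = a * b := mul_one _
    -- The weight in Young's inequality absorbs exactly half of `(d-2)a²`, which yields the constant
    -- `(2/(d-2))²`.
    have hyoung : 2 * (a * b) ≤ ((d : ℝ) - 2) / 2 * a ^ 2 + 2 / ((d : ℝ) - 2) * b ^ 2 := by
      have h1 : 0 ≤ 2 / ((d : ℝ) - 2) * (((d : ℝ) - 2) / 2 * a - b) ^ 2 := by positivity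
      have h2 : 2 / ((d : ℝ) - 2) * (((d : ℝ) - 2) / 2 * a - b) ^ 2
          = ((d : ℝ) - 2) / 2 * a ^ 2 + 2 / ((d : ℝ) - 2) * b ^ 2 - 2 * (a * b) := by
        field_simp
        ring
      linarith
    rw [mul_assoc, ← ha2] at hdiv
    rw [← ha2]
    change _ ≤ s⁻¹ * (2 * inner ℝ (w x) (fderiv ℝ w x x)) + _ * ‖w x‖ ^ 2
    linarith
  have hmain := integral_mono ((hiA.const_mul (((d : ℝ) - 2) / 2)).sub
    (hiB.const_mul (2 / ((d : ℝ) - 2))))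
    (integrable_finsetSum _ fun i _ ↦ hi4 i) hpt
  rw [hsum, integral_sub' (hiA.const_mul _) (hiB.const_mul _), integral_const_mul,
    integral_const_mul] at hmain
  have h1 : ((d : ℝ) - 2) / 2 * ∫ x, (‖x‖ ^ 2 + ε)⁻¹ * ‖w x‖ ^ 2
      ≤ 2 / ((d : ℝ) - 2) * ∫ x, ‖complexGradient w x‖ ^ 2 := by linarith
  have h2 := mul_le_mul_of_nonneg_left h1 (by positivity : 0 ≤ 2 / ((d : ℝ) - 2))
  have h3 : 2 / ((d : ℝ) - 2) * (((d : ℝ) - 2) / 2) = 1 := by field_simp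
  rw [← mul_assoc, h3, one_mul, ← mul_assoc, ← pow_two] at h2
  exact h2

/-- Let `ε = 1/(n+1)` tend to zero and apply Fatou; the weights converge off the origin, a null set.
-/
theorem eLpNorm_hardy_testFunction_le (hd : 3 ≤ d) {w : EuclideanSpace ℝ (Fin d) → ℂ}
    (hw : ContDiff ℝ 1 w) (hc : HasCompactSupport w) :
    eLpNorm (fun x ↦ (‖x‖⁻¹ : ℝ) • w x) 2 volume
      ≤ ENNReal.ofReal (2 / ((d : ℝ) - 2)) * eLpNorm (complexGradient w) 2 volume := by
  have hd' : (0 : ℝ) < (d : ℝ) - 2 := by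
    have : (3 : ℝ) ≤ d := by exact_mod_cast hd
    linarith
  have hne : Nonempty (Fin d) := ⟨⟨0, by omega⟩⟩
  have hpos : ∀ (n : ℕ) (x : EuclideanSpace ℝ (Fin d)), 0 < ‖x‖ ^ 2 + 1 / ((n : ℝ) + 1) :=
    fun n x ↦ by positivity
  have hcont : ∀ n : ℕ, Continuous fun x ↦
      Real.sqrt (‖x‖ ^ 2 + 1 / ((n : ℝ) + 1))⁻¹ • w x := fun n ↦
    ((((continuous_norm.pow 2).add continuous_const).inv₀ fun x ↦ (hpos n x).ne').sqrt).smul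
      hw.continuous
  have hbd : ∀ n : ℕ, eLpNorm (fun x ↦ Real.sqrt (‖x‖ ^ 2 + 1 / ((n : ℝ) + 1))⁻¹ • w x) 2 volume
      ≤ ENNReal.ofReal (2 / ((d : ℝ) - 2)) * eLpNorm (complexGradient w) 2 volume := by
    intro n
    have hcs : HasCompactSupport fun x ↦ Real.sqrt (‖x‖ ^ 2 + 1 / ((n : ℝ) + 1))⁻¹ • w x :=
      HasCompactSupport.smul_left (f := fun x ↦ Real.sqrt (‖x‖ ^ 2 + 1 / ((n : ℝ) + 1))⁻¹) hc
    have hmem := (hcont n).memLp_of_hasCompactSupport (p := 2) (μ := volume) hcs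
    refine eLpNorm_two_le_of_integral_sq_le hmem (memLp_complexGradient hw hc 2)
      (by positivity) ?_
    convert! integral_regularized_hardy_le hd hw hc (Nat.one_div_pos_of_nat (α := ℝ) (n := n))
      using 3 with x
    rw [norm_smul, mul_pow, Real.norm_of_nonneg (Real.sqrt_nonneg _),
      Real.sq_sqrt (inv_nonneg.2 (hpos n x).le)]
  have hlim : ∀ᵐ x : EuclideanSpace ℝ (Fin d), Tendsto
      (fun n : ℕ ↦ Real.sqrt (‖x‖ ^ 2 + 1 / ((n : ℝ) + 1))⁻¹ • w x) atTop
      (𝓝 ((‖x‖⁻¹ : ℝ) • w x)) := by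
    have hnz : ∀ᵐ x : EuclideanSpace ℝ (Fin d), x ≠ 0 := by
      simp [ae_iff, measure_singleton]
    filter_upwards [hnz] with x hx
    have hx' : ‖x‖ ^ 2 + 0 ≠ 0 := by simpa using hx
    have h1 := ((tendsto_const_nhds (x := ‖x‖ ^ 2)).add
      (tendsto_one_div_add_atTop_nhds_zero_nat (𝕜 := ℝ))).inv₀ hx'
    have h2 := h1.sqrt
    rw [add_zero, Real.sqrt_inv, Real.sqrt_sq (norm_nonneg x)] at h2
    exact h2.smul_const _
  refine (Lp.eLpNorm_lim_le_liminf_eLpNorm (fun n ↦ (hcont n).aestronglyMeasurable) _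
    hlim).trans ?_
  exact (liminf_le_liminf (Eventually.of_forall hbd)).trans (by simp)

end TestFunctions

end InverseSquareNLS

/-! ### Interpolation, and `H¹` as a Hilbert space -/

namespace InverseSquareNLS

open Filter Topology ContinuousLinearMap
open scoped ENNReal NNReal

/-- Split at the threshold `s`: below it `t^(p-2) ≤ s^(p-2)`, above it `t^(p-q) ≤ s^(p-q)`. The
threshold stays free because it is used twice: `s = ‖v‖` gives a homogeneous embedding bound, large
`s` gives smallness of the critical term. -/
theorem rpow_le_interpolation {t s p q : ℝ} (ht : 0 ≤ t) (hs : 0 < s) (hp : 2 < p) (hq : p < q) :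
    t ^ p ≤ s ^ (p - 2) * t ^ (2 : ℝ) + s ^ (p - q) * t ^ q := by
  rcases ht.eq_or_lt with rfl | ht
  · rw [Real.zero_rpow (by linarith), Real.zero_rpow (by norm_num),
      Real.zero_rpow (by linarith)]
    simp
  rcases le_total t s with h | h
  · have h1 : t ^ p = t ^ (p - 2) * t ^ (2 : ℝ) := by
      rw [← Real.rpow_add ht]; congr 1; ring
    rw [h1]
    have h2 : t ^ (p - 2) * t ^ (2 : ℝ) ≤ s ^ (p - 2) * t ^ (2 : ℝ) := by
      gcongr
    have : 0 ≤ s ^ (p - q) * t ^ q := by positivity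
    linarith
  · have h1 : t ^ p = t ^ (p - q) * t ^ q := by
      rw [← Real.rpow_add ht]; congr 1; ring
    rw [h1]
    have h2 : t ^ (p - q) * t ^ q ≤ s ^ (p - q) * t ^ q := by
      gcongr ?_ * _
      exact Real.rpow_le_rpow_of_nonpos hs h (by linarith)
    have : 0 ≤ s ^ (p - 2) * t ^ (2 : ℝ) := by positivity
    linarith

theorem eLpNorm_rpow_eq_lintegral {X F : Type*} [MeasurableSpace X] [NormedAddCommGroup F]
    {μ : Measure X} (f : X → F) {p : ℝ} (hp : 0 < p) :
    eLpNorm f (ENNReal.ofReal p) μ ^ p = ∫⁻ x, ‖f x‖ₑ ^ p ∂μ := by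
  rw [eLpNorm_eq_lintegral_rpow_enorm_toReal (by simpa using hp) (by simp),
    ENNReal.toReal_ofReal hp.le, ← ENNReal.rpow_mul, one_div_mul_cancel hp.ne', ENNReal.rpow_one]

theorem eLpNorm_rpow_le_interpolation {X F : Type*} [MeasurableSpace X] [NormedAddCommGroup F]
    {μ : Measure X} {f : X → F} (hf : AEStronglyMeasurable f μ) {s p q : ℝ} (hs : 0 < s)
    (hp : 2 < p) (hq : p < q) :
    eLpNorm f (ENNReal.ofReal p) μ ^ p
      ≤ ENNReal.ofReal (s ^ (p - 2)) * eLpNorm f 2 μ ^ (2 : ℝ)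
        + ENNReal.ofReal (s ^ (p - q)) * eLpNorm f (ENNReal.ofReal q) μ ^ q := by
  have h2 : eLpNorm f 2 μ ^ (2 : ℝ) = ∫⁻ x, ‖f x‖ₑ ^ (2 : ℝ) ∂μ := by
    rw [← eLpNorm_rpow_eq_lintegral f two_pos]; norm_num
  rw [h2, eLpNorm_rpow_eq_lintegral f (by linarith), eLpNorm_rpow_eq_lintegral f (by linarith),
    ← lintegral_const_mul'' _ (hf.enorm.pow_const _),
    ← lintegral_const_mul'' _ (hf.enorm.pow_const _),
    ← lintegral_add_left' ((hf.enorm.pow_const _).const_mul _)]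
  refine lintegral_mono fun x ↦ ?_
  have hn : ‖f x‖ₑ = ENNReal.ofReal ‖f x‖ := (ofReal_norm _).symm
  have h0 := norm_nonneg (f x)
  simp only [hn]
  rw [ENNReal.ofReal_rpow_of_nonneg h0 (by linarith), ENNReal.ofReal_rpow_of_nonneg h0 two_pos.le,
    ENNReal.ofReal_rpow_of_nonneg h0 (by linarith), ← ENNReal.ofReal_mul (by positivity),
    ← ENNReal.ofReal_mul (by positivity), ← ENNReal.ofReal_add (by positivity) (by positivity)]
  exact ENNReal.ofReal_le_ofReal (rpow_le_interpolation h0 hs hp hq)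

namespace H1

variable {d : ℕ}

/-- The embedding of `H¹` in `L²`. -/
noncomputable def toL2 (d : ℕ) :
    H1 d →L[ℝ] Lp ℂ 2 (volume : Measure (EuclideanSpace ℝ (Fin d))) :=
  (WithLp.fstL 2 ℝ _ _).comp (H1 d).subtypeL

/-- The weak gradient as a bounded operator from `H¹` to `L²`. -/
noncomputable def gradL2 (d : ℕ) :
    H1 d →L[ℝ] Lp (EuclideanSpace ℂ (Fin d)) 2 (volume : Measure (EuclideanSpace ℝ (Fin d))) :=
  (WithLp.sndL 2 ℝ _ _).comp (H1 d).subtypeL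

theorem coe_toL2 (v : H1 d) : (toL2 d v : EuclideanSpace ℝ (Fin d) → ℂ) = toFun v := rfl

theorem coe_gradL2 (v : H1 d) :
    (gradL2 d v : EuclideanSpace ℝ (Fin d) → EuclideanSpace ℂ (Fin d)) = grad v := rfl

theorem isWeakGradient (v : H1 d) : IsWeakGradient (toFun v) (grad v) := v.2

theorem memLp_toFun (v : H1 d) : MemLp (toFun v) 2 volume := Lp.memLp (toL2 d v)

theorem memLp_grad (v : H1 d) : MemLp (grad v) 2 volume := Lp.memLp (gradL2 d v)

theorem stronglyMeasurable_toFun (v : H1 d) : StronglyMeasurable (toFun v) :=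
  Lp.stronglyMeasurable (toL2 d v)

theorem stronglyMeasurable_grad (v : H1 d) : StronglyMeasurable (grad v) :=
  Lp.stronglyMeasurable (gradL2 d v)

theorem norm_sq_eq (v : H1 d) : ‖v‖ ^ 2 = ‖toL2 d v‖ ^ 2 + ‖gradL2 d v‖ ^ 2 :=
  WithLp.prod_norm_sq_eq_of_L2 (v : L2Pair d)

theorem norm_toL2_le (v : H1 d) : ‖toL2 d v‖ ≤ ‖v‖ :=
  le_of_sq_le_sq (by nlinarith [norm_sq_eq v]) (norm_nonneg v)

theorem norm_gradL2_le (v : H1 d) : ‖gradL2 d v‖ ≤ ‖v‖ :=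
  le_of_sq_le_sq (by nlinarith [norm_sq_eq v]) (norm_nonneg v)

theorem toFun_add (v w : H1 d) : toFun (v + w) =ᵐ[volume] toFun v + toFun w :=
  Lp.coeFn_add (toL2 d v) (toL2 d w)

theorem toFun_smul (a : ℝ) (v : H1 d) : toFun (a • v) =ᵐ[volume] a • toFun v :=
  Lp.coeFn_smul a (toL2 d v)

theorem eLpNorm_toFun (v : H1 d) : eLpNorm (toFun v) 2 volume = ‖toL2 d v‖ₑ :=
  (Lp.enorm_def (toL2 d v)).symm

theorem eLpNorm_grad (v : H1 d) : eLpNorm (grad v) 2 volume = ‖gradL2 d v‖ₑ :=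
  (Lp.enorm_def (gradL2 d v)).symm

end H1

section Pairing

variable {d : ℕ} {F : Type*} [NormedAddCommGroup F] [NormedSpace ℝ F] [CompleteSpace F]

/-- Integration against a real-valued square integrable function. -/
noncomputable def l2Pairing {ψ : EuclideanSpace ℝ (Fin d) → ℝ} (hψ : MemLp ψ 2 volume) :
    Lp F 2 (volume : Measure (EuclideanSpace ℝ (Fin d))) →L[ℝ] F :=
  (lsmul ℝ ℝ : ℝ →L[ℝ] F →L[ℝ] F).lpPairing volume 2 2 (hψ.toLp ψ)

theorem l2Pairing_apply {ψ : EuclideanSpace ℝ (Fin d) → ℝ} (hψ : MemLp ψ 2 volume)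
    (u : Lp F 2 (volume : Measure (EuclideanSpace ℝ (Fin d)))) :
    l2Pairing hψ u = ∫ x, ψ x • u x := by
  rw [l2Pairing, lpPairing_eq_integral]
  refine integral_congr_ae ?_
  filter_upwards [hψ.coeFn_toLp] with x hx
  rw [hx]
  rfl

theorem memLp_testFunction {φ : EuclideanSpace ℝ (Fin d) → ℝ} (hφ : ContDiff ℝ (⊤ : ℕ∞) φ)
    (hs : HasCompactSupport φ) : MemLp φ 2 volume :=
  hφ.continuous.memLp_of_hasCompactSupport hs

theorem memLp_partial {φ : EuclideanSpace ℝ (Fin d) → ℝ} (hφ : ContDiff ℝ (⊤ : ℕ∞) φ)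
    (hs : HasCompactSupport φ) (i : Fin d) :
    MemLp (fun x ↦ fderiv ℝ φ x (EuclideanSpace.single i 1)) 2 volume :=
  (continuous_partial hφ i).memLp_of_hasCompactSupport (hasCompactSupport_partial hs i)

/-- Expresses membership by bounded operators on `L²`, so that `H¹` is an intersection of closed
sets and hence complete. -/
theorem mem_H1_iff (p : L2Pair d) : p ∈ H1 d ↔
    ∀ (φ : EuclideanSpace ℝ (Fin d) → ℝ) (hφ : ContDiff ℝ (⊤ : ℕ∞) φ) (hs : HasCompactSupport φ)
      (i : Fin d), l2Pairing (memLp_partial hφ hs i) p.fst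
        = -(l2Pairing (memLp_testFunction hφ hs) p.snd) i := by
  have key : ∀ (φ : EuclideanSpace ℝ (Fin d) → ℝ) (hφ : ContDiff ℝ (⊤ : ℕ∞) φ)
      (hs : HasCompactSupport φ) (i : Fin d),
      (l2Pairing (memLp_testFunction hφ hs) p.snd) i = ∫ x, φ x • p.snd x i := by
    intro φ hφ hs i
    have hint : Integrable (fun y ↦ φ y • p.snd y) :=
      memLp_one_iff_integrable.1 ((Lp.memLp p.snd).smul (p := 2) (q := 2)
        (memLp_testFunction hφ hs))
    have h := (EuclideanSpace.proj i : EuclideanSpace ℂ (Fin d) →L[ℂ] ℂ).integral_comp_comm hint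
    rw [l2Pairing_apply]
    exact h.symm
  constructor
  · intro hp φ hφ hs i
    rw [key φ hφ hs i, l2Pairing_apply]
    exact hp φ hφ hs i
  · intro hp φ hφ hs i
    have := hp φ hφ hs i
    rwa [key φ hφ hs i, l2Pairing_apply] at this

theorem isClosed_H1 (d : ℕ) : IsClosed (H1 d : Set (L2Pair d)) := by
  have : (H1 d : Set (L2Pair d)) = ⋂ (φ : EuclideanSpace ℝ (Fin d) → ℝ)
      (hφ : ContDiff ℝ (⊤ : ℕ∞) φ) (hs : HasCompactSupport φ) (i : Fin d),
      {p | l2Pairing (memLp_partial hφ hs i) p.fst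
        = -(l2Pairing (memLp_testFunction hφ hs) p.snd) i} := by
    ext p
    simp only [SetLike.mem_coe, mem_H1_iff, mem_iInter, mem_ofPred_eq]
  rw [this]
  refine isClosed_iInter fun φ ↦ isClosed_iInter fun hφ ↦ isClosed_iInter fun hs ↦
    isClosed_iInter fun i ↦ isClosed_eq ?_ ?_
  · exact (l2Pairing _).continuous.comp (WithLp.fstL 2 ℝ _ _).continuous
  · exact ((EuclideanSpace.proj i : EuclideanSpace ℂ (Fin d) →L[ℂ] ℂ).continuous.comp
      ((l2Pairing _).continuous.comp (WithLp.sndL 2 ℝ _ _).continuous)).neg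

noncomputable instance (d : ℕ) : CompleteSpace (H1 d) :=
  (isClosed_H1 d).completeSpace_coe

/-- The weak gradient is determined by the function. -/
theorem H1.ext_toFun {v w : H1 d} (h : H1.toFun v =ᵐ[volume] H1.toFun w) : v = w := by
  have h1 : H1.toL2 d v = H1.toL2 d w := Lp.ext h
  have h2 : H1.grad v =ᵐ[volume] H1.grad w := by
    have hi : ∀ i, ∀ᵐ x, H1.grad v x i = H1.grad w x i := by
      intro i
      refine ae_eq_of_integral_contDiff_smul_eq
        ((memLp_coord (H1.memLp_grad v) i).locallyIntegrable one_le_two)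
        ((memLp_coord (H1.memLp_grad w) i).locallyIntegrable one_le_two) fun φ hφ hs ↦ ?_
      have hv := H1.isWeakGradient v φ hφ hs i
      have hw := H1.isWeakGradient w φ hφ hs i
      rw [← H1.coe_toL2, h1, H1.coe_toL2, hw] at hv
      exact (neg_injective hv).symm
    filter_upwards [ae_all_iff.2 hi] with x hx
    ext i
    exact hx i
  have h3 : H1.gradL2 d v = H1.gradL2 d w := Lp.ext h2
  refine Subtype.ext ?_
  have h1' : (v : L2Pair d).fst = (w : L2Pair d).fst := h1
  have h3' : (v : L2Pair d).snd = (w : L2Pair d).snd := h3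
  exact (WithLp.ofLp_injective 2) (Prod.ext h1' h3')

end Pairing

end InverseSquareNLS

/-! ### Hardy, Sobolev and translation bounds on `H¹` -/

namespace InverseSquareNLS

open Filter Topology ContinuousLinearMap
open scoped ENNReal NNReal

namespace H1

variable {d : ℕ}

theorem eLpNorm_hardy_le (hd : 3 ≤ d) (v : H1 d) :
    eLpNorm (fun x ↦ (‖x‖⁻¹ : ℝ) • toFun v x) 2 volume
      ≤ ENNReal.ofReal (2 / ((d : ℝ) - 2)) * ‖gradL2 d v‖ₑ := by
  rw [← eLpNorm_grad]
  refine eLpNorm_le_of_testFunction_bound (T := fun w x ↦ (‖x‖⁻¹ : ℝ) • w x) (by simp)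
    (fun w hw hc ↦ ⟨?_, eLpNorm_hardy_testFunction_le hd (hw.of_le (by simp)) hc⟩)
    (fun w u h ↦ h.mono fun x hx ↦ hx.const_smul _) (stronglyMeasurable_toFun v)
    (stronglyMeasurable_grad v) (memLp_toFun v) (memLp_grad v) (isWeakGradient v)
  exact (measurable_norm.inv.aestronglyMeasurable).smul hw.continuous.aestronglyMeasurable

theorem exists_sobolev_const (hd : 3 ≤ d) : ∃ K : ℝ≥0, ∀ v : H1 d,
    eLpNorm (toFun v) (ENNReal.ofReal (2 * d / ((d : ℝ) - 2))) volume
      ≤ K * ‖gradL2 d v‖ₑ := by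
  have hd3 : (3 : ℝ) ≤ d := by exact_mod_cast hd
  have hd' : (0 : ℝ) < (d : ℝ) - 2 := by linarith
  obtain ⟨K, hK⟩ := InverseSquareNLS.exists_sobolev_const (d := d)
    (q := Real.toNNReal (2 * d / ((d : ℝ) - 2))) (by
      rw [Real.coe_toNNReal _ (by positivity)]
      field_simp) (by omega)
  refine ⟨K, fun v ↦ ?_⟩
  rw [← eLpNorm_grad]
  exact eLpNorm_le_of_testFunction_bound (T := fun w x ↦ w x) (by simp)
    (fun w hw hc ↦ ⟨hw.continuous.aestronglyMeasurable, hK w (hw.of_le (by simp)) hc⟩)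
    (fun w u h ↦ h) (stronglyMeasurable_toFun v)
    (stronglyMeasurable_grad v) (memLp_toFun v) (memLp_grad v) (isWeakGradient v)

theorem eLpNorm_translation_sub_le (v : H1 d) (y : EuclideanSpace ℝ (Fin d)) :
    eLpNorm (fun x ↦ toFun v x - toFun v (x - y)) 2 volume ≤ ‖y‖ₑ * ‖gradL2 d v‖ₑ := by
  rw [← eLpNorm_grad]
  refine eLpNorm_le_of_testFunction_bound (T := fun w x ↦ w x - w (x - y)) (by simp)
    (fun w hw hc ↦ ⟨?_, InverseSquareNLS.eLpNorm_translation_sub_le (hw.of_le (by simp)) y⟩)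
    (fun w u h ↦ ?_) (stronglyMeasurable_toFun v)
    (stronglyMeasurable_grad v) (memLp_toFun v) (memLp_grad v) (isWeakGradient v)
  · exact (hw.continuous.sub
      (hw.continuous.comp (continuous_id.sub continuous_const))).aestronglyMeasurable
  · have h2 := (measurePreserving_sub_right (volume : Measure (EuclideanSpace ℝ (Fin d)))
      y).quasiMeasurePreserving.ae h
    filter_upwards [h, h2] with x h1 h2 using h1.sub h2

theorem eLpNorm_sub_mollify_le (v : H1 d) (φ : ContDiffBump (0 : EuclideanSpace ℝ (Fin d))) :
    eLpNorm (fun x ↦ toFun v x - mollify φ (toFun v) x) 2 volume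
      ≤ ENNReal.ofReal φ.rOut * ‖v‖ₑ := by
  refine InverseSquareNLS.eLpNorm_sub_mollify_le φ (stronglyMeasurable_toFun v)
    ((memLp_toFun v).locallyIntegrable one_le_two) one_le_two (by simp) fun y hy ↦ ?_
  refine (eLpNorm_translation_sub_le v y).trans (mul_le_mul' ?_ ?_)
  · rw [← ofReal_norm]
    exact ENNReal.ofReal_le_ofReal hy.le
  · rw [← ofReal_norm, ← ofReal_norm]
    exact ENNReal.ofReal_le_ofReal (norm_gradL2_le v)

/-- Interpolation with threshold `s = ‖v‖` makes both the `L²` term and the critical term multiples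
of `‖v‖ᵖ`. -/
theorem exists_subcritical_sobolev_const (hd : 3 ≤ d) {p : ℝ} (hp : 2 < p)
    (hp' : p < 2 * d / ((d : ℝ) - 2)) : ∃ K : ℝ≥0, ∀ v : H1 d,
    eLpNorm (toFun v) (ENNReal.ofReal p) volume ≤ K * ‖v‖ₑ := by
  obtain ⟨K, hK⟩ := exists_sobolev_const hd
  set q := 2 * d / ((d : ℝ) - 2) with hq
  have hp0 : 0 < p := by linarith
  have hq0 : 0 < q := by linarith
  refine ⟨(1 + K ^ q) ^ (1 / p), fun v ↦ ?_⟩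
  rcases eq_or_ne v 0 with rfl | hv
  · have h0 : toFun (0 : H1 d) =ᵐ[volume] 0 := Lp.coeFn_zero _ _ _
    rw [eLpNorm_congr_ae h0]
    simp
  have hs : 0 < ‖v‖ := norm_pos_iff.2 hv
  have h := eLpNorm_rpow_le_interpolation (stronglyMeasurable_toFun v).aestronglyMeasurable
    (μ := volume) hs hp hp'
  have h2 : eLpNorm (toFun v) 2 volume ≤ ENNReal.ofReal ‖v‖ := by
    rw [eLpNorm_toFun, ← ofReal_norm]
    exact ENNReal.ofReal_le_ofReal (norm_toL2_le v)
  have h3 : eLpNorm (toFun v) (ENNReal.ofReal q) volume ≤ K * ENNReal.ofReal ‖v‖ := by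
    refine (hK v).trans (mul_le_mul' le_rfl ?_)
    rw [← ofReal_norm]
    exact ENNReal.ofReal_le_ofReal (norm_gradL2_le v)
  have h4 : eLpNorm (toFun v) (ENNReal.ofReal p) volume ^ p
      ≤ ENNReal.ofReal (‖v‖ ^ (p - 2)) * ENNReal.ofReal ‖v‖ ^ (2 : ℝ)
        + ENNReal.ofReal (‖v‖ ^ (p - q)) * (K * ENNReal.ofReal ‖v‖) ^ q := by
    refine h.trans ?_
    gcongr
  have h5 : ENNReal.ofReal (‖v‖ ^ (p - 2)) * ENNReal.ofReal ‖v‖ ^ (2 : ℝ)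
        + ENNReal.ofReal (‖v‖ ^ (p - q)) * (K * ENNReal.ofReal ‖v‖) ^ q
      = ((1 + K ^ q : ℝ≥0) : ℝ≥0∞) * ENNReal.ofReal ‖v‖ ^ p := by
    rw [ENNReal.mul_rpow_of_nonneg _ _ hq0.le, ← ENNReal.ofReal_rpow_of_pos hs,
      ← ENNReal.ofReal_rpow_of_pos hs, mul_left_comm, ← ENNReal.rpow_add _ _ (by simpa) (by simp),
      ← ENNReal.rpow_add _ _ (by simpa) (by simp), sub_add_cancel, sub_add_cancel,
      ENNReal.coe_add, ENNReal.coe_one, ENNReal.coe_rpow_of_nonneg _ hq0.le, add_mul, one_mul]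
  rw [h5] at h4
  have h6 := ENNReal.rpow_le_rpow h4 (one_div_nonneg.2 hp0.le)
  rw [ENNReal.mul_rpow_of_nonneg _ _ (one_div_nonneg.2 hp0.le), ← ENNReal.rpow_mul,
    ← ENNReal.rpow_mul, mul_one_div_cancel hp0.ne', ENNReal.rpow_one, ENNReal.rpow_one,
    ofReal_norm, ← ENNReal.coe_rpow_of_nonneg _ (one_div_nonneg.2 hp0.le)] at h6
  exact h6

theorem memLp_weighted {a : EuclideanSpace ℝ (Fin d) → ℝ} (ha : Measurable a)
    {r : ℝ≥0∞} {K : ℝ≥0}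
    (hK : ∀ v : H1 d, eLpNorm (fun x ↦ a x • toFun v x) r volume ≤ K * ‖v‖ₑ) (v : H1 d) :
    MemLp (fun x ↦ a x • toFun v x) r volume :=
  ⟨ha.aestronglyMeasurable.smul (stronglyMeasurable_toFun v).aestronglyMeasurable,
    (hK v).trans_lt (by finiteness)⟩

/-- The bounded operator `v ↦ a v` from `H¹` to `Lʳ`, for a weight `a` with
`‖a v‖_r ≤ K ‖v‖`. -/
noncomputable def weightedEmbedding {a : EuclideanSpace ℝ (Fin d) → ℝ} (ha : Measurable a)
    {r : ℝ≥0∞} [Fact (1 ≤ r)] {K : ℝ≥0}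
    (hK : ∀ v : H1 d, eLpNorm (fun x ↦ a x • toFun v x) r volume ≤ K * ‖v‖ₑ) :
    H1 d →L[ℝ] Lp ℂ r (volume : Measure (EuclideanSpace ℝ (Fin d))) :=
  LinearMap.mkContinuous
    { toFun := fun v ↦ (memLp_weighted ha hK v).toLp _
      map_add' := fun v w ↦ by
        rw [← MemLp.toLp_add]
        refine MemLp.toLp_congr _ _ ?_
        filter_upwards [toFun_add v w] with x hx
        simp [hx]
      map_smul' := fun t v ↦ by
        rw [RingHom.id_apply, ← MemLp.toLp_const_smul]
        refine MemLp.toLp_congr _ _ ?_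
        filter_upwards [toFun_smul t v] with x hx
        rw [hx, Pi.smul_apply, Pi.smul_apply, smul_comm] }
    K fun v ↦ by
      change ‖(memLp_weighted ha hK v).toLp _‖ ≤ _
      rw [Lp.norm_toLp]
      refine ENNReal.toReal_le_of_le_ofReal (by positivity) ((hK v).trans_eq ?_)
      rw [ENNReal.ofReal_mul (by positivity), ENNReal.ofReal_coe_nnreal, ofReal_norm]

theorem coeFn_weightedEmbedding {a : EuclideanSpace ℝ (Fin d) → ℝ} (ha : Measurable a)
    {r : ℝ≥0∞} [Fact (1 ≤ r)] {K : ℝ≥0}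
    (hK : ∀ v : H1 d, eLpNorm (fun x ↦ a x • toFun v x) r volume ≤ K * ‖v‖ₑ) (v : H1 d) :
    weightedEmbedding ha hK v =ᵐ[volume] fun x ↦ a x • toFun v x :=
  (memLp_weighted ha hK v).coeFn_toLp

/-- Multiplication by `|x|⁻¹` is a bounded operator from `H¹` to `L²`, with the sharp Hardy
constant. -/
theorem exists_hardyMap (hd : 3 ≤ d) :
    ∃ W : H1 d →L[ℝ] Lp ℂ 2 (volume : Measure (EuclideanSpace ℝ (Fin d))),
      (∀ v, W v =ᵐ[volume] fun x ↦ (‖x‖⁻¹ : ℝ) • toFun v x) ∧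
      ∀ v, ‖W v‖ ≤ 2 / ((d : ℝ) - 2) * ‖gradL2 d v‖ := by
  have hd3 : (3 : ℝ) ≤ d := by exact_mod_cast hd
  have hd' : (0 : ℝ) < (d : ℝ) - 2 := by linarith
  have hK : ∀ v : H1 d, eLpNorm (fun x ↦ (‖x‖⁻¹ : ℝ) • toFun v x) 2 volume
      ≤ ((2 / ((d : ℝ) - 2)).toNNReal : ℝ≥0) * ‖v‖ₑ := fun v ↦
    (eLpNorm_hardy_le hd v).trans (mul_le_mul' le_rfl (by
      rw [← ofReal_norm, ← ofReal_norm]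
      exact ENNReal.ofReal_le_ofReal (norm_gradL2_le v)))
  have ha : Measurable fun x : EuclideanSpace ℝ (Fin d) ↦ ‖x‖⁻¹ := measurable_norm.inv
  refine ⟨weightedEmbedding ha hK, coeFn_weightedEmbedding ha hK, fun v ↦ ?_⟩
  have h := eLpNorm_hardy_le hd v
  rw [← eLpNorm_congr_ae (coeFn_weightedEmbedding ha hK v), ← Lp.enorm_def,
    ← ofReal_norm, ← ofReal_norm, ← ENNReal.ofReal_mul (by positivity)] at h
  exact (ENNReal.ofReal_le_ofReal_iff (by positivity)).1 h

theorem exists_sobolevMap (hd : 3 ≤ d) {p : ℝ} [Fact (1 ≤ ENNReal.ofReal p)] (hp : 2 < p)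
    (hp' : p < 2 * d / ((d : ℝ) - 2)) :
    ∃ I : H1 d →L[ℝ] Lp ℂ (ENNReal.ofReal p) (volume : Measure (EuclideanSpace ℝ (Fin d))),
      ∀ v, I v =ᵐ[volume] toFun v := by
  obtain ⟨K, hK⟩ := exists_subcritical_sobolev_const hd hp hp'
  have hK' : ∀ v : H1 d, eLpNorm (fun x ↦ (1 : ℝ) • toFun v x) (ENNReal.ofReal p) volume
      ≤ K * ‖v‖ₑ := by simpa using hK
  refine ⟨weightedEmbedding measurable_const hK', fun v ↦ ?_⟩
  simpa using coeFn_weightedEmbedding measurable_const hK' v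

end H1

end InverseSquareNLS

/-! ### Rotations, radial functions and symmetric criticality -/

namespace InverseSquareNLS

open Filter Topology ContinuousLinearMap
open scoped ENNReal NNReal

section ComplexAdjoint

variable {d : ℕ}

/-- The complexification of the adjoint of a linear isometry `R`:
the `i`-th coordinate is `∑ j, (R eᵢ)ⱼ gⱼ`. -/
noncomputable def complexAdjoint
    (R : EuclideanSpace ℝ (Fin d) ≃ₗᵢ[ℝ] EuclideanSpace ℝ (Fin d)) :
    EuclideanSpace ℂ (Fin d) →L[ℝ] EuclideanSpace ℂ (Fin d) :=
  LinearMap.toContinuousLinearMap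
    { toFun := fun g ↦ WithLp.toLp 2 fun i ↦ ∑ j, R (EuclideanSpace.single i 1) j • g j
      map_add' := fun g h ↦ by
        ext i
        simp [Finset.sum_add_distrib]
      map_smul' := fun t g ↦ by
        ext i
        simp [Finset.mul_sum, mul_left_comm] }

theorem complexAdjoint_apply
    (R : EuclideanSpace ℝ (Fin d) ≃ₗᵢ[ℝ] EuclideanSpace ℝ (Fin d)) (g : EuclideanSpace ℂ (Fin d))
    (i : Fin d) : complexAdjoint R g i = ∑ j, R (EuclideanSpace.single i 1) j • g j := rfl

/-- Real and imaginary parts are each transformed by the isometry `R⁻¹`. -/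
theorem norm_complexAdjoint
    (R : EuclideanSpace ℝ (Fin d) ≃ₗᵢ[ℝ] EuclideanSpace ℝ (Fin d))
    (g : EuclideanSpace ℂ (Fin d)) : ‖complexAdjoint R g‖ = ‖g‖ := by
  have hR : ∀ (a : EuclideanSpace ℝ (Fin d)) (i : Fin d),
      ∑ j, R (EuclideanSpace.single i 1) j * a j = R.symm a i := by
    intro a i
    have h1 : inner ℝ (R (EuclideanSpace.single i 1)) a
        = inner ℝ (EuclideanSpace.single i 1) (R.symm a) := by
      rw [← R.inner_map_map (EuclideanSpace.single i 1) (R.symm a), R.apply_symm_apply]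
    rw [EuclideanSpace.inner_single_left, PiLp.inner_apply] at h1
    simpa [mul_comm] using h1
  set a : EuclideanSpace ℝ (Fin d) := WithLp.toLp 2 fun j ↦ (g j).re with ha
  set b : EuclideanSpace ℝ (Fin d) := WithLp.toLp 2 fun j ↦ (g j).im with hb
  have hre : ∀ i, (complexAdjoint R g i).re = R.symm a i := fun i ↦ by
    rw [← hR, complexAdjoint_apply, Complex.re_sum]
    simp [ha]
  have him : ∀ i, (complexAdjoint R g i).im = R.symm b i := fun i ↦ by
    rw [← hR, complexAdjoint_apply, Complex.im_sum]
    simp [hb]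
  have hsplit : ∀ h : EuclideanSpace ℂ (Fin d),
      ‖h‖ ^ 2 = ∑ i, (h i).re ^ 2 + ∑ i, (h i).im ^ 2 := by
    intro h
    rw [EuclideanSpace.norm_sq_eq, ← Finset.sum_add_distrib]
    refine Finset.sum_congr rfl fun i _ ↦ ?_
    rw [Complex.sq_norm, Complex.normSq_apply]
    ring
  have hreal : ∀ h : EuclideanSpace ℝ (Fin d), ∑ i, h i ^ 2 = ‖h‖ ^ 2 := fun h ↦ by
    simp [EuclideanSpace.norm_sq_eq]
  have h1 : ‖complexAdjoint R g‖ ^ 2 = ‖g‖ ^ 2 := by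
    rw [hsplit, hsplit]
    simp only [hre, him]
    rw [hreal, hreal, R.symm.norm_map, R.symm.norm_map, ← hreal, ← hreal]
  exact (sq_eq_sq₀ (norm_nonneg _) (norm_nonneg _)).1 h1

/-- The chain rule is moved onto the test function `ψ = φ ∘ R⁻¹`; the change of variables is free
because `R` preserves volume. -/
theorem IsWeakGradient.comp_linearIsometryEquiv {u : EuclideanSpace ℝ (Fin d) → ℂ}
    {G : EuclideanSpace ℝ (Fin d) → EuclideanSpace ℂ (Fin d)} (hu : MemLp u 2 volume)
    (hG : MemLp G 2 volume) (h : IsWeakGradient u G)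
    (R : EuclideanSpace ℝ (Fin d) ≃ₗᵢ[ℝ] EuclideanSpace ℝ (Fin d)) :
    IsWeakGradient (u ∘ R) (fun x ↦ complexAdjoint R (G (R x))) := by
  intro φ hφ hs i
  set ψ : EuclideanSpace ℝ (Fin d) → ℝ := φ ∘ R.symm with hψ
  have hψs : ContDiff ℝ (⊤ : ℕ∞) ψ := hφ.comp R.symm.contDiff
  have hψc : HasCompactSupport ψ := hs.comp_homeomorph R.symm.toHomeomorph
  have hφψ : φ = ψ ∘ R := by ext x; simp [hψ]
  have hd : ∀ x, fderiv ℝ φ x (EuclideanSpace.single i 1)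
      = ∑ j, R (EuclideanSpace.single i 1) j
        • fderiv ℝ ψ (R x) (EuclideanSpace.single j 1) := by
    intro x
    have h1 : HasFDerivAt φ ((fderiv ℝ ψ (R x)).comp
        (R.toContinuousLinearEquiv : EuclideanSpace ℝ (Fin d) →L[ℝ] EuclideanSpace ℝ (Fin d)))
        x := by
      rw [hφψ]
      exact (hψs.differentiable (by simp) (R x)).hasFDerivAt.comp x
        R.toContinuousLinearEquiv.hasFDerivAt
    rw [h1.fderiv]
    exact apply_eq_sum_single (fderiv ℝ ψ (R x)) (R (EuclideanSpace.single i 1))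
  have hmp := R.measurePreserving
  have hemb := R.toHomeomorph.measurableEmbedding
  have hL : ∫ x, fderiv ℝ φ x (EuclideanSpace.single i 1) • (u ∘ R) x
      = ∑ j, R (EuclideanSpace.single i 1) j
        • ∫ y, fderiv ℝ ψ y (EuclideanSpace.single j 1) • u y := by
    simp only [hd, Function.comp_apply]
    rw [hmp.integral_comp hemb fun y ↦ (∑ j, R (EuclideanSpace.single i 1) j
      • fderiv ℝ ψ y (EuclideanSpace.single j 1)) • u y]
    simp only [Finset.sum_smul, smul_assoc]
    rw [integral_finsetSum]
    · exact Finset.sum_congr rfl fun j _ ↦ integral_smul _ _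
    · exact fun j _ ↦ (integrable_smul_of_memLp (continuous_partial hψs j)
        (hasCompactSupport_partial hψc j) hu).smul (R (EuclideanSpace.single i 1) j)
  have hRt : ∫ x, φ x • complexAdjoint R (G (R x)) i
      = ∑ j, R (EuclideanSpace.single i 1) j • ∫ y, ψ y • G y j := by
    have h1 : ∀ x, φ x • complexAdjoint R (G (R x)) i
        = (fun y ↦ ψ y • complexAdjoint R (G y) i) (R x) := fun x ↦ by simp [hψ]
    simp only [h1]
    rw [hmp.integral_comp hemb fun y ↦ ψ y • complexAdjoint R (G y) i]
    simp only [complexAdjoint_apply, Finset.smul_sum]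
    rw [integral_finsetSum]
    · refine Finset.sum_congr rfl fun j _ ↦ ?_
      rw [← integral_smul]
      exact integral_congr_ae (Eventually.of_forall fun y ↦ smul_comm _ _ _)
    · intro j _
      have := (integrable_smul_of_memLp hψs.continuous hψc (memLp_coord hG j)).smul
        (R (EuclideanSpace.single i 1) j)
      refine this.congr (Eventually.of_forall fun y ↦ ?_)
      exact smul_comm (R (EuclideanSpace.single i 1) j) (ψ y) (G y j)
  rw [hL, hRt, ← Finset.sum_neg_distrib]
  refine Finset.sum_congr rfl fun j _ ↦ ?_
  rw [h ψ hψs hψc j, smul_neg]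

theorem IsWeakGradient.congr_ae {u u' : EuclideanSpace ℝ (Fin d) → ℂ}
    {G G' : EuclideanSpace ℝ (Fin d) → EuclideanSpace ℂ (Fin d)} (h : IsWeakGradient u G)
    (hu : u' =ᵐ[volume] u) (hG : G' =ᵐ[volume] G) : IsWeakGradient u' G' := by
  intro φ hφ hs i
  rw [integral_congr_ae (g := fun x ↦ fderiv ℝ φ x (EuclideanSpace.single i 1) • u x),
    integral_congr_ae (f := fun x ↦ φ x • G' x i) (g := fun x ↦ φ x • G x i), h φ hφ hs i]
  · filter_upwards [hG] with x hx
    rw [hx]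
  · filter_upwards [hu] with x hx
    rw [hx]

end ComplexAdjoint

namespace H1

variable {d : ℕ}

/-- The element of `H¹` given by a square integrable function with a square integrable weak
gradient. -/
noncomputable def mk {u : EuclideanSpace ℝ (Fin d) → ℂ}
    {G : EuclideanSpace ℝ (Fin d) → EuclideanSpace ℂ (Fin d)} (hu : MemLp u 2 volume)
    (hG : MemLp G 2 volume) (h : IsWeakGradient u G) : H1 d :=
  ⟨WithLp.toLp 2 (hu.toLp u, hG.toLp G), h.congr_ae hu.coeFn_toLp hG.coeFn_toLp⟩

theorem toFun_mk {u : EuclideanSpace ℝ (Fin d) → ℂ}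
    {G : EuclideanSpace ℝ (Fin d) → EuclideanSpace ℂ (Fin d)} (hu : MemLp u 2 volume)
    (hG : MemLp G 2 volume) (h : IsWeakGradient u G) : toFun (mk hu hG h) =ᵐ[volume] u :=
  hu.coeFn_toLp

theorem grad_mk {u : EuclideanSpace ℝ (Fin d) → ℂ}
    {G : EuclideanSpace ℝ (Fin d) → EuclideanSpace ℂ (Fin d)} (hu : MemLp u 2 volume)
    (hG : MemLp G 2 volume) (h : IsWeakGradient u G) : grad (mk hu hG h) =ᵐ[volume] G :=
  hG.coeFn_toLp

theorem memLp_comp (R : EuclideanSpace ℝ (Fin d) ≃ₗᵢ[ℝ] EuclideanSpace ℝ (Fin d)) (v : H1 d) :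
    MemLp (toFun v ∘ R) 2 volume :=
  (memLp_toFun v).comp_measurePreserving R.measurePreserving

theorem memLp_grad_comp (R : EuclideanSpace ℝ (Fin d) ≃ₗᵢ[ℝ] EuclideanSpace ℝ (Fin d))
    (v : H1 d) : MemLp (fun x ↦ complexAdjoint R (grad v (R x))) 2 volume :=
  (complexAdjoint R).comp_memLp' ((memLp_grad v).comp_measurePreserving R.measurePreserving)

/-- Composition with a linear isometry of `ℝᵈ`. -/
noncomputable def comp (R : EuclideanSpace ℝ (Fin d) ≃ₗᵢ[ℝ] EuclideanSpace ℝ (Fin d)) (v : H1 d) :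
    H1 d :=
  mk (memLp_comp R v) (memLp_grad_comp R v)
    ((isWeakGradient v).comp_linearIsometryEquiv (memLp_toFun v) (memLp_grad v) R)

theorem toFun_comp (R : EuclideanSpace ℝ (Fin d) ≃ₗᵢ[ℝ] EuclideanSpace ℝ (Fin d)) (v : H1 d) :
    toFun (comp R v) =ᵐ[volume] fun x ↦ toFun v (R x) :=
  toFun_mk _ _ _

theorem grad_comp (R : EuclideanSpace ℝ (Fin d) ≃ₗᵢ[ℝ] EuclideanSpace ℝ (Fin d)) (v : H1 d) :
    grad (comp R v) =ᵐ[volume] fun x ↦ complexAdjoint R (grad v (R x)) :=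
  grad_mk _ _ _

theorem ae_comp (R : EuclideanSpace ℝ (Fin d) ≃ₗᵢ[ℝ] EuclideanSpace ℝ (Fin d))
    {P : EuclideanSpace ℝ (Fin d) → Prop} (h : ∀ᵐ x, P x) : ∀ᵐ x, P (R x) :=
  R.measurePreserving.quasiMeasurePreserving.ae h

theorem norm_toL2_comp (R : EuclideanSpace ℝ (Fin d) ≃ₗᵢ[ℝ] EuclideanSpace ℝ (Fin d)) (v : H1 d) :
    ‖toL2 d (comp R v)‖ = ‖toL2 d v‖ := by
  rw [Lp.norm_def, Lp.norm_def, coe_toL2, coe_toL2, eLpNorm_congr_ae (toFun_comp R v)]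
  congr 1
  exact eLpNorm_comp_measurePreserving (stronglyMeasurable_toFun v).aestronglyMeasurable
    R.measurePreserving

theorem norm_gradL2_comp (R : EuclideanSpace ℝ (Fin d) ≃ₗᵢ[ℝ] EuclideanSpace ℝ (Fin d))
    (v : H1 d) : ‖gradL2 d (comp R v)‖ = ‖gradL2 d v‖ := by
  rw [Lp.norm_def, Lp.norm_def, coe_gradL2, coe_gradL2, eLpNorm_congr_ae (grad_comp R v),
    eLpNorm_congr_norm_ae (f := fun x ↦ complexAdjoint R (grad v (R x))) (g := grad v ∘ R)
      (Eventually.of_forall fun x ↦ norm_complexAdjoint R _)]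
  congr 1
  exact eLpNorm_comp_measurePreserving (stronglyMeasurable_grad v).aestronglyMeasurable
    R.measurePreserving

/-- Composition with a linear isometry of `ℝᵈ` is a linear isometry of `H¹`. -/
noncomputable def compₗᵢ (R : EuclideanSpace ℝ (Fin d) ≃ₗᵢ[ℝ] EuclideanSpace ℝ (Fin d)) :
    H1 d →ₗᵢ[ℝ] H1 d where
  toFun := comp R
  map_add' v w := by
    refine ext_toFun ?_
    filter_upwards [toFun_comp R (v + w), toFun_add (comp R v) (comp R w), toFun_comp R v,
      toFun_comp R w, ae_comp R (toFun_add v w)] with x h1 h2 h3 h4 h5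
    simp [h1, h2, h3, h4, h5]
  map_smul' t v := by
    refine ext_toFun ?_
    filter_upwards [toFun_comp R (t • v), toFun_smul t (comp R v), toFun_comp R v,
      ae_comp R (toFun_smul t v)] with x h1 h2 h3 h4
    simp [h1, h2, h3, h4]
  norm_map' v := by
    change ‖comp R v‖ = ‖v‖
    refine (sq_eq_sq₀ (norm_nonneg _) (norm_nonneg _)).1 ?_
    rw [norm_sq_eq, norm_sq_eq, norm_toL2_comp, norm_gradL2_comp]

theorem compₗᵢ_apply (R : EuclideanSpace ℝ (Fin d) ≃ₗᵢ[ℝ] EuclideanSpace ℝ (Fin d)) (v : H1 d) :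
    compₗᵢ R v = comp R v := rfl

theorem comp_comp_symm (R : EuclideanSpace ℝ (Fin d) ≃ₗᵢ[ℝ] EuclideanSpace ℝ (Fin d)) (v : H1 d) :
    comp R (comp R.symm v) = v := by
  refine ext_toFun ?_
  filter_upwards [toFun_comp R (comp R.symm v), ae_comp R (toFun_comp R.symm v)] with x h1 h2
  rw [h1, h2, R.symm_apply_apply]

/-- The closed subspace of radial functions. -/
noncomputable def radial (d : ℕ) : Submodule ℝ (H1 d) :=
  ⨅ R : EuclideanSpace ℝ (Fin d) ≃ₗᵢ[ℝ] EuclideanSpace ℝ (Fin d),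
    LinearMap.eqLocus (compₗᵢ R).toLinearMap LinearMap.id

theorem mem_radial {v : H1 d} : v ∈ radial d ↔
    ∀ R : EuclideanSpace ℝ (Fin d) ≃ₗᵢ[ℝ] EuclideanSpace ℝ (Fin d), comp R v = v := by
  simp only [radial, Submodule.mem_iInf, LinearMap.mem_eqLocus]
  rfl

theorem mem_radial_iff {v : H1 d} : v ∈ radial d ↔ v ∈ H1rad d := by
  rw [mem_radial]
  refine forall_congr' fun R ↦ ⟨fun h ↦ ?_, fun h ↦ ?_⟩
  · have := toFun_comp R v
    rw [h] at this
    exact this.symm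
  · exact ext_toFun ((toFun_comp R v).trans h)

theorem isClosed_radial (d : ℕ) : IsClosed (radial d : Set (H1 d)) := by
  have : (radial d : Set (H1 d)) =
      ⋂ R : EuclideanSpace ℝ (Fin d) ≃ₗᵢ[ℝ] EuclideanSpace ℝ (Fin d), {v | comp R v = v} := by
    ext v
    simp [mem_radial]
  rw [this]
  exact isClosed_iInter fun R ↦ isClosed_eq (compₗᵢ R).continuous continuous_id

noncomputable instance (d : ℕ) : CompleteSpace (radial d) :=
  (isClosed_radial d).completeSpace_coe

/-- **Principle of symmetric criticality**: if a rotation invariant functional is differentiable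
at a radial point and its derivative vanishes on radial functions, the derivative vanishes. -/
theorem eq_zero_of_forall_radial {S : H1 d → ℝ} {D : H1 d →L[ℝ] ℝ} {v : H1 d}
    (hS : ∀ R w, S (comp R w) = S w) (hv : v ∈ radial d) (hD : HasFDerivAt S D v)
    (h : ∀ w ∈ radial d, D w = 0) : D = 0 := by
  have hinv : ∀ R w, D (comp R w) = D w := by
    intro R w
    have h1 : HasFDerivAt S D (compₗᵢ R v) := by
      rwa [compₗᵢ_apply, mem_radial.1 hv R]
    have h2 := h1.comp v (compₗᵢ R).toContinuousLinearMap.hasFDerivAt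
    have h3 : S ∘ compₗᵢ R = S := funext fun w ↦ hS R w
    rw [h3] at h2
    have h4 := h2.unique hD
    exact congrArg (fun L : H1 d →L[ℝ] ℝ ↦ L w) h4
  -- The Riesz representative of an invariant functional is invariant, hence radial, so `D` vanishes
  -- on it and `‖z‖² = D z = 0`.
  set z := (InnerProductSpace.toDual ℝ (H1 d)).symm D with hz
  have hzD : ∀ w, inner ℝ z w = D w := fun w ↦ InnerProductSpace.toDual_symm_apply
  have hzr : z ∈ radial d := by
    refine mem_radial.2 fun R ↦ ext_inner_right ℝ fun w ↦ ?_
    rw [← comp_comp_symm R w, ← compₗᵢ_apply, ← compₗᵢ_apply R (comp R.symm w),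
      (compₗᵢ R).inner_map_map, hzD, hzD, compₗᵢ_apply, hinv R]
  have h0 : z = 0 := by
    rw [← inner_self_eq_zero (𝕜 := ℝ), hzD]
    exact h z hzr
  ext w
  rw [← hzD, h0, inner_zero_left]
  rfl

end H1

end InverseSquareNLS

/-! ### Differentiability of the power of the `Lᵖ` norm -/

namespace InverseSquareNLS

open Filter Topology ContinuousLinearMap
open scoped ENNReal NNReal

section NormPower

variable {F : Type*} [NormedAddCommGroup F] [InnerProductSpace ℝ F]

/-- Bernoulli's inequality for `(s/r)^(q+1)`. For `q < 1` the power `t^q` is not Lipschitz at zero;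
the extra factor `s` compensates. -/
theorem rpow_mul_sub_le {r s q : ℝ} (hs : 0 ≤ s) (hsr : s ≤ r) (hq : 0 < q) :
    (r ^ q - s ^ q) * s ≤ (q + 1) * (r ^ q * (r - s)) := by
  rcases (hs.trans hsr).eq_or_lt with h0 | hr
  · have : s = 0 := le_antisymm (hsr.trans h0.symm.le) hs
    simp [← h0, this]
  have h1 := one_add_mul_self_le_rpow_one_add (s := s / r - 1) (p := q + 1)
    (by linarith [div_nonneg hs hr.le]) (by linarith)
  rw [add_sub_cancel, Real.div_rpow hs hr.le, le_div_iff₀ (by positivity),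
    Real.rpow_add_one hr.ne', Real.rpow_add_one' hs (by linarith)] at h1
  have h2 : (1 + (q + 1) * (s / r - 1)) * (r ^ q * r)
      = r ^ q * r - (q + 1) * (r ^ q * (r - s)) := by
    field_simp
    ring
  have h3 : r ^ q * s ≤ r ^ q * r := by gcongr
  rw [h2] at h1
  linarith

/-- With `x` the longer vector, the difference is `‖x‖^q (x - a)` plus a difference of weights
multiplying the shorter vector, the case where the scalar inequality applies. -/
theorem norm_rpow_smul_sub_le {x a : F} {q M : ℝ} (hq : 0 < q) (hx : ‖x‖ ≤ M) (ha : ‖a‖ ≤ M) :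
    ‖‖x‖ ^ q • x - ‖a‖ ^ q • a‖ ≤ (q + 2) * M ^ q * ‖x - a‖ := by
  wlog h : ‖a‖ ≤ ‖x‖ generalizing x a
  · rw [norm_sub_rev, norm_sub_rev x a]
    exact this ha hx (le_of_not_ge h)
  have h1 : ‖x‖ ^ q • x - ‖a‖ ^ q • a = ‖x‖ ^ q • (x - a) + (‖x‖ ^ q - ‖a‖ ^ q) • a := by
    module
  have h2 : ‖a‖ ^ q ≤ ‖x‖ ^ q := by gcongr
  have h3 := rpow_mul_sub_le (norm_nonneg a) h hq
  have h4 : ‖x‖ - ‖a‖ ≤ ‖x - a‖ := norm_sub_norm_le x a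
  have h5 : ‖x‖ ^ q ≤ M ^ q := by gcongr
  have h6 : 0 ≤ ‖x‖ ^ q := by positivity
  rw [h1]
  refine (norm_add_le _ _).trans ?_
  rw [norm_smul, norm_smul, Real.norm_of_nonneg h6, Real.norm_of_nonneg (sub_nonneg.2 h2)]
  calc ‖x‖ ^ q * ‖x - a‖ + (‖x‖ ^ q - ‖a‖ ^ q) * ‖a‖
      ≤ ‖x‖ ^ q * ‖x - a‖ + (q + 1) * (‖x‖ ^ q * ‖x - a‖) := by
        refine add_le_add le_rfl (h3.trans ?_)
        gcongr
    _ = (q + 2) * ‖x‖ ^ q * ‖x - a‖ := by ring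
    _ ≤ (q + 2) * M ^ q * ‖x - a‖ := by gcongr

/-- Second-order Taylor control without second derivatives: the mean value inequality on the segment
from `a` to `a + b`, with the Lipschitz bound for `x ↦ ‖x‖^(p-2) x` on the ball of radius `‖a‖ +
‖b‖`. -/
theorem abs_norm_rpow_add_sub_le {p : ℝ} (hp : 2 < p) (a b : F) :
    |‖a + b‖ ^ p - ‖a‖ ^ p - p * ‖a‖ ^ (p - 2) * inner ℝ a b|
      ≤ p ^ 2 * (‖a‖ + ‖b‖) ^ (p - 2) * ‖b‖ ^ 2 := by
  set m := p * ‖a‖ ^ (p - 2) * inner ℝ a b with hm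
  have hd : ∀ t : ℝ, HasDerivAt (fun t : ℝ ↦ ‖a + t • b‖ ^ p - t * m)
      (p * ‖a + t • b‖ ^ (p - 2) * inner ℝ (a + t • b) b - m) t := by
    intro t
    have h1 : HasDerivAt (fun t : ℝ ↦ a + t • b) b t := by
      simpa using ((hasDerivAt_id t).smul_const b).const_add a
    have h2 := (hasFDerivAt_norm_rpow (a + t • b) (by linarith : 1 < p)).comp_hasDerivAt t h1
    have h3 : HasDerivAt (fun t : ℝ ↦ t * m) m t := by
      simpa using (hasDerivAt_id t).mul_const m
    exact h2.sub h3
  have hb : ∀ t ∈ Ico (0 : ℝ) 1,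
      ‖p * ‖a + t • b‖ ^ (p - 2) * inner ℝ (a + t • b) b - m‖
        ≤ p ^ 2 * (‖a‖ + ‖b‖) ^ (p - 2) * ‖b‖ ^ 2 := by
    intro t ht
    have h1 : p * ‖a + t • b‖ ^ (p - 2) * inner ℝ (a + t • b) b - m
        = p * inner ℝ (‖a + t • b‖ ^ (p - 2) • (a + t • b) - ‖a‖ ^ (p - 2) • a) b := by
      rw [inner_sub_left, real_inner_smul_left, real_inner_smul_left, hm]
      ring
    have htb : ‖t • b‖ ≤ ‖b‖ := by
      rw [norm_smul, Real.norm_of_nonneg ht.1]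
      exact mul_le_of_le_one_left (norm_nonneg b) ht.2.le
    have h2 := norm_rpow_smul_sub_le (x := a + t • b) (a := a) (q := p - 2) (M := ‖a‖ + ‖b‖)
      (by linarith) ((norm_add_le _ _).trans (add_le_add le_rfl htb))
      (le_add_of_nonneg_right (norm_nonneg b))
    rw [add_sub_cancel_left, sub_add_cancel] at h2
    rw [h1, norm_mul, Real.norm_of_nonneg (by linarith)]
    calc p * ‖inner ℝ (‖a + t • b‖ ^ (p - 2) • (a + t • b) - ‖a‖ ^ (p - 2) • a) b‖
        ≤ p * ((p * (‖a‖ + ‖b‖) ^ (p - 2) * ‖b‖) * ‖b‖) := by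
          gcongr
          refine (norm_inner_le_norm _ _).trans ?_
          gcongr
          refine h2.trans ?_
          gcongr
      _ = p ^ 2 * (‖a‖ + ‖b‖) ^ (p - 2) * ‖b‖ ^ 2 := by ring
  have := norm_image_sub_le_of_norm_deriv_le_segment_01'
    (fun t _ ↦ (hd t).hasDerivWithinAt) hb
  rw [Real.norm_eq_abs] at this
  convert! this using 2
  simp
  ring

/-- Writing `b = s c` extracts `s²`, and the rest is a `p`-th power of the larger of `a` and `c`.
With `s = ‖h‖` this takes the place of Hölder's inequality in the remainder estimate. -/
theorem add_rpow_mul_sq_le {a b s p : ℝ} (ha : 0 ≤ a) (hb : 0 ≤ b) (hs : 0 < s) (hs1 : s ≤ 1)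
    (hp : 2 < p) :
    (a + b) ^ (p - 2) * b ^ 2 ≤ s ^ 2 * (2 ^ p * (a ^ p + (s ^ p)⁻¹ * b ^ p)) := by
  set c := b / s with hc
  have hc0 : 0 ≤ c := by positivity
  have hbc : b ≤ c := by rw [hc, le_div_iff₀ hs]; nlinarith
  have hb' : b = s * c := by rw [hc]; field_simp
  have h1 : (s ^ p)⁻¹ * b ^ p = c ^ p := by
    rw [hc, Real.div_rpow hb hs.le, div_eq_inv_mul]
  set M := max a c with hM
  have hM0 : 0 ≤ M := ha.trans (le_max_left _ _)
  have h2 : (a + b) ^ (p - 2) ≤ (2 * M) ^ (p - 2) := by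
    gcongr
    linarith [le_max_left a c, le_max_right a c]
  have h3 : M ^ p ≤ a ^ p + c ^ p := by
    rcases max_cases a c with ⟨h, _⟩ | ⟨h, _⟩
    · rw [hM, h]; linarith [Real.rpow_nonneg hc0 p]
    · rw [hM, h]; linarith [Real.rpow_nonneg ha p]
  rw [h1]
  calc (a + b) ^ (p - 2) * b ^ 2 ≤ (2 * M) ^ (p - 2) * (s ^ 2 * M ^ 2) := by
        rw [← mul_pow]
        gcongr
        rw [hb']
        gcongr
        exact le_max_right _ _
    _ = s ^ 2 * (2 ^ (p - 2) * (M ^ (p - 2) * M ^ (2 : ℝ))) := by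
        rw [Real.mul_rpow (by norm_num) hM0, Real.rpow_two]; ring
    _ = s ^ 2 * (2 ^ (p - 2) * M ^ p) := by
        rw [← Real.rpow_add' hM0 (by linarith), sub_add_cancel]
    _ ≤ s ^ 2 * (2 ^ p * (a ^ p + c ^ p)) := by
        gcongr
        · norm_num
        · linarith

end NormPower

section LpPower

variable {X F : Type*} [MeasurableSpace X] {μ : Measure X} [NormedAddCommGroup F]
  {p : ℝ}

theorem integrable_norm_rpow_Lp (hp : 0 < p) (f : Lp F (ENNReal.ofReal p) μ) :
    Integrable (fun x ↦ ‖f x‖ ^ p) μ := by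
  have := (Lp.memLp f).integrable_norm_rpow (by simpa using hp) (by simp)
  rwa [ENNReal.toReal_ofReal hp.le] at this

theorem integral_norm_rpow_Lp (hp : 0 < p) (f : Lp F (ENNReal.ofReal p) μ) :
    ∫ x, ‖f x‖ ^ p ∂μ = ‖f‖ ^ p := by
  have h0 : 0 ≤ ∫ x, ‖f x‖ ^ p ∂μ := integral_nonneg fun x ↦ by positivity
  rw [Lp.norm_def, (Lp.memLp f).eLpNorm_eq_integral_rpow_norm (by simpa using hp) (by simp),
    ENNReal.toReal_ofReal hp.le, ENNReal.toReal_ofReal (by positivity), ← Real.rpow_mul h0,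
    inv_mul_cancel₀ hp.ne', Real.rpow_one]

variable [InnerProductSpace ℝ F]

theorem integrable_norm_rpow_mul_inner (hp : 2 < p) (f h : Lp F (ENNReal.ofReal p) μ) :
    Integrable (fun x ↦ p * ‖f x‖ ^ (p - 2) * inner ℝ (f x) (h x)) μ := by
  have hp0 : 0 < p := by linarith
  have hb := ((integrable_norm_rpow_Lp hp0 f).add (integrable_norm_rpow_Lp hp0 h)).const_mul p
  have hf := Lp.aestronglyMeasurable f
  have hh := Lp.aestronglyMeasurable h
  refine hb.mono' ?_ (Eventually.of_forall fun x ↦ ?_)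
  · exact ((hf.norm.aemeasurable.pow_const _).const_mul p).aestronglyMeasurable.mul (hf.inner hh)
  · have h0 := norm_nonneg (f x)
    have h1 : ‖inner ℝ (f x) (h x)‖ ≤ ‖f x‖ * ‖h x‖ := norm_inner_le_norm _ _
    rw [norm_mul, Real.norm_of_nonneg (by positivity), mul_assoc]
    change _ ≤ p * (‖f x‖ ^ p + ‖h x‖ ^ p)
    gcongr
    set M := max ‖f x‖ ‖h x‖ with hM
    have hM0 : 0 ≤ M := h0.trans (le_max_left _ _)
    calc ‖f x‖ ^ (p - 2) * ‖inner ℝ (f x) (h x)‖ ≤ M ^ (p - 2) * (M * M) := by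
          gcongr
          · exact le_max_left _ _
          · refine h1.trans ?_
            gcongr
            · exact le_max_left _ _
            · exact le_max_right _ _
      _ = M ^ (p - 2) * M ^ (2 : ℝ) := by rw [Real.rpow_two, sq]
      _ = M ^ p := by rw [← Real.rpow_add' hM0 (by linarith), sub_add_cancel]
      _ ≤ ‖f x‖ ^ p + ‖h x‖ ^ p := by
          rcases max_cases ‖f x‖ ‖h x‖ with ⟨hm, _⟩ | ⟨hm, _⟩
          · rw [hM, hm]; linarith [Real.rpow_nonneg (norm_nonneg (h x)) p]
          · rw [hM, hm]; linarith [Real.rpow_nonneg h0 p]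

/-- The derivative of `f ↦ ∫ ‖f‖ ^ p` as a linear map. -/
noncomputable def normPowerDeriv (hp : 2 < p) (f : Lp F (ENNReal.ofReal p) μ) :
    Lp F (ENNReal.ofReal p) μ →ₗ[ℝ] ℝ where
  toFun h := ∫ x, p * ‖f x‖ ^ (p - 2) * inner ℝ (f x) (h x) ∂μ
  map_add' g h := by
    rw [← integral_add (integrable_norm_rpow_mul_inner hp f g)
      (integrable_norm_rpow_mul_inner hp f h)]
    refine integral_congr_ae ?_
    filter_upwards [Lp.coeFn_add g h] with x hx
    rw [hx, Pi.add_apply, inner_add_right, mul_add]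
  map_smul' t h := by
    rw [RingHom.id_apply, smul_eq_mul, ← integral_const_mul]
    refine integral_congr_ae ?_
    filter_upwards [Lp.coeFn_smul t h] with x hx
    rw [hx, Pi.smul_apply, real_inner_smul_right]
    ring

variable [Fact (1 ≤ ENNReal.ofReal p)]

/-- Integrate the pointwise Taylor bound with `s = ‖h‖`: the term `‖h‖⁻ᵖ ∫ |h|ᵖ` equals one, which
leaves a remainder quadratic in `‖h‖`. -/
theorem abs_normPower_remainder_le (hp : 2 < p) (f h : Lp F (ENNReal.ofReal p) μ)
    (hh : ‖h‖ ≤ 1) :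
    |‖f + h‖ ^ p - ‖f‖ ^ p - normPowerDeriv hp f h|
      ≤ p ^ 2 * 2 ^ p * (‖f‖ ^ p + 1) * ‖h‖ ^ 2 := by
  have hp0 : 0 < p := by linarith
  rcases eq_or_ne h 0 with rfl | h0
  · simp
  have hs : 0 < ‖h‖ := norm_pos_iff.2 h0
  have hi1 := integrable_norm_rpow_Lp hp0 (f + h)
  have hi2 := integrable_norm_rpow_Lp hp0 f
  have hi3 := integrable_norm_rpow_mul_inner hp f h
  have hi4 := integrable_norm_rpow_Lp hp0 h
  have h1 : ‖f + h‖ ^ p - ‖f‖ ^ p - normPowerDeriv hp f h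
      = ∫ x, (‖(f + h) x‖ ^ p - ‖f x‖ ^ p - p * ‖f x‖ ^ (p - 2) * inner ℝ (f x) (h x)) ∂μ := by
    have hi5 : Integrable (fun x ↦ ‖(f + h) x‖ ^ p - ‖f x‖ ^ p) μ := hi1.sub hi2
    rw [integral_sub hi5 hi3, integral_sub hi1 hi2, integral_norm_rpow_Lp hp0,
      integral_norm_rpow_Lp hp0]
    rfl
  have hpt : ∀ᵐ x ∂μ, ‖‖(f + h) x‖ ^ p - ‖f x‖ ^ p - p * ‖f x‖ ^ (p - 2) * inner ℝ (f x) (h x)‖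
      ≤ p ^ 2 * ‖h‖ ^ 2 * 2 ^ p * (‖f x‖ ^ p + (‖h‖ ^ p)⁻¹ * ‖h x‖ ^ p) := by
    filter_upwards [Lp.coeFn_add f h] with x hx
    rw [hx, Pi.add_apply, Real.norm_eq_abs]
    refine (abs_norm_rpow_add_sub_le hp _ _).trans ?_
    have := add_rpow_mul_sq_le (norm_nonneg (f x)) (norm_nonneg (h x)) hs hh hp
    calc _ = p ^ 2 * ((‖f x‖ + ‖h x‖) ^ (p - 2) * ‖h x‖ ^ 2) := by ring
      _ ≤ p ^ 2 * (‖h‖ ^ 2 * (2 ^ p * (‖f x‖ ^ p + (‖h‖ ^ p)⁻¹ * ‖h x‖ ^ p))) := by gcongr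
      _ = _ := by ring
  rw [h1, ← Real.norm_eq_abs]
  refine (norm_integral_le_of_norm_le ((hi2.add (hi4.const_mul _)).const_mul _) hpt).trans_eq ?_
  rw [integral_const_mul]
  have h2 : ∫ x, ((fun x ↦ ‖f x‖ ^ p) + fun x ↦ (‖h‖ ^ p)⁻¹ * ‖h x‖ ^ p) x ∂μ
      = ‖f‖ ^ p + 1 := by
    rw [integral_add' hi2 (hi4.const_mul _), integral_const_mul, integral_norm_rpow_Lp hp0,
      integral_norm_rpow_Lp hp0, inv_mul_cancel₀ (by positivity)]
  rw [h2]
  ring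

theorem exists_hasFDerivAt_norm_rpow_Lp (hp : 2 < p) (f : Lp F (ENNReal.ofReal p) μ) :
    ∃ D : Lp F (ENNReal.ofReal p) μ →L[ℝ] ℝ,
      HasFDerivAt (fun g : Lp F (ENNReal.ofReal p) μ ↦ ‖g‖ ^ p) D f := by
  have hp0 : 0 < p := by linarith
  -- Boundedness of the derivative follows from the remainder estimate at the unit vector `e =
  -- h/‖h‖` and linearity.
  have hbound : ∀ h : Lp F (ENNReal.ofReal p) μ, ‖normPowerDeriv hp f h‖
      ≤ ((‖f‖ + 1) ^ p + ‖f‖ ^ p + p ^ 2 * 2 ^ p * (‖f‖ ^ p + 1)) * ‖h‖ := by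
    intro h
    rcases eq_or_ne h 0 with rfl | h0
    · simp
    have hs : 0 < ‖h‖ := norm_pos_iff.2 h0
    set e := ‖h‖⁻¹ • h with he
    have he1 : ‖e‖ = 1 := by rw [he, norm_smul, norm_inv, norm_norm, inv_mul_cancel₀ hs.ne']
    have h1 := abs_normPower_remainder_le hp f e he1.le
    have h2 : ‖f + e‖ ^ p ≤ (‖f‖ + 1) ^ p := by
      gcongr
      exact (norm_add_le _ _).trans_eq (by rw [he1])
    have h3 : 0 ≤ ‖f + e‖ ^ p := by positivity
    have h4 : 0 ≤ ‖f‖ ^ p := by positivity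
    rw [he1, one_pow, mul_one, abs_le] at h1
    have h5 : ‖normPowerDeriv hp f e‖
        ≤ (‖f‖ + 1) ^ p + ‖f‖ ^ p + p ^ 2 * 2 ^ p * (‖f‖ ^ p + 1) := by
      rw [Real.norm_eq_abs, abs_le]
      constructor <;> linarith [h1.1, h1.2]
    have h6 : normPowerDeriv hp f h = ‖h‖ * normPowerDeriv hp f e := by
      rw [he, map_smul, smul_eq_mul, mul_inv_cancel_left₀ hs.ne']
    rw [h6, norm_mul, norm_norm, mul_comm]
    gcongr
  refine ⟨(normPowerDeriv hp f).mkContinuous _ hbound, ?_⟩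
  rw [hasFDerivAt_iff_isLittleO_nhds_zero]
  refine Asymptotics.IsBigO.trans_isLittleO (g := fun h ↦ ‖h‖ ^ 2) ?_
    (Asymptotics.isLittleO_norm_pow_id one_lt_two)
  refine Asymptotics.IsBigO.of_bound (p ^ 2 * 2 ^ p * (‖f‖ ^ p + 1)) ?_
  filter_upwards [Metric.closedBall_mem_nhds (0 : Lp F (ENNReal.ofReal p) μ) one_pos] with h hh
  rw [norm_pow, norm_norm]
  exact abs_normPower_remainder_le hp f h (by simpa using hh)

end LpPower

end InverseSquareNLS

/-! ### Compactness of the radial embedding -/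

namespace InverseSquareNLS

open Filter Topology ContinuousLinearMap
open scoped ENNReal NNReal

namespace H1

variable {d : ℕ}

theorem exists_linearIsometryEquiv_apply_eq {x y : EuclideanSpace ℝ (Fin d)} (h : ‖x‖ = ‖y‖) :
    ∃ R : EuclideanSpace ℝ (Fin d) ≃ₗᵢ[ℝ] EuclideanSpace ℝ (Fin d), R x = y :=
  ⟨_, Submodule.reflection_sub h⟩

/-- From dimension two on the unit sphere is connected with more than one point, hence infinite. -/
theorem exists_injective_unit_vectors (hd : 2 ≤ d) (N : ℕ) :
    ∃ u : Fin N → EuclideanSpace ℝ (Fin d), Function.Injective u ∧ ∀ k, ‖u k‖ = 1 := by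
  have hrank : 1 < Module.rank ℝ (EuclideanSpace ℝ (Fin d)) := by
    rw [← Module.finrank_eq_rank, finrank_euclideanSpace_fin]
    exact_mod_cast hd
  have hconn := isConnected_sphere hrank (0 : EuclideanSpace ℝ (Fin d)) zero_le_one
  have hnt : (Metric.sphere (0 : EuclideanSpace ℝ (Fin d)) 1).Nontrivial := by
    refine ⟨EuclideanSpace.single ⟨0, by omega⟩ 1, by simp,
      EuclideanSpace.single ⟨1, by omega⟩ 1, by simp, fun h ↦ ?_⟩
    have := congrArg (fun v : EuclideanSpace ℝ (Fin d) ↦ v ⟨0, by omega⟩) h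
    simp at this
  have hinf : (Metric.sphere (0 : EuclideanSpace ℝ (Fin d)) 1).Infinite :=
    hconn.isPreconnected.infinite_of_nontrivial hnt
  refine ⟨fun k ↦ hinf.natEmbedding _ k, fun k l h ↦ ?_, fun k ↦ ?_⟩
  · exact Fin.ext ((hinf.natEmbedding _).injective (Subtype.ext h))
  · exact mem_sphere_zero_iff_norm.1 (hinf.natEmbedding _ k).2

theorem lintegral_closedBall_eq_of_mem_radial {v : H1 d} (hv : v ∈ radial d)
    {x y : EuclideanSpace ℝ (Fin d)} (h : ‖x‖ = ‖y‖) (r : ℝ) :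
    ∫⁻ z in Metric.closedBall x r, ‖toFun v z‖ₑ ^ (2 : ℝ)
      = ∫⁻ z in Metric.closedBall y r, ‖toFun v z‖ₑ ^ (2 : ℝ) := by
  obtain ⟨R, rfl⟩ := exists_linearIsometryEquiv_apply_eq h
  have h1 := R.measurePreserving.setLIntegral_comp_preimage_emb
    R.toHomeomorph.measurableEmbedding (fun z ↦ ‖toFun v z‖ₑ ^ (2 : ℝ)) (Metric.closedBall (R x) r)
  have h2 : R ⁻¹' Metric.closedBall (R x) r = Metric.closedBall x r := by
    ext z
    simp
  rw [← h1, h2]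
  refine setLIntegral_congr_fun_ae Metric.isClosed_closedBall.measurableSet ?_
  filter_upwards [mem_radial_iff.1 hv R] with z hz _
  rw [hz]

/-- The `L²` mass of a radial function in balls of fixed radius far from the origin is small. -/
theorem exists_radius_mul_lintegral_closedBall_le (hd : 2 ≤ d) (N : ℕ) (r : ℝ) :
    ∃ ρ : ℝ, ∀ v ∈ radial d, ∀ x : EuclideanSpace ℝ (Fin d), ρ ≤ ‖x‖ →
      N * ∫⁻ z in Metric.closedBall x r, ‖toFun v z‖ₑ ^ (2 : ℝ)
        ≤ ∫⁻ z, ‖toFun v z‖ₑ ^ (2 : ℝ) := by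
  obtain ⟨u, hu, hu1⟩ := exists_injective_unit_vectors hd N
  -- For `‖x‖ ≥ ρ` the centres `‖x‖ u k` lie at mutual distance at least `2r + 1`, so the balls are
  -- disjoint. Diagonal pairs contribute a division by zero, that is `0`, and are harmless.
  obtain ⟨ρ, hρ⟩ := (finite_range fun q : Fin N × Fin N ↦
    (2 * r + 1) / ‖u q.1 - u q.2‖).bddAbove
  refine ⟨ρ, fun v hv x hx ↦ ?_⟩
  have hdisj : Pairwise (Function.onFun Disjoint fun k ↦ Metric.closedBall (‖x‖ • u k) r) := by
    intro k l hkl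
    refine Metric.closedBall_disjoint_closedBall ?_
    have hpos : 0 < ‖u k - u l‖ := norm_pos_iff.2 (sub_ne_zero.2 fun h ↦ hkl (hu h))
    have h1 : (2 * r + 1) / ‖u k - u l‖ ≤ ‖x‖ := (hρ ⟨(k, l), rfl⟩).trans hx
    rw [div_le_iff₀ hpos] at h1
    rw [dist_eq_norm, ← smul_sub, norm_smul, norm_norm]
    linarith
  have h1 : ∀ k, ∫⁻ z in Metric.closedBall (‖x‖ • u k) r, ‖toFun v z‖ₑ ^ (2 : ℝ)
      = ∫⁻ z in Metric.closedBall x r, ‖toFun v z‖ₑ ^ (2 : ℝ) := fun k ↦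
    lintegral_closedBall_eq_of_mem_radial hv (by rw [norm_smul, norm_norm, hu1, mul_one]) r
  calc N * ∫⁻ z in Metric.closedBall x r, ‖toFun v z‖ₑ ^ (2 : ℝ)
      = ∑ k, ∫⁻ z in Metric.closedBall (‖x‖ • u k) r, ‖toFun v z‖ₑ ^ (2 : ℝ) := by
        rw [Finset.sum_congr rfl fun k _ ↦ h1 k, Finset.sum_const, Finset.card_univ,
          Fintype.card_fin, nsmul_eq_mul]
    _ = ∫⁻ z in ⋃ k, Metric.closedBall (‖x‖ • u k) r, ‖toFun v z‖ₑ ^ (2 : ℝ) := by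
        rw [lintegral_iUnion (fun k ↦ Metric.isClosed_closedBall.measurableSet) hdisj,
          tsum_fintype]
    _ ≤ ∫⁻ z, ‖toFun v z‖ₑ ^ (2 : ℝ) := setLIntegral_le_lintegral _ _

variable (φ : ContDiffBump (0 : EuclideanSpace ℝ (Fin d)))

theorem memLp_bump_sub (x : EuclideanSpace ℝ (Fin d)) :
    MemLp (fun y ↦ φ.normed volume (x - y)) 2 volume :=
  (φ.continuous_normed.comp (continuous_const.sub continuous_id)).memLp_of_hasCompactSupport
    (φ.hasCompactSupport_normed.comp_homeomorph (Homeomorph.subLeft x))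

theorem eLpNorm_comp_sub_left {f : EuclideanSpace ℝ (Fin d) → ℝ}
    (hf : AEStronglyMeasurable f volume) (x : EuclideanSpace ℝ (Fin d)) :
    eLpNorm (fun y ↦ f (x - y)) 2 volume = eLpNorm f 2 volume :=
  eLpNorm_comp_measurePreserving (p := 2) hf (Measure.measurePreserving_sub_left volume x)

theorem eLpNorm_bump_sub (x : EuclideanSpace ℝ (Fin d)) :
    eLpNorm (fun y ↦ φ.normed volume (x - y)) 2 volume = eLpNorm (φ.normed volume) 2 volume :=
  eLpNorm_comp_sub_left (f := φ.normed volume) φ.continuous_normed.aestronglyMeasurable x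

/-- Cauchy–Schwarz on the support of the bump: a value of the mollification sees only the `L²` mass
in one ball, which is small far out for radial functions. -/
theorem enorm_mollify_le (v : H1 d) (x : EuclideanSpace ℝ (Fin d)) :
    ‖mollify φ (toFun v) x‖ₑ ≤ eLpNorm (φ.normed volume) 2 volume
      * eLpNorm (toFun v) 2 (volume.restrict (Metric.closedBall x φ.rOut)) := by
  have hsupp : ∀ y, y ∉ Metric.closedBall x φ.rOut → φ.normed volume (x - y) • toFun v y = 0 := by
    intro y hy
    have : x - y ∉ Function.support (φ.normed volume) := by
      rw [φ.support_normed_eq]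
      intro h
      refine hy (Metric.mem_closedBall.2 ?_)
      rw [dist_comm, dist_eq_norm]
      simpa using (Metric.mem_ball.1 h).le
    rw [Function.notMem_support.1 this, zero_smul]
  rw [mollify_apply', ← setIntegral_eq_integral_of_forall_compl_eq_zero hsupp]
  refine (enorm_integral_le_lintegral_enorm _).trans ?_
  rw [← eLpNorm_one_eq_lintegral_enorm]
  have h1 := eLpNorm_smul_le_mul_eLpNorm (p := 2) (q := 2) (r := 1)
    (μ := volume.restrict (Metric.closedBall x φ.rOut))
    (stronglyMeasurable_toFun v).aestronglyMeasurable
    ((memLp_bump_sub φ x).1.mono_measure Measure.restrict_le_self)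
  refine h1.trans (mul_le_mul' ?_ le_rfl)
  rw [← eLpNorm_bump_sub φ x]
  exact eLpNorm_mono_measure _ Measure.restrict_le_self

theorem enorm_mollify_le_enorm (v : H1 d) (x : EuclideanSpace ℝ (Fin d)) :
    ‖mollify φ (toFun v) x‖ₑ ≤ eLpNorm (φ.normed volume) 2 volume * ‖v‖ₑ := by
  refine (enorm_mollify_le φ v x).trans (mul_le_mul' le_rfl ?_)
  refine (eLpNorm_mono_measure _ Measure.restrict_le_self).trans ?_
  rw [eLpNorm_toFun, ← ofReal_norm, ← ofReal_norm]
  exact ENNReal.ofReal_le_ofReal (norm_toL2_le v)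

theorem eLpNorm_bump_ne_top : eLpNorm (φ.normed volume) 2 volume ≠ ∞ := by
  rw [← eLpNorm_bump_sub φ 0]
  exact (memLp_bump_sub φ 0).2.ne

/-- Mollifications of radial functions decay uniformly at infinity. -/
theorem exists_radius_enorm_mollify_le (hd : 2 ≤ d) {C ε : ℝ≥0∞} (hC : C ≠ ∞) (hε : ε ≠ 0) :
    ∃ ρ : ℝ, ∀ v ∈ radial d, ‖v‖ₑ ≤ C → ∀ x : EuclideanSpace ℝ (Fin d), ρ ≤ ‖x‖ →
      ‖mollify φ (toFun v) x‖ₑ ≤ ε := by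
  set K := eLpNorm (φ.normed volume) 2 volume with hK
  have hKt : K ≠ ∞ := eLpNorm_bump_ne_top φ
  rcases eq_or_ne ε ∞ with rfl | hεt
  · exact ⟨0, fun _ _ _ _ _ ↦ le_top⟩
  -- The number of disjoint copies is fixed in advance by the desired smallness; it must be positive
  -- to be cancelled at the end.
  obtain ⟨N, hN0, hN⟩ : ∃ N : ℕ, 0 < N ∧ (K * C) ^ (2 : ℝ) ≤ N * ε ^ (2 : ℝ) := by
    have hε2 : ε ^ (2 : ℝ) ≠ 0 := by simpa using hε
    obtain ⟨N, hN⟩ := ENNReal.exists_nat_mul_gt (b := (K * C) ^ (2 : ℝ)) hε2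
      (ENNReal.rpow_ne_top_of_nonneg two_pos.le (ENNReal.mul_ne_top hKt hC))
    refine ⟨N + 1, Nat.succ_pos N, hN.le.trans ?_⟩
    gcongr
    simp
  obtain ⟨ρ, hρ⟩ := exists_radius_mul_lintegral_closedBall_le hd N φ.rOut
  refine ⟨ρ, fun v hv hvC x hx ↦ ?_⟩
  have h2 : ∀ μ : Measure (EuclideanSpace ℝ (Fin d)), eLpNorm (toFun v) 2 μ ^ (2 : ℝ)
      = ∫⁻ x, ‖toFun v x‖ₑ ^ (2 : ℝ) ∂μ := fun μ ↦ by
    rw [← eLpNorm_rpow_eq_lintegral _ two_pos]; norm_num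
  have h3 := hρ v hv x hx
  rw [← h2, ← h2, eLpNorm_toFun] at h3
  have h4 : ‖toL2 d v‖ₑ ≤ C := by
    refine le_trans ?_ hvC
    rw [← ofReal_norm, ← ofReal_norm]
    exact ENNReal.ofReal_le_ofReal (norm_toL2_le v)
  have h5 : N * ‖mollify φ (toFun v) x‖ₑ ^ (2 : ℝ) ≤ N * ε ^ (2 : ℝ) := by
    calc N * ‖mollify φ (toFun v) x‖ₑ ^ (2 : ℝ)
        ≤ N * (K * eLpNorm (toFun v) 2 (volume.restrict (Metric.closedBall x φ.rOut)))
            ^ (2 : ℝ) := by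
          gcongr
          exact enorm_mollify_le φ v x
      _ = K ^ (2 : ℝ) * (N * eLpNorm (toFun v) 2
            (volume.restrict (Metric.closedBall x φ.rOut)) ^ (2 : ℝ)) := by
          rw [ENNReal.mul_rpow_of_nonneg _ _ two_pos.le]; ring
      _ ≤ K ^ (2 : ℝ) * C ^ (2 : ℝ) := by
          gcongr
          exact h3.trans (by gcongr)
      _ = (K * C) ^ (2 : ℝ) := (ENNReal.mul_rpow_of_nonneg _ _ two_pos.le).symm
      _ ≤ N * ε ^ (2 : ℝ) := hN
  have h6 := (ENNReal.mul_le_mul_iff_right (by exact_mod_cast hN0.ne') (by simp)).1 h5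
  exact (ENNReal.rpow_le_rpow_iff two_pos).1 h6

theorem stronglyMeasurable_mollify (v : H1 d) : StronglyMeasurable (mollify φ (toFun v)) :=
  (contDiff_mollify φ ((memLp_toFun v).locallyIntegrable one_le_two)).continuous.stronglyMeasurable

/-- The value of the mollification at a fixed point is a bounded linear functional on `H¹`. Weak
convergence is tested by real functionals, hence the split into real and imaginary parts. -/
theorem tendsto_mollify_of_weakly_null {w : ℕ → radial d}
    (hweak : ∀ L : radial d →L[ℝ] ℝ, Tendsto (fun n ↦ L (w n)) atTop (𝓝 0))
    (x : EuclideanSpace ℝ (Fin d)) :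
    Tendsto (fun n ↦ mollify φ (toFun (w n : H1 d)) x) atTop (𝓝 0) := by
  have hL : ∃ L : radial d →L[ℝ] ℂ, ∀ v, L v = mollify φ (toFun (v : H1 d)) x :=
    ⟨(l2Pairing (memLp_bump_sub φ x)).comp ((toL2 d).comp (radial d).subtypeL), fun v ↦ by
      rw [mollify_apply']
      exact l2Pairing_apply (memLp_bump_sub φ x) (toL2 d (v : H1 d))⟩
  obtain ⟨L, hL⟩ := hL
  have hre := (Complex.continuous_ofReal.tendsto 0).comp (hweak (Complex.reCLM.comp L))
  have him := ((Complex.continuous_ofReal.tendsto 0).comp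
    (hweak (Complex.imCLM.comp L))).mul_const Complex.I
  have h := hre.add him
  simp only [Complex.ofReal_zero, zero_mul, add_zero] at h
  refine h.congr fun n ↦ ?_
  rw [← hL]
  exact Complex.re_add_im (L (w n))

theorem exists_rpow_mul_le {C ε : ℝ≥0∞} (hC : C ≠ ∞) (hε : ε ≠ 0) {r : ℝ} (hr : 0 < r) :
    ∃ δ : ℝ≥0∞, δ ≠ 0 ∧ δ ^ r * C ≤ ε := by
  have h1 : Tendsto (fun δ : ℝ≥0∞ ↦ δ ^ r * C) (𝓝 0) (𝓝 0) := by
    have h2 := ENNReal.Tendsto.mul_const (b := C)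
      (ENNReal.continuous_rpow_const (y := r)).continuousAt.tendsto (Or.inr hC) (a := 0 ^ r)
    rwa [ENNReal.zero_rpow_of_pos hr, zero_mul] at h2
  have h3 := (ENNReal.tendsto_nhds_zero.1 h1) ε hε.bot_lt
  obtain ⟨δ, hδ, hδ0⟩ := ((h3.filter_mono nhdsWithin_le_nhds).and
    (self_mem_nhdsWithin (s := Ioi (0 : ℝ≥0∞)) (a := 0))).exists
  exact ⟨δ, (mem_Ioi.1 hδ0).ne', hδ⟩

/-- Where `|m| ≤ δ` one has `|m|ᵖ ≤ δ^(p-2) |m|²`, and the `L²` norm is bounded by `C`; the gain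
comes from `p > 2`. -/
theorem setLIntegral_compl_mollify_le {p : ℝ} (hp : 2 < p) {v : H1 d} {C δ : ℝ≥0∞} {ρ : ℝ}
    (hv : ‖v‖ₑ ≤ C)
    (hρ : ∀ x : EuclideanSpace ℝ (Fin d), ρ ≤ ‖x‖ → ‖mollify φ (toFun v) x‖ₑ ≤ δ) :
    ∫⁻ x in (Metric.ball (0 : EuclideanSpace ℝ (Fin d)) ρ)ᶜ, ‖mollify φ (toFun v) x‖ₑ ^ p
      ≤ δ ^ (p - 2) * C ^ (2 : ℝ) := by
  set m := mollify φ (toFun v) with hm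
  have hmm : Measurable fun x ↦ ‖m x‖ₑ ^ (2 : ℝ) :=
    (stronglyMeasurable_mollify φ v).enorm.pow_const _
  have h2 : ∫⁻ x, ‖m x‖ₑ ^ (2 : ℝ) = eLpNorm m 2 volume ^ (2 : ℝ) := by
    rw [← eLpNorm_rpow_eq_lintegral _ two_pos]
    norm_num
  have h3 : eLpNorm m 2 volume ≤ C := by
    refine (eLpNorm_mollify_le φ (stronglyMeasurable_toFun v) one_le_two (by simp)).trans ?_
    rw [eLpNorm_toFun]
    refine le_trans ?_ hv
    rw [← ofReal_norm, ← ofReal_norm]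
    exact ENNReal.ofReal_le_ofReal (norm_toL2_le v)
  calc ∫⁻ x in (Metric.ball (0 : EuclideanSpace ℝ (Fin d)) ρ)ᶜ, ‖m x‖ₑ ^ p
      ≤ ∫⁻ x in (Metric.ball (0 : EuclideanSpace ℝ (Fin d)) ρ)ᶜ,
          δ ^ (p - 2) * ‖m x‖ₑ ^ (2 : ℝ) := by
        refine setLIntegral_mono' Metric.isOpen_ball.measurableSet.compl fun x hx ↦ ?_
        have hx' : ρ ≤ ‖x‖ := by simpa using hx
        rw [show p = p - 2 + 2 by ring, ENNReal.rpow_add_of_nonneg _ _ (by linarith) two_pos.le,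
          add_sub_cancel_right]
        exact mul_le_mul' (ENNReal.rpow_le_rpow (hρ x hx') (by linarith)) le_rfl
    _ ≤ ∫⁻ x, δ ^ (p - 2) * ‖m x‖ₑ ^ (2 : ℝ) := setLIntegral_le_lintegral _ _
    _ = δ ^ (p - 2) * eLpNorm m 2 volume ^ (2 : ℝ) := by rw [lintegral_const_mul _ hmm, h2]
    _ ≤ δ ^ (p - 2) * C ^ (2 : ℝ) :=
        mul_le_mul' le_rfl (ENNReal.rpow_le_rpow h3 two_pos.le)

/-- Dominated convergence: mollifications of a bounded sequence are bounded by one constant,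
integrable on a set of finite measure. -/
theorem tendsto_setLIntegral_mollify {p : ℝ} (hp : 0 < p) {w : ℕ → H1 d}
    {C : ℝ≥0∞} (hC : C ≠ ∞) (hw : ∀ n, ‖w n‖ₑ ≤ C)
    (hpt : ∀ x, Tendsto (fun n ↦ mollify φ (toFun (w n)) x) atTop (𝓝 0))
    {B : Set (EuclideanSpace ℝ (Fin d))} (hB : volume B ≠ ∞) :
    Tendsto (fun n ↦ ∫⁻ x in B, ‖mollify φ (toFun (w n)) x‖ₑ ^ p) atTop (𝓝 0) := by
  have hKt := eLpNorm_bump_ne_top φ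
  have hbd : ∀ n x, ‖mollify φ (toFun (w n)) x‖ₑ
      ≤ eLpNorm (φ.normed volume) 2 volume * C := fun n x ↦
    (enorm_mollify_le_enorm φ _ x).trans (mul_le_mul' le_rfl (hw n))
  have h1 := tendsto_lintegral_of_dominated_convergence (μ := volume.restrict B)
    (F := fun n x ↦ ‖mollify φ (toFun (w n)) x‖ₑ ^ p) (f := fun _ ↦ 0)
    (fun _ ↦ (eLpNorm (φ.normed volume) 2 volume * C) ^ p)
    (fun n ↦ (stronglyMeasurable_mollify φ _).enorm.pow_const _)
    (fun n ↦ Eventually.of_forall fun x ↦ ENNReal.rpow_le_rpow (hbd n x) hp.le) ?_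
    (Eventually.of_forall fun x ↦ ?_)
  · simpa using h1
  · rw [lintegral_const, Measure.restrict_apply_univ]
    exact ENNReal.mul_ne_top (ENNReal.rpow_ne_top_of_nonneg hp.le
      (ENNReal.mul_ne_top hKt hC)) hB
  · have h2 := (ENNReal.continuous_rpow_const (y := p)).continuousAt.tendsto.comp (hpt x).enorm
    rw [enorm_zero, ENNReal.zero_rpow_of_pos hp] at h2
    exact h2

/-- Mollifications of a weakly null sequence of radial functions tend to zero in `Lᵖ`, `p > 2`. -/
theorem tendsto_lintegral_mollify (hd : 2 ≤ d) {p : ℝ} (hp : 2 < p) {w : ℕ → radial d}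
    {C : ℝ≥0∞} (hC : C ≠ ∞) (hw : ∀ n, ‖(w n : H1 d)‖ₑ ≤ C)
    (hweak : ∀ L : radial d →L[ℝ] ℝ, Tendsto (fun n ↦ L (w n)) atTop (𝓝 0)) :
    Tendsto (fun n ↦ ∫⁻ x, ‖mollify φ (toFun (w n : H1 d)) x‖ₑ ^ p) atTop (𝓝 0) := by
  rw [ENNReal.tendsto_nhds_zero]
  intro ε hε
  obtain ⟨δ, hδ0, hδ⟩ := exists_rpow_mul_le (ENNReal.rpow_ne_top_of_nonneg two_pos.le hC)
    (ENNReal.half_pos hε.ne').ne' (by linarith : 0 < p - 2)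
  obtain ⟨ρ, hρ⟩ := exists_radius_enorm_mollify_le φ hd hC hδ0
  have hin := tendsto_setLIntegral_mollify φ (by linarith : 0 < p) hC hw
    (tendsto_mollify_of_weakly_null φ hweak)
    (measure_ball_lt_top (μ := volume) (x := (0 : EuclideanSpace ℝ (Fin d))) (r := ρ)).ne
  filter_upwards [(ENNReal.tendsto_nhds_zero.1 hin) (ε / 2) (ENNReal.half_pos hε.ne')] with n hn
  rw [← lintegral_add_compl _ (Metric.isOpen_ball (x := (0 : EuclideanSpace ℝ (Fin d)))
    (ε := ρ)).measurableSet, ← ENNReal.add_halves ε]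
  exact add_le_add hn
    ((setLIntegral_compl_mollify_le φ hp (hw n) (hρ (w n) (w n).2 (hw n))).trans hδ)

/-- Mollification converges in subcritical `Lᵖ` uniformly on bounded sets of `H¹`. -/
theorem exists_bump_eLpNorm_sub_mollify_le (hd : 3 ≤ d) {p : ℝ} (hp : 2 < p)
    (hp' : p < 2 * d / ((d : ℝ) - 2)) {C ε : ℝ≥0∞} (hC : C ≠ ∞) (hε : ε ≠ 0) :
    ∃ φ : ContDiffBump (0 : EuclideanSpace ℝ (Fin d)), ∀ v : H1 d, ‖v‖ₑ ≤ C →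
      eLpNorm (fun x ↦ toFun v x - mollify φ (toFun v) x) (ENNReal.ofReal p) volume ^ p ≤ ε := by
  obtain ⟨K, hK⟩ := exists_sobolev_const hd
  set q := 2 * d / ((d : ℝ) - 2) with hq
  have hq1 : 1 ≤ ENNReal.ofReal q := by
    rw [← ENNReal.ofReal_one]
    exact ENNReal.ofReal_le_ofReal (by linarith)
  have hgrad : ∀ v : H1 d, ‖v‖ₑ ≤ C → ‖gradL2 d v‖ₑ ≤ C := fun v hv ↦ by
    refine le_trans ?_ hv
    rw [← ofReal_norm, ← ofReal_norm]
    exact ENNReal.ofReal_le_ofReal (norm_gradL2_le v)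
  set A : ℝ≥0∞ := (2 * (K * C)) ^ q with hA
  have hAt : A ≠ ∞ := by
    refine ENNReal.rpow_ne_top_of_nonneg (by linarith) ?_
    finiteness
  -- The threshold is taken large first: since `p < q`, this makes the bounded critical term small.
  obtain ⟨s, hs0, hs⟩ : ∃ s : ℝ, 0 < s ∧ ENNReal.ofReal (s ^ (p - q)) * A ≤ ε / 2 := by
    have h1 : Tendsto (fun s : ℝ ↦ ENNReal.ofReal (s ^ (p - q)) * A) atTop (𝓝 0) := by
      have h2 := ENNReal.Tendsto.mul_const (b := A)
        (ENNReal.tendsto_ofReal (tendsto_rpow_neg_atTop (y := q - p) (by linarith))) (Or.inr hAt)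
      simpa using h2
    have h3 := (ENNReal.tendsto_nhds_zero.1 h1) (ε / 2) (ENNReal.half_pos hε)
    obtain ⟨s, hs, hs0⟩ := (h3.and (eventually_gt_atTop 0)).exists
    exact ⟨s, hs0, hs⟩
  -- With `s` fixed, the bump radius `1/(j+1)` is shrunk until the `L²` error, at most the radius
  -- times `C`, is small.
  obtain ⟨j, hj⟩ : ∃ j : ℕ, ENNReal.ofReal (s ^ (p - 2))
      * (ENNReal.ofReal (1 / ((j : ℝ) + 1)) * C) ^ (2 : ℝ) ≤ ε / 2 := by
    have h1 : Tendsto (fun j : ℕ ↦ ENNReal.ofReal (s ^ (p - 2))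
        * (ENNReal.ofReal (1 / ((j : ℝ) + 1)) * C) ^ (2 : ℝ)) atTop (𝓝 0) := by
      have h2 := ENNReal.Tendsto.mul_const (b := C)
        (ENNReal.tendsto_ofReal (tendsto_one_div_add_atTop_nhds_zero_nat (𝕜 := ℝ))) (Or.inr hC)
      have h3 := (ENNReal.continuous_rpow_const (y := 2)).continuousAt.tendsto.comp h2
      have h4 := ENNReal.Tendsto.const_mul (a := ENNReal.ofReal (s ^ (p - 2))) h3
        (Or.inr ENNReal.ofReal_ne_top)
      simpa using h4
    exact ((ENNReal.tendsto_nhds_zero.1 h1) (ε / 2) (ENNReal.half_pos hε)).exists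
  refine ⟨shrinkingBump d j, fun v hv ↦ ?_⟩
  have hm : StronglyMeasurable
      fun x ↦ toFun v x - mollify (shrinkingBump d j) (toFun v) x :=
    (stronglyMeasurable_toFun v).sub (stronglyMeasurable_mollify _ v)
  refine (eLpNorm_rpow_le_interpolation hm.aestronglyMeasurable hs0 hp hp').trans ?_
  rw [← ENNReal.add_halves ε]
  refine add_le_add (le_trans ?_ hj) (le_trans ?_ hs)
  · gcongr
    refine (eLpNorm_sub_mollify_le v (shrinkingBump d j)).trans ?_
    gcongr
    rfl
  · refine mul_le_mul' le_rfl (ENNReal.rpow_le_rpow ?_ (by linarith))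
    have h0 := eLpNorm_sub_le (stronglyMeasurable_toFun v).aestronglyMeasurable
      (stronglyMeasurable_mollify (shrinkingBump d j) v).aestronglyMeasurable hq1 (μ := volume)
    refine h0.trans ?_
    rw [two_mul]
    have h1 : eLpNorm (toFun v) (ENNReal.ofReal q) volume ≤ K * C :=
      (hK v).trans (mul_le_mul' le_rfl (hgrad v hv))
    exact add_le_add h1 ((eLpNorm_mollify_le _ (stronglyMeasurable_toFun v) hq1
      (by simp)).trans h1)

/-- **Compactness of the radial embedding**: weakly null sequences of radial functions tend to
zero in subcritical `Lᵖ`. -/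
theorem tendsto_eLpNorm_of_weakly_null (hd : 3 ≤ d) {p : ℝ} (hp : 2 < p)
    (hp' : p < 2 * d / ((d : ℝ) - 2)) {w : ℕ → radial d}
    {C : ℝ≥0∞} (hC : C ≠ ∞) (hw : ∀ n, ‖(w n : H1 d)‖ₑ ≤ C)
    (hweak : ∀ L : radial d →L[ℝ] ℝ, Tendsto (fun n ↦ L (w n)) atTop (𝓝 0)) :
    Tendsto (fun n ↦ eLpNorm (toFun (w n : H1 d)) (ENNReal.ofReal p) volume) atTop (𝓝 0) := by
  have hp0 : 0 < p := by linarith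
  have hp1 : 1 ≤ ENNReal.ofReal p := by
    rw [← ENNReal.ofReal_one]
    exact ENNReal.ofReal_le_ofReal (by linarith)
  rw [ENNReal.tendsto_nhds_zero]
  intro ε hε
  have hε2 : (ε / 2) ^ p ≠ 0 := by
    simpa [hp0, hp0.not_gt] using hε.ne'
  -- One bump serves the whole sequence, so it is chosen before `n`.
  obtain ⟨φ, hφ⟩ := exists_bump_eLpNorm_sub_mollify_le hd hp hp' hC hε2
  have h1 := tendsto_lintegral_mollify φ (by omega) hp hC hw hweak
  filter_upwards [(ENNReal.tendsto_nhds_zero.1 h1) _ hε2.bot_lt] with n hn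
  rw [← eLpNorm_rpow_eq_lintegral _ hp0, ENNReal.rpow_le_rpow_iff hp0] at hn
  have h2 := (ENNReal.rpow_le_rpow_iff hp0).1 (hφ (w n) (hw n))
  have h3 : toFun (w n : H1 d) = (fun x ↦ toFun (w n : H1 d) x
      - mollify φ (toFun (w n : H1 d)) x) + mollify φ (toFun (w n : H1 d)) := by
    funext x; simp
  rw [h3, ← ENNReal.add_halves ε]
  exact (eLpNorm_add_le ((stronglyMeasurable_toFun _).sub
    (stronglyMeasurable_mollify φ _)).aestronglyMeasurable
    (stronglyMeasurable_mollify φ _).aestronglyMeasurable hp1).trans (add_le_add h2 hn)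

end H1

end InverseSquareNLS

/-! ### Maximization under a quadratic constraint, and the energy form -/

namespace InverseSquareNLS

open Filter Topology ContinuousLinearMap
open scoped ENNReal NNReal

section Variational

variable {V : Type*} [NormedAddCommGroup V] [InnerProductSpace ℝ V] [CompleteSpace V]
  [TopologicalSpace.SeparableSpace V]

/-- Sequential Banach–Alaoglu, available by separability, carried to the space itself by Riesz
representation. -/
theorem exists_weakly_convergent_subsequence {v : ℕ → V} {C : ℝ} (hv : ∀ n, ‖v n‖ ≤ C) :
    ∃ (w : V) (φ : ℕ → ℕ), StrictMono φ ∧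
      ∀ L : V →L[ℝ] ℝ, Tendsto (fun n ↦ L (v (φ n))) atTop (𝓝 (L w)) := by
  set f : ℕ → WeakDual ℝ V := fun n ↦
    WeakDual.toStrongDual.symm (InnerProductSpace.toDual ℝ V (v n)) with hf
  have hmem : ∀ n, f n ∈ WeakDual.toStrongDual ⁻¹'
      Metric.closedBall (0 : StrongDual ℝ V) C := by
    intro n
    rw [mem_preimage, mem_closedBall_zero_iff]
    change ‖InnerProductSpace.toDual ℝ V (v n)‖ ≤ C
    rw [LinearIsometryEquiv.norm_map]
    exact hv n
  obtain ⟨a, -, φ, hφ, ha⟩ := WeakDual.isSeqCompact_closedBall ℝ V 0 C hmem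
  refine ⟨(InnerProductSpace.toDual ℝ V).symm (WeakDual.toStrongDual a), φ, hφ, fun L ↦ ?_⟩
  set z := (InnerProductSpace.toDual ℝ V).symm L with hz
  have hL : ∀ x, L x = inner ℝ x z := fun x ↦ by
    rw [real_inner_comm, hz, InnerProductSpace.toDual_symm_apply]
  have h1 := ((WeakDual.eval_continuous z).tendsto a).comp ha
  simp only [hL]
  rw [InnerProductSpace.toDual_symm_apply]
  exact h1

/-- A positively homogeneous weakly continuous functional attains its maximum on the unit sphere
of a coercive quadratic form. -/
theorem exists_maximizer {B : V →L[ℝ] V →L[ℝ] ℝ} (hsymm : ∀ v w, B v w = B w v) {δ : ℝ}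
    (hδ : 0 < δ) (hcoer : ∀ v, δ * ‖v‖ ^ 2 ≤ B v v) {P : V → ℝ} {p : ℝ} (hp : 0 < p)
    (hP : ∀ (v : ℕ → V) (w : V) (C : ℝ), (∀ n, ‖v n‖ ≤ C) →
      (∀ L : V →L[ℝ] ℝ, Tendsto (fun n ↦ L (v n)) atTop (𝓝 (L w))) →
      Tendsto (fun n ↦ P (v n)) atTop (𝓝 (P w)))
    (hhom : ∀ (s : ℝ) (v : V), 0 ≤ s → P (s • v) = s ^ p * P v) {u₀ : V} (hu₀ : 0 < P u₀) :
    ∃ u, B u u = 1 ∧ 0 < P u ∧ ∀ v, P v ≤ P u * B v v ^ (p / 2) := by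
  have hpos : ∀ v, v ≠ 0 → 0 < B v v := fun v hv ↦
    (mul_pos hδ (pow_pos (norm_pos_iff.2 hv) 2)).trans_le (hcoer v)
  have hnn : ∀ v, 0 ≤ B v v := fun v ↦ (by positivity : 0 ≤ δ * ‖v‖ ^ 2).trans (hcoer v)
  have hP0 : P 0 = 0 := by
    have := hhom 0 0 le_rfl
    rwa [smul_zero, Real.zero_rpow hp.ne', zero_mul] at this
  -- The ball rather than the sphere: only the ball is weakly sequentially closed.
  set S : Set V := {v | B v v ≤ 1} with hS
  have hcomp : IsSeqCompact (P '' S) := by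
    intro a ha
    choose v hvS hva using ha
    have hbd : ∀ n, ‖v n‖ ≤ Real.sqrt δ⁻¹ := fun n ↦ by
      refine Real.le_sqrt_of_sq_le ?_
      rw [inv_eq_one_div, le_div_iff₀ hδ, mul_comm]
      exact (hcoer (v n)).trans (hvS n)
    obtain ⟨w, φ, hφ, hw⟩ := exists_weakly_convergent_subsequence hbd
    refine ⟨P w, ⟨w, ?_, rfl⟩, φ, hφ, ?_⟩
    -- Weak lower semicontinuity of `B`, obtained by expanding `B(vₙ - w, vₙ - w) ≥ 0`.
    · have h1 : Tendsto (fun n ↦ 2 * B w (v (φ n)) - B w w) atTop (𝓝 (2 * B w w - B w w)) :=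
        ((hw (B w)).const_mul 2).sub_const _
      have h2 : ∀ n, 2 * B w (v (φ n)) - B w w ≤ 1 := fun n ↦ by
        have h3 := hnn (v (φ n) - w)
        simp only [map_sub, _root_.sub_apply, hsymm (v (φ n)) w] at h3
        have h4 : B (v (φ n)) (v (φ n)) ≤ 1 := hvS (φ n)
        linarith
      have := le_of_tendsto' h1 h2
      change B w w ≤ 1
      linarith
    · have h1 := hP (fun n ↦ v (φ n)) w _ (fun n ↦ hbd _) hw
      exact h1.congr fun n ↦ hva _
  have hne : (P '' S).Nonempty := ⟨P 0, 0, by simp [hS], rfl⟩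
  obtain ⟨M, ⟨v, hvS, hvM⟩, hmax⟩ := hcomp.isCompact.exists_isGreatest hne
  have hbound : ∀ w, P w ≤ M * B w w ^ (p / 2) := by
    intro w
    rcases eq_or_ne w 0 with rfl | hw
    · rw [hP0, map_zero, Real.zero_rpow (by positivity), mul_zero]
    have hb := hpos w hw
    set s := Real.sqrt (B w w) with hs
    have hs0 : 0 < s := Real.sqrt_pos.2 hb
    have hs2 : s * s = B w w := Real.mul_self_sqrt hb.le
    have h1 : s⁻¹ • w ∈ S := by
      have h0 : B (s⁻¹ • w) (s⁻¹ • w) = 1 := by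
        simp only [map_smul, _root_.smul_apply, smul_eq_mul]
        rw [← hs2]
        field_simp
      exact h0.le
    have h2 : P (s⁻¹ • w) ≤ M := hmax ⟨_, h1, rfl⟩
    have h3 : P w = s ^ p * P (s⁻¹ • w) := by
      rw [← hhom _ _ hs0.le, smul_inv_smul₀ hs0.ne']
    have h4 : B w w ^ (p / 2) = s ^ p := by
      rw [hs, Real.sqrt_eq_rpow, ← Real.rpow_mul hb.le]
      congr 1
      ring
    rw [h3, h4, mul_comm]
    gcongr
  have hM : 0 < M := by
    by_contra h
    have h1 := hbound u₀
    have h2 : M * B u₀ u₀ ^ (p / 2) ≤ 0 :=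
      mul_nonpos_of_nonpos_of_nonneg (not_lt.1 h) (Real.rpow_nonneg (hnn _) _)
    linarith
  have hv0 : v ≠ 0 := by
    rintro rfl
    rw [hP0] at hvM
    exact hM.ne hvM
  have hb := hpos v hv0
  set s := Real.sqrt (B v v) with hs
  have hs0 : 0 < s := Real.sqrt_pos.2 hb
  have hs2 : s * s = B v v := Real.mul_self_sqrt hb.le
  have hu1 : B (s⁻¹ • v) (s⁻¹ • v) = 1 := by
    simp only [map_smul, _root_.smul_apply, smul_eq_mul]
    rw [← hs2]
    field_simp
  -- Rescaling to the sphere multiplies `P` by `s⁻ᵖ ≥ 1`, so the maximizer on the ball yields one on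
  -- the sphere.
  have hs1 : s ≤ 1 := Real.sqrt_le_one.2 hvS
  have huM : P (s⁻¹ • v) = M := by
    refine le_antisymm (hmax ⟨_, hu1.le, rfl⟩) ?_
    rw [hhom _ _ (inv_nonneg.2 hs0.le), hvM]
    exact le_mul_of_one_le_left hM.le
      (Real.one_le_rpow (one_le_inv_iff₀.2 ⟨hs0, hs1⟩) hp.le)
  exact ⟨s⁻¹ • v, hu1, by rwa [huM], fun w ↦ by rw [huM]; exact hbound w⟩

end Variational

theorem norm_sq_Lp_two {X F : Type*} [MeasurableSpace X] {μ : Measure X} [NormedAddCommGroup F]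
    (f : Lp F 2 μ) : ‖f‖ ^ 2 = ∫ x, ‖f x‖ ^ 2 ∂μ := by
  rw [Lp.norm_def, MemLp.eLpNorm_two_eq_sqrt_integral (Lp.memLp f),
    ENNReal.toReal_ofReal (Real.sqrt_nonneg _), Real.sq_sqrt]
  exact integral_nonneg fun x ↦ by positivity

section Energy

variable {d : ℕ}

theorem integral_norm_sq_toFun (v : H1 d) :
    ∫ x, ‖H1.toFun v x‖ ^ 2 = ‖H1.toL2 d v‖ ^ 2 :=
  (norm_sq_Lp_two (H1.toL2 d v)).symm

theorem integral_norm_sq_grad (v : H1 d) :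
    ∫ x, ‖H1.grad v x‖ ^ 2 = ‖H1.gradL2 d v‖ ^ 2 :=
  (norm_sq_Lp_two (H1.gradL2 d v)).symm

/-- Hardy's inequality leaves the fraction `1 - cκ²` of the gradient term when `c ≥ 0`; when `c ≤ 0`
the potential only helps. This is why the minimum with `1` appears. -/
theorem exists_coercive_form {V F G K : Type*} [NormedAddCommGroup V] [NormedSpace ℝ V]
    [NormedAddCommGroup F] [InnerProductSpace ℝ F] [NormedAddCommGroup G] [InnerProductSpace ℝ G]
    [NormedAddCommGroup K] [InnerProductSpace ℝ K] (A : V →L[ℝ] F) (W : V →L[ℝ] G) (T : V →L[ℝ] K)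
    {c ω κ : ℝ} (hω : 0 < ω) (hκc : c * κ ^ 2 < 1)
    (hWn : ∀ v, ‖W v‖ ≤ κ * ‖A v‖) (hn : ∀ v, ‖v‖ ^ 2 = ‖T v‖ ^ 2 + ‖A v‖ ^ 2) :
    ∃ B : V →L[ℝ] V →L[ℝ] ℝ, (∀ v, B v v = ‖A v‖ ^ 2 - c * ‖W v‖ ^ 2 + ω * ‖T v‖ ^ 2) ∧
      (∀ v w, B v w = B w v) ∧ ∃ δ, 0 < δ ∧ ∀ v, δ * ‖v‖ ^ 2 ≤ B v v := by
  obtain ⟨B, hBv⟩ : ∃ B : V →L[ℝ] V →L[ℝ] ℝ, ∀ v w, B v w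
      = inner ℝ (A v) (A w) - c * inner ℝ (W v) (W w) + ω * inner ℝ (T v) (T w) :=
    ⟨(innerSL ℝ).bilinearComp A A - c • (innerSL ℝ).bilinearComp W W
      + ω • (innerSL ℝ).bilinearComp T T, fun _ _ ↦ rfl⟩
  refine ⟨B, fun v ↦ ?_, fun v w ↦ ?_, min (min 1 (1 - c * κ ^ 2)) ω, by simp [hω, hκc],
    fun v ↦ ?_⟩
  · rw [hBv, real_inner_self_eq_norm_sq, real_inner_self_eq_norm_sq, real_inner_self_eq_norm_sq]
  · rw [hBv, hBv, real_inner_comm, real_inner_comm (W w), real_inner_comm (T w)]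
  · rw [hBv, real_inner_self_eq_norm_sq, real_inner_self_eq_norm_sq, real_inner_self_eq_norm_sq,
      hn, mul_add]
    have hWsq : ‖W v‖ ^ 2 ≤ κ ^ 2 * ‖A v‖ ^ 2 := by
      rw [← mul_pow]
      gcongr
      exact hWn v
    have hg : min 1 (1 - c * κ ^ 2) * ‖A v‖ ^ 2 ≤ ‖A v‖ ^ 2 - c * ‖W v‖ ^ 2 := by
      rcases le_total c 0 with h | h
      · have h1 : min 1 (1 - c * κ ^ 2) * ‖A v‖ ^ 2 ≤ 1 * ‖A v‖ ^ 2 := by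
          gcongr
          exact min_le_left _ _
        have h2 : c * ‖W v‖ ^ 2 ≤ 0 := mul_nonpos_of_nonpos_of_nonneg h (by positivity)
        linarith
      · have h1 : min 1 (1 - c * κ ^ 2) * ‖A v‖ ^ 2 ≤ (1 - c * κ ^ 2) * ‖A v‖ ^ 2 := by
          gcongr
          exact min_le_right _ _
        have h2 := mul_le_mul_of_nonneg_left hWsq h
        linarith
    have h1 : min (min 1 (1 - c * κ ^ 2)) ω * ‖A v‖ ^ 2 ≤ min 1 (1 - c * κ ^ 2) * ‖A v‖ ^ 2 :=
      mul_le_mul_of_nonneg_right (min_le_left _ _) (by positivity)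
    have h2 : min (min 1 (1 - c * κ ^ 2)) ω * ‖T v‖ ^ 2 ≤ ω * ‖T v‖ ^ 2 := by
      gcongr
      exact min_le_right _ _
    linarith

/-- The quadratic part of the action is given by a bounded coercive symmetric form. -/
theorem exists_energyForm (hd : 3 ≤ d) {c ω : ℝ} (hc : c < (((d : ℝ) - 2) / 2) ^ 2)
    (hω : 0 < ω) : ∃ B : H1 d →L[ℝ] H1 d →L[ℝ] ℝ,
      (∀ v, B v v = hardy c v + ω * ∫ x, ‖H1.toFun v x‖ ^ 2) ∧
      (∀ v w, B v w = B w v) ∧ ∃ δ, 0 < δ ∧ ∀ v, δ * ‖v‖ ^ 2 ≤ B v v := by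
  have hd3 : (3 : ℝ) ≤ d := by exact_mod_cast hd
  have hd' : (0 : ℝ) < (d : ℝ) - 2 := by linarith
  have hκc : c * (2 / ((d : ℝ) - 2)) ^ 2 < 1 := by
    have h1 : (((d : ℝ) - 2) / 2) ^ 2 * (2 / ((d : ℝ) - 2)) ^ 2 = 1 := by field_simp
    rw [← h1]
    gcongr
  obtain ⟨W, hW, hWn⟩ := H1.exists_hardyMap hd
  have hdiag : ∀ v, ‖H1.gradL2 d v‖ ^ 2 - c * ‖W v‖ ^ 2 + ω * ‖H1.toL2 d v‖ ^ 2
      = hardy c v + ω * ∫ x, ‖H1.toFun v x‖ ^ 2 := by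
    intro v
    have hWv : ‖W v‖ ^ 2 = ∫ x, ‖(‖x‖⁻¹ : ℝ) • H1.toFun v x‖ ^ 2 := by
      rw [norm_sq_Lp_two]
      refine integral_congr_ae ?_
      filter_upwards [hW v] with x hx
      rw [hx]
    rw [hardy, integral_norm_sq_toFun, integral_norm_sq_grad, hWv]
  have h := exists_coercive_form (H1.gradL2 d) W (H1.toL2 d) hω hκc hWn H1.norm_sq_eq
  exact h.elim fun B hB ↦ ⟨B, fun v ↦ (hB.1 v).trans (hdiag v), hB.2⟩

theorem isWeakGradient_complexGradient {u : EuclideanSpace ℝ (Fin d) → ℂ} (hu : ContDiff ℝ 1 u) :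
    IsWeakGradient u (complexGradient u) := by
  intro φ hφ hs i
  have hcu : Continuous fun x ↦ fderiv ℝ u x (EuclideanSpace.single i 1) :=
    (hu.continuous_fderiv one_ne_zero).clm_apply continuous_const
  have hi1 : Integrable fun x ↦ fderiv ℝ φ x (EuclideanSpace.single i 1) • u x :=
    ((continuous_partial hφ i).smul hu.continuous).integrable_of_hasCompactSupport
      (HasCompactSupport.smul_right (hasCompactSupport_partial hs i))
  have hi2 : Integrable fun x ↦ φ x • fderiv ℝ u x (EuclideanSpace.single i 1) :=
    (hφ.continuous.smul hcu).integrable_of_hasCompactSupport hs.smul_right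
  have hi3 : Integrable fun x ↦ φ x • u x :=
    (hφ.continuous.smul hu.continuous).integrable_of_hasCompactSupport hs.smul_right
  have h := integral_smul_fderiv_eq_neg_fderiv_smul_of_integrable hi1 hi2 hi3
    (fun x _ ↦ hφ.differentiable (by simp) x) (fun x _ ↦ hu.differentiable one_ne_zero x)
  change _ = -∫ x, φ x • fderiv ℝ u x (EuclideanSpace.single i 1)
  rw [h, neg_neg]

/-- Supplies a radial function with positive potential energy, so that the maximization is not
vacuous. The witness depends on `‖x‖²`, not `‖x‖`, to be smooth at the origin. -/
theorem exists_radial_not_ae_zero (d : ℕ) :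
    ∃ v ∈ H1.radial d, ¬ H1.toFun v =ᵐ[volume] 0 := by
  set u : EuclideanSpace ℝ (Fin d) → ℂ := fun x ↦ (Real.smoothTransition (1 - ‖x‖ ^ 2) : ℝ) with hu
  have hus : ContDiff ℝ 1 u := Complex.ofRealCLM.contDiff.comp
    (Real.smoothTransition.contDiff.comp (contDiff_const.sub (contDiff_norm_sq ℝ)))
  have huc : HasCompactSupport u := by
    refine HasCompactSupport.of_support_subset_isCompact
      (isCompact_closedBall (0 : EuclideanSpace ℝ (Fin d)) 1) fun x hx ↦ ?_
    by_contra h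
    refine hx ?_
    rw [mem_closedBall_zero_iff, not_le] at h
    simp only [hu]
    rw [Real.smoothTransition.zero_of_nonpos (by nlinarith), Complex.ofReal_zero]
  have hmem : MemLp u 2 volume := hus.continuous.memLp_of_hasCompactSupport huc
  have hmk := H1.toFun_mk hmem (memLp_complexGradient hus huc 2)
    (isWeakGradient_complexGradient hus)
  refine ⟨H1.mk hmem (memLp_complexGradient hus huc 2) (isWeakGradient_complexGradient hus),
    H1.mem_radial_iff.2 fun R ↦ ?_, fun h ↦ ?_⟩
  · filter_upwards [hmk, H1.ae_comp R hmk] with x h1 h2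
    rw [h1, h2]
    simp [hu]
  · have h1 : u =ᵐ[volume] 0 := hmk.symm.trans h
    have h2 : u = 0 := (Continuous.ae_eq_iff_eq volume hus.continuous continuous_const).1 h1
    have h3 := congrFun h2 0
    simp [hu] at h3

end Energy

end InverseSquareNLS

/-! ### Minimization on an abstract Nehari manifold -/

namespace InverseSquareNLS

open Filter Topology ContinuousLinearMap
open scoped ENNReal NNReal

section Nehari

variable {E : Type*} [NormedAddCommGroup E] [InnerProductSpace ℝ E]

theorem hasFDerivAt_bilinear_diag {B : E →L[ℝ] E →L[ℝ] ℝ} (hsymm : ∀ v w, B v w = B w v) (v : E) :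
    HasFDerivAt (fun w ↦ B w w) ((2 : ℝ) • B v) v := by
  have h := B.hasFDerivAt.clm_apply (hasFDerivAt_id (𝕜 := ℝ) v)
  refine h.congr_fderiv ?_
  ext w
  simp [hsymm w v, two_mul]

/-- Homogeneity of degrees `2` and `p` cancels the factors `1/2` and `1/p`. Nonnegative scalars
suffice because only `s` near `1` matters. -/
theorem hasDerivAt_dilation {B : E →L[ℝ] E →L[ℝ] ℝ} {N : E → ℝ} {p : ℝ} (hp : 0 < p)
    (hhom : ∀ (s : ℝ) (v : E), 0 ≤ s → N (s • v) = s ^ p * N v) (v : E) :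
    HasDerivAt (fun s : ℝ ↦ 1 / 2 * B (s • v) (s • v) - 1 / p * N (s • v)) (B v v - N v) 1 := by
  have h1 : HasDerivAt (fun s : ℝ ↦ s ^ 2 * (1 / 2 * B v v) - s ^ p * (1 / p * N v))
      (((2 : ℕ) * (1 : ℝ) ^ (2 - 1)) * (1 / 2 * B v v) - (p * 1 ^ (p - 1)) * (1 / p * N v)) 1 :=
    ((hasDerivAt_pow 2 (1 : ℝ)).mul_const _).sub
      ((Real.hasDerivAt_rpow_const (Or.inl one_ne_zero)).mul_const _)
  have h2 : B v v - N v
      = ((2 : ℕ) * (1 : ℝ) ^ (2 - 1)) * (1 / 2 * B v v) - (p * 1 ^ (p - 1)) * (1 / p * N v) := by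
    rw [Real.one_rpow]
    field_simp
    simp only [Nat.cast_ofNat]
    ring
  rw [h2]
  refine h1.congr_of_eventuallyEq ?_
  filter_upwards [eventually_gt_nhds (zero_lt_one (α := ℝ))] with s hs
  rw [hhom s v hs.le]
  simp only [map_smul, _root_.smul_apply, smul_eq_mul]
  ring

/-- At a critical point the derivative along dilations vanishes. -/
theorem sub_eq_zero_of_hasFDerivAt_zero {B : E →L[ℝ] E →L[ℝ] ℝ} {N : E → ℝ} {p : ℝ} (hp : 0 < p)
    (hhom : ∀ (s : ℝ) (v : E), 0 ≤ s → N (s • v) = s ^ p * N v) {v : E}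
    (h : HasFDerivAt (fun w ↦ 1 / 2 * B w w - 1 / p * N w) (0 : E →L[ℝ] ℝ) v) :
    B v v - N v = 0 := by
  have h1 : HasDerivAt (fun s : ℝ ↦ s • v) ((1 : ℝ) • v) 1 := (hasDerivAt_id (1 : ℝ)).smul_const v
  have h2 : HasFDerivAt (fun w ↦ 1 / 2 * B w w - 1 / p * N w) (0 : E →L[ℝ] ℝ) ((1 : ℝ) • v) := by
    rwa [one_smul]
  have h3 := h2.comp_hasDerivAt (1 : ℝ) h1
  rw [zero_apply] at h3
  exact (hasDerivAt_dilation hp hhom v).unique h3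

/-- The action attains its minimum on the Nehari manifold of a closed subspace, and the minimizers
are critical points along this subspace. -/
theorem exists_isLeast_nehari {B : E →L[ℝ] E →L[ℝ] ℝ} (hsymm : ∀ v w, B v w = B w v) {δ : ℝ}
    (hδ : 0 < δ) (hcoer : ∀ v, δ * ‖v‖ ^ 2 ≤ B v v) {N : E → ℝ} {p : ℝ} (hp : 2 < p)
    (V : Submodule ℝ E) [CompleteSpace V] [TopologicalSpace.SeparableSpace V]
    (hN : ∀ (v : ℕ → V) (w : V) (C : ℝ), (∀ n, ‖v n‖ ≤ C) →
      (∀ L : V →L[ℝ] ℝ, Tendsto (fun n ↦ L (v n)) atTop (𝓝 (L w))) →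
      Tendsto (fun n ↦ N (v n)) atTop (𝓝 (N w)))
    (hhom : ∀ (s : ℝ) (v : E), 0 ≤ s → N (s • v) = s ^ p * N v) {u₀ : E} (hu₀V : u₀ ∈ V)
    (hu₀ : 0 < N u₀) :
    ∃ m : ℝ, IsLeast ((fun v ↦ 1 / 2 * B v v - 1 / p * N v) ''
        {v | v ∈ V ∧ v ≠ 0 ∧ B v v - N v = 0}) m ∧
      ∀ v ∈ V, v ≠ 0 → B v v - N v = 0 → 1 / 2 * B v v - 1 / p * N v = m →
        ∀ D : E →L[ℝ] ℝ, HasFDerivAt N D v → ∀ h ∈ V, D h = p * B v h := by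
  have hp0 : 0 < p := by linarith
  have hp2 : 0 < p - 2 := by linarith
  have hpos : ∀ v, v ≠ 0 → 0 < B v v := fun v hv ↦
    (mul_pos hδ (pow_pos (norm_pos_iff.2 hv) 2)).trans_le (hcoer v)
  obtain ⟨u, hu1, huN, hmax⟩ := exists_maximizer (V := V)
    (B := B.bilinearComp V.subtypeL V.subtypeL) (P := fun v ↦ N v) (p := p)
    (fun v w ↦ hsymm v w) hδ (fun v ↦ hcoer v) hp0 hN (fun s v hs ↦ hhom s v hs)
    (u₀ := ⟨u₀, hu₀V⟩) hu₀
  set M := N u with hM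
  replace hu1 : B (u : E) u = 1 := hu1
  replace hmax : ∀ v ∈ V, N v ≤ M * B v v ^ (p / 2) := fun v hv ↦ hmax ⟨v, hv⟩
  -- The positive solution of `M q^(p/2) = q`, the value of `B` at which a maximizing direction
  -- meets the Nehari manifold.
  set q := M ^ (-(2 / (p - 2))) with hq
  have hq0 : 0 < q := Real.rpow_pos_of_pos huN _
  have hMq : M * q ^ (p / 2 - 1) = 1 := by
    rw [hq, ← Real.rpow_mul huN.le]
    have : -(2 / (p - 2)) * (p / 2 - 1) = -1 := by field_simp
    rw [this, Real.rpow_neg_one, mul_inv_cancel₀ huN.ne']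
  have hsplit : ∀ b : ℝ, 0 < b → b ^ (p / 2) = b ^ (p / 2 - 1) * b := fun b hb ↦ by
    rw [← Real.rpow_add_one hb.ne', sub_add_cancel]
  have hMq' : M * q ^ (p / 2) = q := by rw [hsplit q hq0, ← mul_assoc, hMq, one_mul]
  -- If `B < q`, then `N ≤ M B^(p/2) < B`, which contradicts `N = B`.
  have hlow : ∀ v ∈ V, v ≠ 0 → B v v - N v = 0 → q ≤ B v v := by
    intro v hv hv0 hK
    by_contra! hlt
    have hb := hpos v hv0
    have h1 : M * B v v ^ (p / 2 - 1) < 1 :=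
      (mul_lt_mul_of_pos_left (Real.rpow_lt_rpow hb.le hlt (by linarith)) huN).trans_eq hMq
    have h2 := hmax v hv
    rw [hsplit _ hb, ← mul_assoc] at h2
    have h3 := mul_lt_mul_of_pos_right h1 hb
    linarith
  have hfac : 0 < 1 / 2 - 1 / p := by
    rw [sub_pos]
    exact one_div_lt_one_div_of_lt two_pos hp
  -- The minimizer is the normalized maximizer `u` dilated by `√q`, where both `B` and `N` take the
  -- value `q`.
  refine ⟨(1 / 2 - 1 / p) * q, ⟨⟨Real.sqrt q • (u : E), ⟨V.smul_mem _ u.2, ?_, ?_⟩, ?_⟩, ?_⟩, ?_⟩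
  · refine smul_ne_zero (Real.sqrt_pos.2 hq0).ne' fun h ↦ ?_
    rw [h] at hu1
    simp at hu1
  all_goals
    have hBu : B (Real.sqrt q • (u : E)) (Real.sqrt q • (u : E)) = q := by
      simp only [map_smul, _root_.smul_apply, smul_eq_mul, hu1, mul_one]
      exact Real.mul_self_sqrt hq0.le
    have hNu : N (Real.sqrt q • (u : E)) = q := by
      rw [hhom _ _ (Real.sqrt_nonneg _), Real.sqrt_eq_rpow, ← Real.rpow_mul hq0.le, mul_comm]
      convert hMq' using 3
      ring
  · rw [hBu, hNu, sub_self]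
  · simp only [hBu, hNu]
    ring
  · rintro _ ⟨v, ⟨hv, hv0, hK⟩, rfl⟩
    have h1 := mul_le_mul_of_nonneg_left (hlow v hv hv0 hK) hfac.le
    have h2 : N v = B v v := by linarith
    simp only [h2]
    linarith
  · intro v hv hv0 hK hS D hD h hh
    have hNv : N v = B v v := by linarith
    have hBv : B v v = q := by
      rw [hNv] at hS
      exact mul_left_cancel₀ hfac.ne' (by linarith)
    -- This function is nonnegative on `V` and vanishes at `v`, because `B = N = q` there. Its
    -- derivative along `V` is therefore zero, and `M q^(p/2-1) = 1` removes the constant.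
    have h1 : HasFDerivAt (fun w ↦ M * B w w ^ (p / 2) - N w)
        (M • ((p / 2 * B v v ^ (p / 2 - 1)) • (2 : ℝ) • B v) - D) v :=
      (((hasFDerivAt_bilinear_diag hsymm v).rpow_const (Or.inl (hpos v hv0).ne')).const_mul M).sub
        hD
    have h2 : HasDerivAt (fun t : ℝ ↦ v + t • h) ((1 : ℝ) • h) 0 :=
      ((hasDerivAt_id (0 : ℝ)).smul_const h).const_add v
    rw [show v = v + (0 : ℝ) • h by simp] at h1
    have h3 := h1.comp_hasDerivAt (0 : ℝ) h2
    have h4 : IsLocalMin ((fun w ↦ M * B w w ^ (p / 2) - N w) ∘ fun t : ℝ ↦ v + t • h) 0 := by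
      refine Eventually.of_forall fun t ↦ ?_
      have h5 := hmax (v + t • h) (V.add_mem hv (V.smul_mem t hh))
      simp only [Function.comp_apply, zero_smul, add_zero, hNv, hBv, hMq', sub_self]
      linarith
    have h5 := h4.hasDerivAt_eq_zero h3
    simp only [zero_smul, add_zero, one_smul, hBv, _root_.sub_apply, _root_.smul_apply,
      smul_eq_mul] at h5
    linear_combination -h5 + p * B v h * hMq

end Nehari

end InverseSquareNLS

/-! ### Radial ground states -/

namespace InverseSquareNLS

open Filter Topology ContinuousLinearMap
open scoped ENNReal NNReal

namespace H1

variable {d : ℕ}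

/-- Required for extracting weakly convergent subsequences; it is inherited from the second
countable `L²` spaces. -/
instance : TopologicalSpace.SeparableSpace (radial d) := by
  have h0 : Fact ((2 : ℝ≥0∞) ≠ ∞) := ⟨ENNReal.ofNat_ne_top⟩
  have h1 : SecondCountableTopology
      (Lp ℂ 2 (volume : Measure (EuclideanSpace ℝ (Fin d)))) := inferInstance
  have h2 : SecondCountableTopology
      (Lp (EuclideanSpace ℂ (Fin d)) 2 (volume : Measure (EuclideanSpace ℝ (Fin d)))) :=
    inferInstance
  have h3 : SecondCountableTopology (L2Pair d) := inferInstance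
  infer_instance

/-- The dependence of `g` on `‖x‖` covers the Hardy weight together with the unweighted integrals.
-/
theorem integral_comp_isometry
    (R : EuclideanSpace ℝ (Fin d) ≃ₗᵢ[ℝ] EuclideanSpace ℝ (Fin d)) (v : H1 d) (g : ℝ → ℂ → ℝ) :
    ∫ x, g ‖x‖ (toFun (comp R v) x) = ∫ x, g ‖x‖ (toFun v x) := by
  have h1 : ∫ x, g ‖x‖ (toFun (comp R v) x) = ∫ x, g ‖R x‖ (toFun v (R x)) := by
    refine integral_congr_ae ?_
    filter_upwards [toFun_comp R v] with x hx
    rw [hx, R.norm_map]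
  rw [h1]
  exact R.measurePreserving.integral_comp R.toHomeomorph.measurableEmbedding
    fun x ↦ g ‖x‖ (toFun v x)

end H1

theorem action_comp {d : ℕ} (c α ω : ℝ)
    (R : EuclideanSpace ℝ (Fin d) ≃ₗᵢ[ℝ] EuclideanSpace ℝ (Fin d)) (v : H1 d) :
    action c α ω (H1.comp R v) = action c α ω v := by
  rw [action, action, hardy, hardy, integral_norm_sq_grad, integral_norm_sq_grad,
    H1.norm_gradL2_comp, H1.integral_comp_isometry R v fun r z ↦ ‖(r⁻¹ : ℝ) • z‖ ^ 2,
    H1.integral_comp_isometry R v fun _ z ↦ ‖z‖ ^ 2,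
    H1.integral_comp_isometry R v fun _ z ↦ ‖z‖ ^ (α + 2)]

/-- The differences `v n - w` are bounded and weakly null, so compactness of the radial embedding
makes the convergence in `Lᵖ` strong. -/
theorem H1.tendsto_norm_of_tendsto_weakly {d : ℕ} (hd : 3 ≤ d) {p : ℝ}
    [Fact (1 ≤ ENNReal.ofReal p)] (hp : 2 < p) (hp' : p < 2 * d / ((d : ℝ) - 2))
    {I : H1 d →L[ℝ] Lp ℂ (ENNReal.ofReal p) (volume : Measure (EuclideanSpace ℝ (Fin d)))}
    (hI : ∀ v, I v =ᵐ[volume] H1.toFun v) {v : ℕ → H1.radial d} {w : H1.radial d} {C : ℝ}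
    (hv : ∀ n, ‖v n‖ ≤ C)
    (hweak : ∀ L : H1.radial d →L[ℝ] ℝ, Tendsto (fun n ↦ L (v n)) atTop (𝓝 (L w))) :
    Tendsto (fun n ↦ ‖I (v n)‖) atTop (𝓝 ‖I w‖) := by
  have h1 : Tendsto (fun n ↦ eLpNorm (H1.toFun ((v n - w : H1.radial d) : H1 d))
      (ENNReal.ofReal p) volume) atTop (𝓝 0) := by
    refine H1.tendsto_eLpNorm_of_weakly_null hd hp hp' (C := (C + ‖w‖).toNNReal)
      ENNReal.coe_ne_top (fun n ↦ ?_) fun L ↦ ?_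
    · rw [← ofReal_norm]
      exact ENNReal.ofReal_le_ofReal ((norm_sub_le _ _).trans (add_le_add (hv n) le_rfl))
    · simpa using (hweak L).sub_const (L w)
  have h2 : ∀ n, ‖I (v n - w)‖ = (eLpNorm (H1.toFun ((v n - w : H1.radial d) : H1 d))
      (ENNReal.ofReal p) volume).toReal := fun n ↦ by
    rw [Lp.norm_def]
    exact congrArg ENNReal.toReal (eLpNorm_congr_ae (hI _))
  have h3 : Tendsto (fun n ↦ ‖I (v n - w)‖) atTop (𝓝 0) := by
    simp only [h2]
    exact (ENNReal.tendsto_toReal ENNReal.zero_ne_top).comp h1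
  have h4 : Tendsto (fun n ↦ I (v n)) atTop (𝓝 (I w)) := by
    rw [tendsto_iff_norm_sub_tendsto_zero]
    simpa only [map_sub] using h3
  exact h4.norm

section Potential

variable {d : ℕ} {p : ℝ}

/-- The potential energy `∫ |v|ᵖ`. -/
noncomputable def potential (p : ℝ) (v : H1 d) : ℝ := ∫ x, ‖H1.toFun v x‖ ^ p

theorem fact_one_le_ofReal (hp : 2 < p) : Fact (1 ≤ ENNReal.ofReal p) :=
  ⟨by rw [← ENNReal.ofReal_one]; exact ENNReal.ofReal_le_ofReal (by linarith)⟩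

theorem integrable_norm_rpow_toFun (hd : 3 ≤ d) (hp : 2 < p) (hp' : p < 2 * d / ((d : ℝ) - 2))
    (v : H1 d) : Integrable (fun x ↦ ‖H1.toFun v x‖ ^ p) := by
  have := fact_one_le_ofReal hp
  obtain ⟨I, hI⟩ := H1.exists_sobolevMap hd hp hp'
  refine (integrable_norm_rpow_Lp (by linarith) (I v)).congr ?_
  filter_upwards [hI v] with x hx
  rw [hx]

theorem potential_eq_norm_rpow [Fact (1 ≤ ENNReal.ofReal p)] (hp : 0 < p)
    {I : H1 d →L[ℝ] Lp ℂ (ENNReal.ofReal p) (volume : Measure (EuclideanSpace ℝ (Fin d)))}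
    (hI : ∀ v, I v =ᵐ[volume] H1.toFun v) (v : H1 d) : potential p v = ‖I v‖ ^ p := by
  rw [← integral_norm_rpow_Lp hp]
  refine integral_congr_ae ?_
  filter_upwards [hI v] with x hx
  rw [hx]

theorem potential_smul {s : ℝ} (hs : 0 ≤ s) (v : H1 d) :
    potential p (s • v) = s ^ p * potential p v := by
  rw [potential, potential, ← integral_const_mul]
  refine integral_congr_ae ?_
  filter_upwards [H1.toFun_smul s v] with x hx
  rw [hx, Pi.smul_apply, norm_smul, Real.norm_of_nonneg hs, Real.mul_rpow hs (norm_nonneg _)]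

theorem exists_hasFDerivAt_potential (hd : 3 ≤ d) (hp : 2 < p)
    (hp' : p < 2 * d / ((d : ℝ) - 2)) (v : H1 d) :
    ∃ D : H1 d →L[ℝ] ℝ, HasFDerivAt (potential p) D v := by
  have := fact_one_le_ofReal hp
  obtain ⟨I, hI⟩ := H1.exists_sobolevMap hd hp hp'
  obtain ⟨D, hD⟩ := exists_hasFDerivAt_norm_rpow_Lp hp (I v)
  rw [funext (potential_eq_norm_rpow (by linarith) hI)]
  exact ⟨_, hD.comp v I.hasFDerivAt⟩

theorem tendsto_potential (hd : 3 ≤ d) (hp : 2 < p) (hp' : p < 2 * d / ((d : ℝ) - 2))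
    {v : ℕ → H1.radial d} {w : H1.radial d} {C : ℝ} (hv : ∀ n, ‖v n‖ ≤ C)
    (hweak : ∀ L : H1.radial d →L[ℝ] ℝ, Tendsto (fun n ↦ L (v n)) atTop (𝓝 (L w))) :
    Tendsto (fun n ↦ potential p (v n : H1 d)) atTop (𝓝 (potential p (w : H1 d))) := by
  have := fact_one_le_ofReal hp
  have hp0 : 0 < p := by linarith
  obtain ⟨I, hI⟩ := H1.exists_sobolevMap hd hp hp'
  simp only [potential_eq_norm_rpow hp0 hI]
  exact (H1.tendsto_norm_of_tendsto_weakly hd hp hp' hI hv hweak).rpow_const (Or.inr hp0.le)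

theorem potential_pos (hd : 3 ≤ d) (hp : 2 < p) (hp' : p < 2 * d / ((d : ℝ) - 2)) {v : H1 d}
    (hv : ¬ H1.toFun v =ᵐ[volume] 0) : 0 < potential p v := by
  have := fact_one_le_ofReal hp
  obtain ⟨I, hI⟩ := H1.exists_sobolevMap hd hp hp'
  rw [potential_eq_norm_rpow (by linarith) hI]
  refine Real.rpow_pos_of_pos (norm_pos_iff.2 fun h ↦ hv ?_) _
  have h1 := hI v
  rw [h] at h1
  exact h1.symm.trans (Lp.coeFn_zero _ _ _)

end Potential

section GroundStates

variable {d : ℕ} {c α ω : ℝ} {B : H1 d →L[ℝ] H1 d →L[ℝ] ℝ}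

theorem action_eq (hB : ∀ v, B v v = hardy c v + ω * ∫ x, ‖H1.toFun v x‖ ^ 2) :
    action c α ω = fun v ↦ 1 / 2 * B v v - 1 / (α + 2) * potential (α + 2) v := by
  funext v
  rw [action, potential, hB]
  ring

theorem nehari_eq (hB : ∀ v, B v v = hardy c v + ω * ∫ x, ‖H1.toFun v x‖ ^ 2) (v : H1 d) :
    nehari c α ω v = B v v - potential (α + 2) v := by
  rw [nehari, potential, hB]

theorem hasDerivAt_action_smul (hα : 0 < α + 2)
    (hB : ∀ v, B v v = hardy c v + ω * ∫ x, ‖H1.toFun v x‖ ^ 2) (v : H1 d) :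
    HasDerivAt (fun s : ℝ ↦ action c α ω (s • v)) (nehari c α ω v) 1 := by
  rw [action_eq hB, nehari_eq hB]
  exact hasDerivAt_dilation hα (fun s v hs ↦ potential_smul hs v) v

theorem radialSolutions_subset_radialNehari (hα : 0 < α + 2)
    (hB : ∀ v, B v v = hardy c v + ω * ∫ x, ‖H1.toFun v x‖ ^ 2) :
    radialSolutions d c α ω ⊆ radialNehari d c α ω := by
  rintro v ⟨hv, hv0, hv'⟩
  refine ⟨hv, hv0, ?_⟩
  rw [action_eq hB] at hv'
  rw [nehari_eq hB]
  exact sub_eq_zero_of_hasFDerivAt_zero hα (fun s v hs ↦ potential_smul hs v) hv'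

/-- The derivative of the action at `v` is `B v - D/(α+2)`, which vanishes on radial directions;
rotation invariance of the action then makes it vanish everywhere. -/
theorem mem_radialSolutions_of_forall_radial (hα : 0 < α + 2)
    (hsymm : ∀ v w, B v w = B w v)
    (hB : ∀ v, B v v = hardy c v + ω * ∫ x, ‖H1.toFun v x‖ ^ 2) {v : H1 d}
    (hv : v ∈ H1rad d) (hv0 : v ≠ 0) {D : H1 d →L[ℝ] ℝ}
    (hD : HasFDerivAt (potential (α + 2)) D v)
    (h : ∀ w ∈ H1.radial d, D w = (α + 2) * B v w) : v ∈ radialSolutions d c α ω := by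
  have h2 : HasFDerivAt (action c α ω)
      ((1 / 2 : ℝ) • (2 : ℝ) • B v - (1 / (α + 2) : ℝ) • D) v := by
    rw [action_eq hB]
    exact ((hasFDerivAt_bilinear_diag hsymm v).const_mul _).sub (hD.const_mul _)
  refine ⟨hv, hv0, ?_⟩
  rwa [H1.eq_zero_of_forall_radial (action_comp c α ω) (H1.mem_radial_iff.2 hv) h2
    fun w hw ↦ ?_] at h2
  simp only [_root_.sub_apply, _root_.smul_apply, smul_eq_mul, h w hw]
  field_simp
  ring

/-- The action attains its minimum on the radial Nehari manifold, at radial solutions. -/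
theorem exists_isLeast_action (hd : 3 ≤ d) (hα : 2 < α + 2)
    (hα' : α + 2 < 2 * d / ((d : ℝ) - 2)) (hsymm : ∀ v w, B v w = B w v) {δ : ℝ} (hδ : 0 < δ)
    (hcoer : ∀ v, δ * ‖v‖ ^ 2 ≤ B v v)
    (hB : ∀ v, B v v = hardy c v + ω * ∫ x, ‖H1.toFun v x‖ ^ 2) :
    ∃ m, IsLeast (action c α ω '' radialNehari d c α ω) m ∧
      ∀ v ∈ radialNehari d c α ω, action c α ω v = m → v ∈ radialSolutions d c α ω := by
  obtain ⟨u₀, hu₀, hu₀ne⟩ := exists_radial_not_ae_zero d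
  have h := exists_isLeast_nehari hsymm hδ hcoer hα (H1.radial d)
    (fun v w C hv hweak ↦ tendsto_potential hd hα hα' hv hweak)
    (fun s v hs ↦ potential_smul hs v) hu₀ (potential_pos hd hα hα' hu₀ne)
  have hset : radialNehari d c α ω
      = {v | v ∈ H1.radial d ∧ v ≠ 0 ∧ B v v - potential (α + 2) v = 0} := by
    ext v
    simp only [radialNehari, mem_ofPred_eq, H1.mem_radial_iff, nehari_eq hB]
  refine h.elim fun m hm ↦ ⟨m, by rw [hset, action_eq hB]; exact hm.1, ?_⟩
  rintro v ⟨hv, hv0, hv'⟩ hvm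
  rw [nehari_eq hB] at hv'
  rw [action_eq hB] at hvm
  refine (exists_hasFDerivAt_potential hd hα hα' v).elim fun D hD ↦ ?_
  exact mem_radialSolutions_of_forall_radial (by linarith) hsymm hB hv hv0 hD
    (hm.2 v (H1.mem_radial_iff.2 hv) hv0 hv' hvm D hD)

/-- A pure order argument: solutions lie on the Nehari manifold and its minimizers are solutions, so
minimizing over either set gives the same value and the same points. -/
theorem radialGroundStates_eq {m : ℝ} (hm : IsLeast (action c α ω '' radialNehari d c α ω) m)
    (hsol : radialSolutions d c α ω ⊆ radialNehari d c α ω)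
    (hcrit : ∀ v ∈ radialNehari d c α ω, action c α ω v = m → v ∈ radialSolutions d c α ω) :
    radialGroundStates d c α ω = {v : H1 d | v ∈ H1rad d ∧ v ≠ 0 ∧
      action c α ω v = dRad d c α ω ∧ nehari c α ω v = 0} := by
  have hdm : dRad d c α ω = m := hm.csInf_eq
  obtain ⟨u, hu, hum⟩ := hm.1
  ext v
  refine ⟨fun ⟨hv, hmv⟩ ↦ ?_, fun ⟨hv, hv0, hvm, hvK⟩ ↦ ?_⟩
  · obtain ⟨h1, h2, h3⟩ := hsol hv
    refine ⟨h1, h2, ?_, h3⟩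
    rw [hdm]
    exact le_antisymm ((hmv u (hcrit u hu hum)).trans_eq hum) (hm.2 ⟨v, hsol hv, rfl⟩)
  · rw [hdm] at hvm
    exact ⟨hcrit v ⟨hv, hv0, hvK⟩ hvm, fun w hw ↦ hvm.trans_le (hm.2 ⟨w, hsol hw, rfl⟩)⟩

theorem integrable_hardy (hd : 3 ≤ d) (v : H1 d) :
    Integrable (fun x ↦ ‖(‖x‖⁻¹ : ℝ) • H1.toFun v x‖ ^ 2) := by
  obtain ⟨W, hW, -⟩ := H1.exists_hardyMap hd
  refine ((Lp.memLp (W v)).integrable_norm_pow two_ne_zero).congr ?_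
  filter_upwards [hW v] with x hx
  rw [hx]

end GroundStates

end InverseSquareNLS

theorem proposition1p2 (d : ℕ) (hd : 3 ≤ d) (c : ℝ) (hc0 : c ≠ 0)
    (hc : c < (((d : ℝ) - 2) / 2) ^ 2) (α : ℝ) (hα1 : 4 / (d : ℝ) < α)
    (hα2 : α < 4 / ((d : ℝ) - 2)) (ω : ℝ) (hω : 0 < ω) :
    -- the integrals in the action and in the Nehari functional are finite
    (∀ v : InverseSquareNLS.H1 d,
      Integrable (fun x ↦ ‖(‖x‖⁻¹ : ℝ) • InverseSquareNLS.H1.toFun v x‖ ^ 2) ∧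
      Integrable (fun x ↦ ‖InverseSquareNLS.H1.toFun v x‖ ^ (α + 2))) ∧
    -- the Nehari functional is the derivative of the action along dilations of the values
    (∀ v : InverseSquareNLS.H1 d,
      HasDerivAt (fun s : ℝ ↦ InverseSquareNLS.action c α ω (s • v))
        (InverseSquareNLS.nehari c α ω v) 1) ∧
    -- `d(rad, ω)` is a genuine infimum
    IsGLB (InverseSquareNLS.action c α ω '' InverseSquareNLS.radialNehari d c α ω)
      (InverseSquareNLS.dRad d c α ω) ∧
    -- radial ground states exist, and they are the minimizers on the radial Nehari manifold
    (InverseSquareNLS.radialGroundStates d c α ω).Nonempty ∧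
    InverseSquareNLS.radialGroundStates d c α ω =
      {v : InverseSquareNLS.H1 d | v ∈ InverseSquareNLS.H1rad d ∧ v ≠ 0 ∧
        InverseSquareNLS.action c α ω v = InverseSquareNLS.dRad d c α ω ∧
        InverseSquareNLS.nehari c α ω v = 0} := by
  have hd3 : (3 : ℝ) ≤ d := by exact_mod_cast hd
  have hd2 : (0 : ℝ) < (d : ℝ) - 2 := by linarith
  have hα0 : 0 < α := lt_trans (by positivity) hα1
  have hp : 2 < α + 2 := by linarith
  have hp0 : 0 < α + 2 := by linarith
  -- The upper bound on `α` is exactly energy subcriticality, since `2d/(d-2) = 4/(d-2) + 2`.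
  have hp' : α + 2 < 2 * d / ((d : ℝ) - 2) := by
    have : 2 * d / ((d : ℝ) - 2) = 4 / ((d : ℝ) - 2) + 2 := by
      field_simp
      ring
    linarith
  refine (InverseSquareNLS.exists_energyForm hd hc hω).elim fun B hB ↦ hB.2.2.elim fun δ hδ ↦ ?_
  have hsol : InverseSquareNLS.radialSolutions d c α ω ⊆ InverseSquareNLS.radialNehari d c α ω :=
    InverseSquareNLS.radialSolutions_subset_radialNehari hp0 hB.1
  obtain ⟨m, hm, hcrit⟩ :=
    InverseSquareNLS.exists_isLeast_action hd hp hp' hB.2.1 hδ.1 hδ.2 hB.1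
  have hdm : InverseSquareNLS.dRad d c α ω = m := hm.csInf_eq
  have hground := InverseSquareNLS.radialGroundStates_eq hm hsol hcrit
  refine ⟨fun v ↦ ⟨InverseSquareNLS.integrable_hardy hd v,
    InverseSquareNLS.integrable_norm_rpow_toFun hd hp hp' v⟩,
    InverseSquareNLS.hasDerivAt_action_smul hp0 hB.1, ?_, ?_, hground⟩
  · rw [hdm]
    exact hm.isGLB
  · rw [hground, hdm]
    obtain ⟨u, ⟨h1, h2, h3⟩, hum⟩ := hm.1
    exact ⟨u, h1, h2, hum, h3⟩
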